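/- Let $\mathbb M$ be Minkowski spacetime with one time and $s\ge 1$ space dimensions, and let $O\mapsto\mathfrak A(O)$ be a net of unital $C^*$-algebras over the open double cones of $\mathbb M$: closed unital $*$-subalgebras of a unital $C^*$-algebra $\mathfrak A$ with $\mathfrak A(O_1)\subseteq\mathfrak A(O_2)$ for $O_1\subseteq O_2$ and $\bigcup_O\mathfrak A(O)$ dense in $\mathfrak A$. Let $\mathfrak A(O')$ be the $C^*$-algebra generated by all $\mathfrak A(O_1)$ with $O_1$ spacelike separated from $O$. Let $\omega_0$ be a state of $\mathfrak A$ with GNS representation $(H_0,\pi_0)$, and assume: * microcausality: $\mathfrak A(O_1)$ and $\mathfrak A(O_2)$ commute if $O_1,O_2$ are spacelike separated; * property B: if $\overline{O_1}\subseteq O_2$ and $E\ne 0$ is a projection in $\pi_0(\mathfrak A(O_1))''$, then $E=VV^*$ for an isometry $V\in\pi_0(\mathfrak A(O_2))''$; * Haag duality: $\pi_0(\mathfrak A(O'))'=\pi_0(\mathfrak A(O))''$ for every double cone $O$; * $H_0$ is separable; * nontriviality: $\pi_0(\mathfrak A(O))\neq\mathbb C I$ for every double cone $O$. Let $(\pi,H,\mathfrak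 F,(G,k))$ be a field system with gauge symmetry for $(\mathfrak A,\omega_0)$. That is: $(H,\pi)$ is a representation of $\mathfrak A$; $O\mapsto\mathfrak F(O)$ is an isotonous net of von Neumann algebras acting irreducibly on $H$; $G$ is a strongly compact group of unitaries on $H$; $k\in G$ is central with $k^2=I$; there is an isometry $V:H_0\to H$ with $V\pi_0(A)=\pi(A)V$ for all $A\in\mathfrak A$, whose values are $G$-invariant vectors; for all $O$ and $g\in G$, $g\mathfrak F(O)g^*=\mathfrak F(O)$, and $\pi(\mathfrak A(O))''$ is the set of fixed points of $G$ in $\mathfrak F(O)$; $V(H_0)$ is cyclic for each $\mathfrak F(O)$; and $\mathfrak F(O_1)$ commutes with $\pi(\mathfrak A(O_2))$ whenever $O_1,O_2$ are spacelike separated. All representations are unital. A representation $(K,\phi)$ of $\mathfrak A$ is a *DHR representation* if for every double cone $O$ the restrictions of $\phi$ and $\pi_0$ to $\mathfrak A(O')$ are unitarily equivalent. $DHR(\mathfrak A)$ is the category of DHR representations with bounded intertwiners, and $\mathrm{Rep}_{\mathfrak F}\mathfrak A$ is the category of the nonzero subrepresentations of $(H,\pi)$ on separable Hilbert spaces, with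 bounded intertwiners. Then: 1. A subrepresentation $(K,\phi)$ of $(H,\pi)$ is a DHR representation if and only if $K$ is nonzero and separable. If $(K,\phi)$ is irreducible or, more generally, a direct sum of finitely many irreducible representations, then $K$ is separable. 2. There is a faithful functor $\mathrm{Rep}_{\mathfrak F}\mathfrak A\to DHR(\mathfrak A)$ which is the identity on objects and arrows. 3. Suppose moreover that $\pi_0$ is injective and $\pi_0(\mathfrak A(O))''=\pi_0(\mathfrak A(O))$ for every double cone $O$. Let $\Delta$ be the category of localized transportable endomorphisms of $\mathfrak A$. Its objects are the unital $*$-endomorphisms $\rho$ of $\mathfrak A$ that are localized in some double cone $O$ (that is, $\rho(A)=A$ for $A\in\mathfrak A(O')$) and such that for each double cone $O_1$ there are a $*$-endomorphism $\rho_1$ localized in $O_1$ and a unitary $U\in\mathfrak A$ with $U\rho(A)=\rho_1(A)U$ for all $A\in\mathfrak A$. Its arrows are $\mathrm{Hom}(\rho,\sigma)=\{T\in\mathfrak A: T\rho(A)=\sigma(A)T\ \forall A\in\mathfrak A\}$. Let $\Delta_f$ be the full subcategory of those $\rho\in\Delta$ that have a conjugate, i.e. for which there are $\bar\rho\in\Delta$,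 $r\in\mathrm{Hom}(\mathrm{id},\bar\rho\rho)$ and $\bar r\in\mathrm{Hom}(\mathrm{id},\rho\bar\rho)$ with $\bar r^*\rho(r)=I=r^*\bar\rho(\bar r)$. Then there is a faithful functor $\Phi:\mathrm{Rep}_{\mathfrak F}\mathfrak A\to\Delta$ such that $\pi_0\circ\Phi(X)$ is unitarily equivalent to $X$, naturally in $X$, and $\Phi$ restricts to a faithful functor into $\Delta_f$ on the full subcategory of those $X$ that are direct sums of finitely many irreducible representations. -/

import Mathlib

open CategoryTheory TopologicalSpace

universe u v

noncomputable section

/-! ## Minkowski spacetime and double cones -/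

/-- Minkowski spacetime with one time and `s` space dimensions (first component: time). -/
abbrev Minkowski (s : ℕ) : Type := ℝ × EuclideanSpace ℝ (Fin s)

/-- `y` lies in the open (timelike) future of `x`. -/
def Precedes {s : ℕ} (x y : Minkowski s) : Prop := ‖y.2 - x.2‖ < y.1 - x.1

/-- Two points are spacelike separated. -/
def SpacelikePts {s : ℕ} (x y : Minkowski s) : Prop := |y.1 - x.1| < ‖y.2 - x.2‖

/-- The open double cones: the points to the future of `x` and to the past of `y`,
where `y` is to the future of `x`. -/
def DoubleCone (s : ℕ) : Type :=
  {O : Set (Minkowski s) // ∃ x y, Precedes x y ∧ O = {z | Precedes x z ∧ Precedes z y}}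

/-- Spacelike separation of double cones. -/
def SpacelikeSep {s : ℕ} (O₁ O₂ : DoubleCone s) : Prop :=
  ∀ x ∈ O₁.1, ∀ y ∈ O₂.1, SpacelikePts x y

/-! ## Nets of observables -/

/-- A net of observable algebras: local unital C*-subalgebras of the C*-algebra `A`, which is
their inductive limit (the quasilocal algebra). -/
structure ObservableNet (s : ℕ) (A : Type u) [CStarAlgebra A] where
  alg : DoubleCone s → StarSubalgebra ℂ A
  closed : ∀ O, IsClosed (alg O : Set A)
  isotony : ∀ O₁ O₂ : DoubleCone s, O₁.1 ⊆ O₂.1 → alg O₁ ≤ alg O₂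
  quasilocal : Dense (⋃ O, (alg O : Set A))

section Net

variable {s : ℕ} {A : Type u} [CStarAlgebra A]

/-- The C*-algebra `A(O')` of the spacelike complement of `O`, generated by the algebras of the
double cones that are spacelike separated from `O`. -/
def ObservableNet.compl (N : ObservableNet s A) (O : DoubleCone s) : StarSubalgebra ℂ A :=
  (⨆ O₁ : {O₁ : DoubleCone s // SpacelikeSep O₁ O}, N.alg O₁.1).topologicalClosure

def ObservableNet.Microcausality (N : ObservableNet s A) : Prop :=
  ∀ O₁ O₂, SpacelikeSep O₁ O₂ → ∀ a ∈ N.alg O₁, ∀ b ∈ N.alg O₂, a * b = b * a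

end Net

/-! ## Representations -/

/-- A (unital) representation of the C*-algebra `A` on a Hilbert space. -/
structure Repn (A : Type u) [CStarAlgebra A] where
  carrier : Type v
  [normed : NormedAddCommGroup carrier]
  [inner : InnerProductSpace ℂ carrier]
  [complete : CompleteSpace carrier]
  hom : A →⋆ₐ[ℂ] (carrier →L[ℂ] carrier)

attribute [instance] Repn.normed Repn.inner Repn.complete

namespace Repn

variable {A : Type u} [CStarAlgebra A]

/-- Bounded intertwining operators. -/
@[ext]
structure Hom (X Y : Repn.{u, v} A) where
  op : X.carrier →L[ℂ] Y.carrier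
  comm : ∀ a, op.comp (X.hom a) = (Y.hom a).comp op

/-- The category of representations with bounded intertwiners. -/
instance : Category (Repn.{u, v} A) where
  Hom := Hom
  id X := ⟨ContinuousLinearMap.id ℂ X.carrier, fun _ => rfl⟩
  comp f g := ⟨g.op.comp f.op, fun a => by
    rw [ContinuousLinearMap.comp_assoc, f.comm, ← ContinuousLinearMap.comp_assoc, g.comm,
      ContinuousLinearMap.comp_assoc]⟩

/-- `X` is a subrepresentation of `Y`: there is an intertwining isometry. -/
def IsSubrep (X Y : Repn.{u, v} A) : Prop :=
  ∃ W : X.carrier →ₗᵢ[ℂ] Y.carrier, ∀ a x, Y.hom a (W x) = W (X.hom a x)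

/-- Irreducibility: the space is nonzero and the commutant consists of the scalars. -/
def IsIrreducible (X : Repn.{u, v} A) : Prop :=
  Nontrivial X.carrier ∧
    ∀ T : X.carrier →L[ℂ] X.carrier, (∀ a, T * X.hom a = X.hom a * T) → ∃ c : ℂ, T = c • 1

/-- `X` is a direct sum of finitely many irreducible representations, embedded in `X` by
intertwining isometries whose range projections add up to the identity. -/
def IsFiniteSum (X : Repn.{u, v} A) : Prop :=
  ∃ (n : ℕ) (Y : Fin n → Repn.{u, v} A) (w : ∀ i, Hom (Y i) X),
    (∀ i, (Y i).IsIrreducible) ∧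
    (∀ i, (ContinuousLinearMap.adjoint (w i).op).comp (w i).op = ContinuousLinearMap.id ℂ _) ∧
    ∑ i, (w i).op.comp (ContinuousLinearMap.adjoint (w i).op) = ContinuousLinearMap.id ℂ _

end Repn

/-- The bicommutant of a set of bounded operators. -/
def bicommutant {H : Type v} [NormedAddCommGroup H] [InnerProductSpace ℂ H]
    (S : Set (H →L[ℂ] H)) : Set (H →L[ℂ] H) :=
  Set.centralizer (Set.centralizer S)

/-- Property B for a net of algebras of operators: if the closure of `O₁` lies in `O₂`, every
nonzero projection `E` of `R O₁` is `V V*` for an isometry `V` of `R O₂`. -/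
def PropertyB {s : ℕ} {H : Type v} [NormedAddCommGroup H] [InnerProductSpace ℂ H]
    [CompleteSpace H] (R : DoubleCone s → Set (H →L[ℂ] H)) : Prop :=
  ∀ O₁ O₂ : DoubleCone s, closure O₁.1 ⊆ O₂.1 →
    ∀ E ∈ R O₁, IsStarProjection E → E ≠ 0 → ∃ V ∈ R O₂, star V * V = 1 ∧ V * star V = E

/-- A state of a unital C*-algebra. -/
structure IsState {A : Type u} [CStarAlgebra A] (ω : A →ₗ[ℂ] ℂ) : Prop where
  nonneg : ∀ a, 0 ≤ (ω (star a * a)).re ∧ (ω (star a * a)).im = 0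
  map_one : ω 1 = 1

/-- `(X, Ω)` is the GNS representation of `ω` (unique up to unitary equivalence). -/
structure IsGNS {A : Type u} [CStarAlgebra A] (ω : A →ₗ[ℂ] ℂ) (X : Repn.{u, v} A)
    (Ω : X.carrier) : Prop where
  norm_eq : ‖Ω‖ = 1
  state_eq : ∀ a, ω a = inner ℂ Ω (X.hom a Ω)
  cyclic : Dense (Set.range fun a => X.hom a Ω)

section Vacuum

variable {s : ℕ} {A : Type u} [CStarAlgebra A]

/-- The local algebra `π(A(O))''` of a representation `π`. -/
def localVN (N : ObservableNet s A) (X : Repn.{u, v} A) (O : DoubleCone s) :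
    Set (X.carrier →L[ℂ] X.carrier) :=
  bicommutant (X.hom '' (N.alg O : Set A))

/-- Haag duality: `π(A(O'))' = π(A(O))''` for every double cone. -/
def HaagDuality (N : ObservableNet s A) (X : Repn.{u, v} A) : Prop :=
  ∀ O, Set.centralizer (X.hom '' (N.compl O : Set A)) = localVN N X O

/-- No local algebra is represented by scalars only. -/
def Nontriviality (N : ObservableNet s A) (X : Repn.{u, v} A) : Prop :=
  ∀ O, ∃ a ∈ N.alg O, ∀ c : ℂ, X.hom a ≠ c • 1

/-- DHR representations with respect to the vacuum representation `π₀`: for every double cone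
`O`, the restrictions to `A(O')` of the two representations are unitarily equivalent. -/
def IsDHR (N : ObservableNet s A) (π₀ : Repn.{u, v} A) : ObjectProperty (Repn.{u, v} A) :=
  fun X => ∀ O : DoubleCone s, ∃ U : X.carrier ≃ₗᵢ[ℂ] π₀.carrier,
    ∀ a ∈ N.compl O, ∀ x, U (X.hom a x) = π₀.hom a (U x)

/-! ## Field systems -/

/-- A field system with gauge symmetry `(π, H, F, (G, k))` over the vacuum representation `π₀`;
`(H, π)` is the field `rep`. -/
structure FieldSystem (N : ObservableNet s A) (π₀ : Repn.{u, v} A) where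
  rep : Repn.{u, v} A
  field : DoubleCone s → VonNeumannAlgebra rep.carrier
  isotony : ∀ O₁ O₂ : DoubleCone s, O₁.1 ⊆ O₂.1 → ∀ T ∈ field O₁, T ∈ field O₂
  irreducible : ∀ T : rep.carrier →L[ℂ] rep.carrier,
    (∀ O, ∀ S ∈ field O, T * S = S * T) → ∃ c : ℂ, T = c • 1
  gauge : Subgroup (unitary (rep.carrier →L[ℂ] rep.carrier))
  /-- `G` is compact in the strong operator topology, i.e. for pointwise convergence. -/
  compact : IsCompact ((fun (g : unitary (rep.carrier →L[ℂ] rep.carrier)) (x : rep.carrier) =>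
    (g : rep.carrier →L[ℂ] rep.carrier) x) '' (gauge : Set (unitary _)))
  k : unitary (rep.carrier →L[ℂ] rep.carrier)
  k_mem : k ∈ gauge
  k_central : ∀ g ∈ gauge, k * g = g * k
  k_sq : k * k = 1
  /-- The vacuum representation is a subrepresentation, -/
  vac : π₀.carrier →ₗᵢ[ℂ] rep.carrier
  vac_intertwines : ∀ a x, vac (π₀.hom a x) = rep.hom a (vac x)
  /-- by gauge invariant vectors. -/
  vac_invariant : ∀ g ∈ gauge, ∀ x, (g : rep.carrier →L[ℂ] rep.carrier) (vac x) = vac x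
  /-- `G` acts on each `F(O)` by automorphisms, -/
  gauge_field : ∀ g ∈ gauge, ∀ O, ∀ T ∈ field O,
    (g : rep.carrier →L[ℂ] rep.carrier) * T * star (g : rep.carrier →L[ℂ] rep.carrier) ∈ field O
  /-- with fixed point algebra `π(A(O))''`. -/
  fixed_points : ∀ O, localVN N rep O =
    {T | T ∈ field O ∧ ∀ g ∈ gauge,
      (g : rep.carrier →L[ℂ] rep.carrier) * T * star (g : rep.carrier →L[ℂ] rep.carrier) = T}
  /-- The vacuum subspace is cyclic for every `F(O)`. -/
  cyclic : ∀ O, Dense (Submodule.span ℂ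
    {y : rep.carrier | ∃ T ∈ field O, ∃ x, y = T (vac x)} : Set rep.carrier)
  /-- The fields are local relative to the observables. -/
  relative_locality : ∀ O₁ O₂, SpacelikeSep O₁ O₂ → ∀ T ∈ field O₁, ∀ a ∈ N.alg O₂,
    T * rep.hom a = rep.hom a * T

/-- The nonzero subrepresentations of `π` on separable Hilbert spaces, as objects of the category
of representations of `A`. -/
def FieldSystem.RepF {N : ObservableNet s A} {π₀ : Repn.{u, v} A} (𝓕 : FieldSystem N π₀) :
    ObjectProperty (Repn.{u, v} A) :=
  fun X => X.IsSubrep 𝓕.rep ∧ Nontrivial X.carrier ∧ SeparableSpace X.carrier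

/-- Those which are direct sums of finitely many irreducible representations. -/
def FieldSystem.RepFfin {N : ObservableNet s A} {π₀ : Repn.{u, v} A} (𝓕 : FieldSystem N π₀) :
    ObjectProperty (Repn.{u, v} A) :=
  fun X => 𝓕.RepF X ∧ X.IsFiniteSum

theorem FieldSystem.repFfin_le {N : ObservableNet s A} {π₀ : Repn.{u, v} A}
    (𝓕 : FieldSystem N π₀) : 𝓕.RepFfin ≤ 𝓕.RepF :=
  fun _ h => h.1

/-! ## Localized transportable endomorphisms -/

/-- `ρ` is localized in `O`. -/
def IsLocalizedIn (N : ObservableNet s A) (ρ : A →⋆ₐ[ℂ] A) (O : DoubleCone s) : Prop :=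
  ∀ a ∈ N.compl O, ρ a = a

/-- `t` belongs to `Hom(ρ, σ)`. -/
def Intertwines (ρ σ : A →⋆ₐ[ℂ] A) (t : A) : Prop := ∀ a, t * ρ a = σ a * t

def IsTransportable (N : ObservableNet s A) (ρ : A →⋆ₐ[ℂ] A) : Prop :=
  ∀ O₁ : DoubleCone s, ∃ ρ₁ : A →⋆ₐ[ℂ] A, IsLocalizedIn N ρ₁ O₁ ∧
    ∃ U ∈ unitary A, Intertwines ρ ρ₁ U

/-- The objects of the category `Δ`: localized transportable endomorphisms of `A`. -/
structure Delta (N : ObservableNet s A) where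
  endo : A →⋆ₐ[ℂ] A
  localized : ∃ O, IsLocalizedIn N endo O
  transportable : IsTransportable N endo

namespace Delta

variable {N : ObservableNet s A}

/-- Arrows of `Δ`: intertwiners in `A`. -/
@[ext]
structure Hom (ρ σ : Delta N) where
  elt : A
  comm : Intertwines ρ.endo σ.endo elt

instance : Category (Delta N) where
  Hom := Hom
  id ρ := ⟨1, fun a => by rw [one_mul, mul_one]⟩
  comp f g := ⟨g.elt * f.elt, fun a => by
    rw [mul_assoc, f.comm, ← mul_assoc, g.comm, mul_assoc]⟩
  id_comp f := Hom.ext (mul_one _)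
  comp_id f := Hom.ext (one_mul _)
  assoc f g h := Hom.ext (mul_assoc _ _ _).symm

/-- The tensor product `S × T = S ρ(T)` of arrows, where `ρ` is the source of `S`; on objects the
tensor product is the composition of endomorphisms, with unit object the identity. -/
def tensorArrow (ρ : A →⋆ₐ[ℂ] A) (S T : A) : A := S * ρ T

/-- A solution of the conjugate equations for `ρ`: arrows `r : ι ⟶ σ ⊗ ρ` and `r' : ι ⟶ ρ ⊗ σ`
with `(r'* ⊗ id_ρ) ∘ (id_ρ ⊗ r) = id_ρ` and `(r* ⊗ id_σ) ∘ (id_σ ⊗ r') = id_σ`. -/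
structure IsConjugate (ρ σ : Delta N) (r r' : A) : Prop where
  arrow : Intertwines (StarAlgHom.id ℂ A) (σ.endo.comp ρ.endo) r
  arrow' : Intertwines (StarAlgHom.id ℂ A) (ρ.endo.comp σ.endo) r'
  eq : tensorArrow (ρ.endo.comp σ.endo) (star r') 1 * tensorArrow ρ.endo 1 r = 1
  eq' : tensorArrow (σ.endo.comp ρ.endo) (star r) 1 * tensorArrow σ.endo 1 r' = 1

/-- The objects of `Δ_f`: those of finite dimension, i.e. those which have a conjugate. -/
def finite (N : ObservableNet s A) : ObjectProperty (Delta N) :=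
  fun ρ => ∃ (σ : Delta N) (r r' : A), IsConjugate ρ σ r r'

/-- The functor `ρ ↦ π₀ ∘ ρ`, `t ↦ π₀(t)` from `Δ` to representations of `A`. -/
def toRepn (N : ObservableNet s A) (π₀ : Repn.{u, v} A) : Delta N ⥤ Repn.{u, v} A where
  obj ρ := { carrier := π₀.carrier, hom := π₀.hom.comp ρ.endo }
  map {ρ σ} t := ⟨π₀.hom t.elt, fun a => by
    change π₀.hom t.elt * π₀.hom (ρ.endo a) = π₀.hom (σ.endo a) * π₀.hom t.elt
    rw [← map_mul, t.comm, map_mul]⟩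
  map_id ρ := Repn.Hom.ext (map_one π₀.hom)
  map_comp f g := Repn.Hom.ext (map_mul π₀.hom g.elt f.elt)

end Delta

end Vacuum

end

-- Write `V` for the vacuum isometry. A field `T` in `F(O)` commutes with `π(A(O'))`, so `T V`
-- intertwines the restrictions of `π₀` and `π` to `A(O')`. Since `V(H₀)` is cyclic for `F(O)`, such
-- local intertwiners generate `H`, and composing with the adjoint of an embedding shows the same
-- for every subrepresentation (`LocallyGenerated`).
--
-- Nontriviality and property B put infinitely many isometries with orthogonal ranges into each
-- local vacuum algebra. If `X` is separable, they allow countably many local intertwiners to be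
-- added up without interference to a single one with dense range (`exists_denseRange`). The polar
-- decomposition of its adjoint gives a local isometry from `X` to `H₀`; by Haag duality its range
-- projection belongs to a local von Neumann algebra, and property B turns the isometry into a
-- unitary. Hence `X` is DHR. Separability of irreducibles holds because `A(O)` lies in `A(O₂')` for
-- some `O₂`, so that vectors in the range of an intertwiner for `A(O₂')` stay there under `A(O)`.
--
-- For part 3, Haag duality turns DHR representations into localized endomorphisms and intertwiners
-- into local observables. The hard point is the conjugate. Compactness of `G` places an irreducible
-- `X` in a finite gauge multiplet of intertwiners (`nonempty_multiplet`); averaging a local field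
-- against matrix elements and dividing by an observable gives fields `T i` in `F(O)` with `∑ T i* T
-- i = 1` and `T i π(ρ a) = π(a) T i`, and finite sums follow. The vectors `(T i* V x)_i` generate a
-- subrepresentation of a finite power of `H`, which is DHR by the first argument and so is given by
-- an endomorphism `σ`. There is `r` with `∑ T i π(a) T i* = π(r* σ(a) r)`, and uniqueness of the
-- Stinespring dilation yields `Q i` with `Q i π(σ a) = π(a) Q i` and `Q i π(r) = T i*`. The
-- restriction `q` of `∑ Q i T i` to the vacuum satisfies `q ρ(r) = 1` and `σ(q) r = 1`, which are
-- the conjugate equations.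

open scoped InnerProduct

/-! ## Operators on Hilbert spaces -/

section HilbertSpace

variable {E F G : Type*} [NormedAddCommGroup E] [InnerProductSpace ℂ E] [CompleteSpace E]
  [NormedAddCommGroup F] [InnerProductSpace ℂ F] [CompleteSpace F]
  [NormedAddCommGroup G] [InnerProductSpace ℂ G] [CompleteSpace G]

/-- Continuous extension of a linear map that is bounded relative to another one, by zero on the
orthogonal complement of the range of the latter. -/
theorem exists_extension {D : Type*} [AddCommGroup D] [Module ℂ D] (C : D →ₗ[ℂ] F)
    (R : D →ₗ[ℂ] G) (M : ℝ) (h : ∀ y, ‖R y‖ ≤ M * ‖C y‖) :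
    ∃ T : F →L[ℂ] G, (∀ y, T (C y) = R y) ∧ ∀ z ∈ (LinearMap.range C)ᗮ, T z = 0 := by
  let K : Submodule ℂ F := (LinearMap.range C).topologicalClosure
  have : CompleteSpace K := (Submodule.isClosed_topologicalClosure _).completeSpace_coe
  have hK : ∀ y, C y ∈ K := fun y => Submodule.le_topologicalClosure _ ⟨y, rfl⟩
  let C' : D →ₗ[ℂ] K := C.codRestrict K hK
  have hd : DenseRange C' := by
    intro z
    rw [Metric.mem_closure_range_iff]
    intro ε hε
    have hz : (z : F) ∈ closure (Set.range C) := z.2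
    obtain ⟨y, hy⟩ := Metric.mem_closure_range_iff.1 hz ε hε
    exact ⟨y, hy⟩
  refine ⟨(R.extendOfNorm C').comp K.orthogonalProjectionOnto, fun y => ?_, fun z hz => ?_⟩
  · have h1 : K.orthogonalProjectionOnto (C y) = C' y :=
      Submodule.orthogonalProjectionOnto_mem_subspace_eq_self (C' y)
    rw [ContinuousLinearMap.comp_apply, h1]
    exact LinearMap.extendOfNorm_eq hd ⟨M, h⟩ y
  · have h1 : K.orthogonalProjectionOnto z = 0 := by
      rw [Submodule.orthogonalProjectionOnto_eq_zero_iff]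
      rwa [Submodule.orthogonal_closure]
    rw [ContinuousLinearMap.comp_apply, h1, map_zero]

theorem ext_of_denseRange {D : Type*} {T S : F →L[ℂ] G} {C : D → F} (hC : DenseRange C)
    (h : ∀ x, T (C x) = S (C x)) : T = S :=
  ContinuousLinearMap.coeFn_injective
    (hC.equalizer T.continuous S.continuous (funext h))

theorem denseRange_of_adjoint_injective (T : E →L[ℂ] F) (h : Function.Injective (T†)) :
    DenseRange T := by
  have h1 : (LinearMap.range (T : E →ₗ[ℂ] F))ᗮ = ⊥ := by
    rw [eq_bot_iff]
    intro z hz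
    rw [Submodule.mem_orthogonal] at hz
    apply h
    rw [map_zero]
    apply ext_inner_left ℂ
    intro x
    rw [ContinuousLinearMap.adjoint_inner_right, inner_zero_right]
    exact hz _ ⟨x, rfl⟩
  have h2 := Submodule.dense_iff_topologicalClosure_eq_top.2
    (Submodule.topologicalClosure_eq_top_iff.2 h1)
  exact h2

theorem adjoint_injective_of_denseRange (T : E →L[ℂ] F) (h : DenseRange T) :
    Function.Injective (T†) := by
  rw [injective_iff_map_eq_zero]
  intro z hz
  have : ∀ y, inner ℂ y z = (0 : ℂ) := by
    intro y
    refine congrFun (h.equalizer (g := fun y => inner ℂ y z) (h := fun _ => (0 : ℂ))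
      (by fun_prop) (by fun_prop) (funext fun x => ?_)) y
    simp only [Function.comp]
    rw [← ContinuousLinearMap.adjoint_inner_right, hz, inner_zero_right]
  exact inner_self_eq_zero.1 (this z)

/-- The isometric part of the polar decomposition of an injective operator. -/
theorem exists_polar_isometry (J : E →L[ℂ] F) (hJ : Function.Injective J) :
    ∃ u : E →ₗᵢ[ℂ] F, ∀ (S : E →L[ℂ] E) (S' : F →L[ℂ] F), (∀ x, J (S x) = S' (J x)) →
      (∀ x, J (star S x) = star S' (J x)) → ∀ x, u (S x) = S' (u x) := by
  set P : E →L[ℂ] E := J† ∘L J with hP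
  have hP0 : 0 ≤ P := (ContinuousLinearMap.nonneg_iff_isPositive _).2
    (ContinuousLinearMap.isPositive_adjoint_comp_self J)
  set Q : E →L[ℂ] E := CFC.sqrt P with hQ
  have hQQ : Q * Q = P := CFC.sqrt_mul_sqrt_self P hP0
  have hQs : star Q = Q := (IsSelfAdjoint.of_nonneg (CFC.sqrt_nonneg P)).star_eq
  have hnorm : ∀ x, ‖J x‖ = ‖Q x‖ := by
    intro x
    have h1 : (inner ℂ (J x) (J x) : ℂ) = inner ℂ (Q x) (Q x) := by
      rw [← ContinuousLinearMap.adjoint_inner_right, ← ContinuousLinearMap.adjoint_inner_right Q,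
        ← ContinuousLinearMap.star_eq_adjoint Q, hQs, ← mul_apply_eq_comp, hQQ]
      rfl
    rw [inner_self_eq_norm_sq_to_K, inner_self_eq_norm_sq_to_K] at h1
    have h2 : ‖J x‖ ^ 2 = ‖Q x‖ ^ 2 := by exact_mod_cast h1
    exact (sq_eq_sq₀ (norm_nonneg _) (norm_nonneg _)).1 h2
  have hQd : DenseRange Q := by
    apply denseRange_of_adjoint_injective
    rw [← ContinuousLinearMap.star_eq_adjoint, hQs, injective_iff_map_eq_zero]
    intro x hx
    have := hnorm x
    rw [hx, norm_zero, norm_eq_zero] at this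
    exact hJ (by rw [this, map_zero])
  -- As `‖J x‖ = ‖Q x‖` and `Q` has dense range, `Q x ↦ J x` extends to an isometry.
  obtain ⟨T, hT, -⟩ := exists_extension (Q : E →ₗ[ℂ] E) (J : E →ₗ[ℂ] F) 1
    (fun y => by simp [hnorm])
  have hT' : ∀ y, T (Q y) = J y := hT
  have hTn : ∀ z, ‖T z‖ = ‖z‖ := by
    intro z
    refine congrFun (hQd.equalizer (g := fun z => ‖T z‖) (h := fun z => ‖z‖)
      (by fun_prop) (by fun_prop) (funext fun x => ?_)) z
    simp only [Function.comp, hT', hnorm]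
  refine ⟨⟨T.toLinearMap, hTn⟩, fun S S' h1 h2 => ?_⟩
  -- The relation for `star S` is what moves `S` past `J†`; then `S` also commutes with the square
  -- root of `J† J`.
  have hPS : Commute P S := by
    ext x
    change (J†) (J (S x)) = S ((J†) (J x))
    rw [h1]
    apply ext_inner_left ℂ
    intro y
    rw [ContinuousLinearMap.adjoint_inner_right, ← ContinuousLinearMap.adjoint_inner_left S,
      ContinuousLinearMap.adjoint_inner_right, ← ContinuousLinearMap.star_eq_adjoint, h2,
      ContinuousLinearMap.star_eq_adjoint, ContinuousLinearMap.adjoint_inner_left]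
  have hQS : Commute Q S := hPS.cfcₙ_nnreal _
  have : T ∘L S = S' ∘L T := by
    refine ext_of_denseRange hQd fun x => ?_
    change T (S (Q x)) = S' (T (Q x))
    have : S (Q x) = Q (S x) := (congrArg (fun f : E →L[ℂ] E => f x) hQS.eq).symm
    rw [this, hT', hT', h1]
  exact fun x => congrArg (fun f : E →L[ℂ] F => f x) this

theorem starProjection_commute (U : Submodule ℂ E) [U.HasOrthogonalProjection]
    (S : E →L[ℂ] E) (h1 : ∀ x ∈ U, S x ∈ U) (h2 : ∀ x ∈ U, star S x ∈ U) (x : E) :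
    U.starProjection (S x) = S (U.starProjection x) := by
  apply Submodule.eq_starProjection_of_mem_of_inner_eq_zero
  · exact h1 _ (U.starProjection_apply_mem x)
  · intro w hw
    rw [← map_sub, ← ContinuousLinearMap.adjoint_inner_right,
      ← ContinuousLinearMap.star_eq_adjoint]
    exact U.starProjection_inner_eq_zero x _ (h2 w hw)

/-- A bounded operator that is not a scalar gives rise to a nontrivial projection in every
commutant which contains it. -/
theorem exists_projection_of_ne_smul (T : E →L[ℂ] E) (hT : ∀ c : ℂ, T ≠ c • 1) :
    ∃ e : E →L[ℂ] E, IsStarProjection e ∧ e ≠ 0 ∧ e ≠ 1 ∧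
      ∀ S : E →L[ℂ] E, S * T = T * S → S * star T = star T * S → S * e = e * S := by
  -- Up to scalar factors, `h` is the real or the imaginary part of `T`; they cannot both be
  -- scalars.
  have key : ∃ h : E →L[ℂ] E, IsSelfAdjoint h ∧ (∀ c : ℂ, h ≠ c • 1) ∧
      ∀ S : E →L[ℂ] E, S * T = T * S → S * star T = star T * S → S * h = h * S := by
    by_cases h1 : ∃ c : ℂ, T + star T = c • (1 : E →L[ℂ] E)
    · obtain ⟨c, hc⟩ := h1
      refine ⟨Complex.I • (T - star T), ?_, fun d hd => ?_, fun S h1 h2 => ?_⟩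
      · rw [isSelfAdjoint_iff, star_smul, star_sub, star_star, Complex.star_def, Complex.conj_I,
          neg_smul, ← smul_neg, neg_sub]
      · apply hT (2⁻¹ * (c + -Complex.I * d))
        have e1 : T - star T = (-Complex.I * d) • (1 : E →L[ℂ] E) := by
          rw [mul_smul, ← hd, smul_smul]
          simp
        have : T = (2⁻¹ : ℂ) • ((T + star T) + (T - star T)) := by
          rw [add_add_sub_cancel, ← two_smul ℂ, smul_smul]
          simp
        rw [this, hc, e1, ← add_smul, smul_smul]
      · rw [mul_smul_comm, smul_mul_assoc, mul_sub, sub_mul, h1, h2]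
    · push Not at h1
      refine ⟨T + star T, IsSelfAdjoint.add_star_self T, h1, fun S h1 h2 => ?_⟩
      rw [mul_add, add_mul, h1, h2]
  obtain ⟨h, hsa, hns, hcomm⟩ := key
  have : Nontrivial (E →L[ℂ] E) := ⟨⟨h, 0, by simpa using hns 0⟩⟩
  obtain ⟨a, ha⟩ := ContinuousFunctionalCalculus.spectrum_nonempty (R := ℝ) h hsa
  have hb : ∃ b ∈ spectrum ℝ h, b ≠ a := by
    by_contra hcon
    push Not at hcon
    apply hns a
    have h1 : cfc (id : ℝ → ℝ) h = cfc (fun _ => a : ℝ → ℝ) h :=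
      cfc_congr fun x hx => hcon x hx
    rw [cfc_id ℝ h hsa, cfc_const a h hsa] at h1
    rw [h1, Algebra.algebraMap_eq_smul_one]
    rfl
  obtain ⟨b, hb, hba⟩ := hb
  obtain ⟨l, hl, r, hr, hlr⟩ : ∃ l ∈ spectrum ℝ h, ∃ r ∈ spectrum ℝ h, l < r := by
    rcases lt_or_gt_of_ne hba with h' | h'
    · exact ⟨b, hb, a, ha, h'⟩
    · exact ⟨a, ha, b, hb, h'⟩
  -- The functions `f` and `g` live on opposite sides of the midpoint of two spectral values. The
  -- kernel of `f(h)` contains the range of `g(h)`, so it is neither zero nor the whole space.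
  set f : ℝ → ℝ := fun x => max (x - (l + r) / 2) 0 with hf
  set g : ℝ → ℝ := fun x => max ((l + r) / 2 - x) 0 with hg
  have hfc : Continuous f := by fun_prop
  have hgc : Continuous g := by fun_prop
  have hf0 : cfc f h ≠ 0 := by
    intro h0
    have h1 := cfc_map_spectrum f h hsa hfc.continuousOn
    rw [h0, spectrum.zero_eq] at h1
    have h2 : f r ∈ ({0} : Set ℝ) := h1 ▸ ⟨r, hr, rfl⟩
    have h3 : f r > 0 := lt_max_of_lt_left (by linarith)
    exact h3.ne' h2
  have hg0 : cfc g h ≠ 0 := by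
    intro h0
    have h1 := cfc_map_spectrum g h hsa hgc.continuousOn
    rw [h0, spectrum.zero_eq] at h1
    have h2 : g l ∈ ({0} : Set ℝ) := h1 ▸ ⟨l, hl, rfl⟩
    have h3 : g l > 0 := lt_max_of_lt_left (by linarith)
    exact h3.ne' h2
  have hfg : cfc f h * cfc g h = 0 := by
    rw [← cfc_mul f g h hfc.continuousOn hgc.continuousOn]
    have : (fun x => f x * g x) = fun _ => 0 := by
      funext x
      rcases le_total x ((l + r) / 2) with h' | h'
      · have : f x = 0 := max_eq_right (by linarith)
        rw [this, zero_mul]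
      · have : g x = 0 := max_eq_right (by linarith)
        rw [this, mul_zero]
    rw [this, cfc_const 0 h hsa, map_zero]
  let U : Submodule ℂ E := LinearMap.ker (cfc f h : E →L[ℂ] E).toLinearMap
  have : CompleteSpace U := (ContinuousLinearMap.isClosed_ker (cfc f h)).completeSpace_coe
  refine ⟨U.starProjection, isStarProjection_starProjection, fun h0 => ?_, fun h1 => ?_, ?_⟩
  · apply hg0
    ext x
    have hx : cfc g h x ∈ U := congrArg (fun t : E →L[ℂ] E => t x) hfg
    rw [← U.starProjection_eq_self_iff.2 hx, h0]
    rfl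
  · apply hf0
    ext x
    have hx : x ∈ U := U.starProjection_eq_self_iff.1 (by rw [h1]; rfl)
    exact hx
  · intro S h1 h2
    have inv : ∀ S : E →L[ℂ] E, S * h = h * S → ∀ x ∈ U, S x ∈ U := by
      intro S hS x hx
      have h3 : Commute (cfc f h) S := Commute.cfc_real (show Commute h S from hS.symm) f
      change cfc f h (S x) = 0
      have h4 : cfc f h (S x) = S (cfc f h x) := congrArg (fun t : E →L[ℂ] E => t x) h3.eq
      rw [h4, show cfc f h x = 0 from hx, map_zero]
    have hS := hcomm S h1 h2
    have hS' : star S * h = h * star S := by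
      have := congrArg star hS
      rw [star_mul, star_mul, hsa.star_eq] at this
      exact this.symm
    ext x
    exact (starProjection_commute U S (inv S hS) (inv _ hS') x).symm

/-- Given isometries `s k` with orthogonal ranges, a closed space of operators into a separable
space, whose ranges are total and which is stable under right multiplication by the `(s k)*`,
contains an operator with dense range. -/
theorem exists_denseRange {Y : Type*} [NormedAddCommGroup Y] [NormedSpace ℂ Y] [CompleteSpace Y]
    [SeparableSpace F] (𝒯 : Submodule ℂ Y) (h𝒯 : IsClosed (𝒯 : Set Y)) (Λ : Y →L[ℂ] (E →L[ℂ] F))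
    (s : ℕ → (E →L[ℂ] E)) (hs : ∀ k, star (s k) * s k = 1)
    (hs' : ∀ k l, k ≠ l → star (s k) * s l = 0)
    (hmul : ∀ t ∈ 𝒯, ∀ k, ∃ t' ∈ 𝒯, Λ t' = Λ t ∘L star (s k))
    (htot : Dense (Submodule.span ℂ {y | ∃ t ∈ 𝒯, ∃ x, y = Λ t x} : Set F)) :
    ∃ t ∈ 𝒯, DenseRange (Λ t) := by
  set D : Set F := {y | ∃ t ∈ 𝒯, ∃ x, y = Λ t x} with hD
  obtain ⟨c, hcD, hc, hcl⟩ := (IsSeparable.of_separableSpace D).exists_countable_dense_subset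
  have hne : c.Nonempty := by
    rw [← closure_nonempty_iff]
    exact ⟨0, hcl ⟨0, 𝒯.zero_mem, 0, by simp⟩⟩
  obtain ⟨f, hf⟩ := hc.exists_eq_range hne
  have hfD : ∀ n, f n ∈ D := fun n => hcD (hf ▸ ⟨n, rfl⟩)
  choose t ht x hx using hfD
  choose t' ht' hΛ using fun n => hmul (t n) (ht n) n
  -- The coefficients must be nonzero and small enough for the series to converge in norm.
  let a : ℕ → ℂ := fun n => (((1 / 2 : ℝ) ^ n / (1 + ‖t' n‖) : ℝ) : ℂ)
  have hpos : ∀ n, 0 < (1 / 2 : ℝ) ^ n / (1 + ‖t' n‖) := fun n => by positivity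
  have ha : ∀ n, a n ≠ 0 := fun n => Complex.ofReal_ne_zero.2 (hpos n).ne'
  have hsum : Summable fun n => a n • t' n := by
    refine Summable.of_norm_bounded summable_geometric_two fun n => ?_
    rw [norm_smul, Complex.norm_real, Real.norm_of_nonneg (hpos n).le, div_mul_eq_mul_div]
    exact (div_le_iff₀ (by positivity)).2
      (mul_le_mul_of_nonneg_left (by linarith [norm_nonneg (t' n)]) (by positivity))
  refine ⟨∑' n, a n • t' n, ?_, ?_⟩
  · refine h𝒯.mem_of_tendsto hsum.hasSum (Filter.Eventually.of_forall fun S => ?_)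
    exact 𝒯.sum_mem fun n _ => 𝒯.smul_mem _ (ht' n)
  · set T := Λ (∑' n, a n • t' n) with hT
    -- Orthogonality of the ranges isolates the `m`-th term, so the range of `T` contains every
    -- vector of the countable dense set.
    have hval : ∀ m y, T (s m y) = a m • Λ (t m) y := by
      intro m y
      have h2 : HasSum (fun n => Λ (a n • t' n) (s m y)) (T (s m y)) :=
        ((ContinuousLinearMap.apply ℂ F (s m y)).comp Λ).hasSum hsum.hasSum
      have h3 : HasSum (fun n => Λ (a n • t' n) (s m y)) (Λ (a m • t' m) (s m y)) := by
        refine hasSum_single m fun n hn => ?_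
        rw [map_smul, smul_apply, hΛ]
        change a n • Λ (t n) ((star (s n) * s m) y) = 0
        rw [hs' n m hn]
        simp
      rw [h2.unique h3, map_smul, smul_apply, hΛ]
      change a m • Λ (t m) ((star (s m) * s m) y) = _
      rw [hs m]
      rfl
    have hmem : c ⊆ (LinearMap.range T.toLinearMap : Set F) := by
      rw [hf]
      rintro _ ⟨n, rfl⟩
      refine ⟨s n ((a n)⁻¹ • x n), ?_⟩
      change T _ = _
      rw [hval, map_smul, smul_smul, mul_inv_cancel₀ (ha n), one_smul, ← hx]
    let K := (LinearMap.range T.toLinearMap).topologicalClosure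
    have hDK : Submodule.span ℂ D ≤ K :=
      Submodule.span_le.2 (hcl.trans (closure_mono hmem))
    have : Dense (K : Set F) := htot.mono hDK
    have hcl2 : IsClosed (K : Set F) := Submodule.isClosed_topologicalClosure _
    intro y
    have : y ∈ (K : Set F) := hcl2.closure_eq ▸ this y
    exact this

end HilbertSpace

/-! ## Double cones -/

section Geometry

variable {s : ℕ}

/-- The double cone with vertices `(c.1 - r, c.2)` and `(c.1 + r, c.2)`. -/
def ballCone (c : Minkowski s) (r : ℝ) (hr : 0 < r) : DoubleCone s :=
  ⟨{z | ‖z.2 - c.2‖ + |z.1 - c.1| < r}, (c.1 - r, c.2), (c.1 + r, c.2), by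
    simp only [Precedes, sub_self, norm_zero]
    linarith, by
    ext z
    simp only [Precedes, Set.mem_ofPred_eq]
    rw [norm_sub_rev c.2 z.2, ← lt_sub_iff_add_lt', abs_lt]
    constructor
    · rintro ⟨h1, h2⟩
      constructor <;> linarith
    · rintro ⟨h1, h2⟩
      constructor <;> linarith⟩

theorem mem_ballCone {c : Minkowski s} {r : ℝ} {hr : 0 < r} {z : Minkowski s} :
    z ∈ (ballCone c r hr).1 ↔ ‖z.2 - c.2‖ + |z.1 - c.1| < r := Iff.rfl

/-- The increasing sequence of double cones centred at the origin. -/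
def bigCone (s : ℕ) (n : ℕ) : DoubleCone s := ballCone 0 (n + 1) (by positivity)

theorem bigCone_mono {m n : ℕ} (h : m ≤ n) : (bigCone s m).1 ⊆ (bigCone s n).1 := by
  intro z hz
  have h' : (m : ℝ) ≤ n := by exact_mod_cast h
  have := mem_ballCone.1 hz
  exact mem_ballCone.2 (by linarith)

theorem exists_subset_bigCone (O : DoubleCone s) : ∃ n, O.1 ⊆ (bigCone s n).1 := by
  obtain ⟨O, x, y, -, rfl⟩ := O
  obtain ⟨n, hn⟩ := exists_nat_ge (max (‖x.2‖ - x.1) (‖y.2‖ + y.1))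
  have h1 := (le_max_left _ _).trans hn
  have h2 := (le_max_right _ _).trans hn
  refine ⟨n, fun z hz => mem_ballCone.2 ?_⟩
  obtain ⟨ha, hb⟩ := hz
  simp only [Precedes] at ha hb
  have h3 : ‖z.2‖ ≤ ‖z.2 - x.2‖ + ‖x.2‖ := by
    simpa using norm_add_le (z.2 - x.2) x.2
  have h4 : ‖z.2‖ ≤ ‖y.2 - z.2‖ + ‖y.2‖ := by
    simpa using norm_sub_le y.2 (y.2 - z.2) |>.trans_eq (add_comm _ _)
  simp only [Prod.fst_zero, Prod.snd_zero, sub_zero]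
  rw [← lt_sub_iff_add_lt', abs_lt]
  constructor <;> linarith

theorem exists_subset_both (O₁ O₂ : DoubleCone s) :
    ∃ O : DoubleCone s, O₁.1 ⊆ O.1 ∧ O₂.1 ⊆ O.1 := by
  obtain ⟨m, hm⟩ := exists_subset_bigCone O₁
  obtain ⟨n, hn⟩ := exists_subset_bigCone O₂
  exact ⟨bigCone s (max m n), hm.trans (bigCone_mono (le_max_left _ _)),
    hn.trans (bigCone_mono (le_max_right _ _))⟩

theorem SpacelikeSep.symm {O₁ O₂ : DoubleCone s} (h : SpacelikeSep O₁ O₂) :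
    SpacelikeSep O₂ O₁ := by
  intro x hx y hy
  have := h y hy x hx
  rwa [SpacelikePts, abs_sub_comm, norm_sub_rev] at this

theorem SpacelikeSep.mono_right {O O₁ O₂ : DoubleCone s} (h : SpacelikeSep O O₂)
    (h' : O₁.1 ⊆ O₂.1) : SpacelikeSep O O₁ :=
  fun x hx y hy => h x hx y (h' hy)

theorem exists_spacelikeSep (hs : 1 ≤ s) (O : DoubleCone s) :
    ∃ O₂ : DoubleCone s, SpacelikeSep O₂ O := by
  obtain ⟨n, hn⟩ := exists_subset_bigCone O
  -- A spatial shift by `n + 2 = (n + 1) + 1`, the sum of the radii of the two cones, makes them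
  -- spacelike separated; a space direction is needed here.
  let e : EuclideanSpace ℝ (Fin s) := EuclideanSpace.single ⟨0, hs⟩ (n + 2 : ℝ)
  have he : ‖e‖ = n + 2 := by
    rw [PiLp.norm_single, Real.norm_of_nonneg (by positivity)]
  refine ⟨ballCone (0, e) 1 one_pos, fun w hw z hz => ?_⟩
  have h1 := mem_ballCone.1 hw
  have h2 := mem_ballCone.1 (hn hz)
  simp only [Prod.fst_zero, Prod.snd_zero, sub_zero] at h1 h2
  have h3 : ‖e‖ ≤ ‖w.2 - e‖ + ‖z.2 - w.2‖ + ‖z.2‖ := by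
    have h4 := norm_add₃_le (a := e - w.2) (b := w.2 - z.2) (c := z.2)
    rw [sub_add_sub_cancel, sub_add_cancel, norm_sub_rev e, norm_sub_rev w.2 z.2] at h4
    exact h4
  have h5 : |z.1 - w.1| ≤ |z.1| + |w.1| := abs_sub _ _
  rw [SpacelikePts]
  linarith

theorem exists_closure_subset (O : DoubleCone s) :
    ∃ O₁ : DoubleCone s, closure O₁.1 ⊆ O.1 := by
  obtain ⟨O, x, y, hxy, rfl⟩ := O
  simp only [Precedes] at hxy
  -- Both vertices move inwards by a third of the axis. The displacement is timelike, and this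
  -- strict inequality absorbs the non-strict ones on the closure.
  have hv : ‖(1 / 3 : ℝ) • (y.2 - x.2)‖ < 1 / 3 * (y.1 - x.1) := by
    rw [norm_smul, Real.norm_of_nonneg (by norm_num)]
    linarith
  set v := (1 / 3 : ℝ) • (y.2 - x.2) with hvdef
  refine ⟨⟨_, (x.1 + 1 / 3 * (y.1 - x.1), x.2 + v), (y.1 - 1 / 3 * (y.1 - x.1), y.2 - v), ?_,
    rfl⟩, ?_⟩
  · simp only [Precedes]
    have : y.2 - v - (x.2 + v) = v := by
      rw [hvdef]
      module
    rw [this]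
    linarith
  · have hcl : IsClosed {z : Minkowski s | ‖z.2 - (x.2 + v)‖ ≤ z.1 - (x.1 + 1 / 3 * (y.1 - x.1)) ∧
        ‖y.2 - v - z.2‖ ≤ y.1 - 1 / 3 * (y.1 - x.1) - z.1} :=
      IsClosed.and (isClosed_le (by fun_prop) (by fun_prop))
        (isClosed_le (by fun_prop) (by fun_prop))
    refine (closure_minimal ?_ hcl).trans ?_
    · rintro z ⟨h1, h2⟩
      exact ⟨le_of_lt h1, le_of_lt h2⟩
    · rintro z ⟨h1, h2⟩
      simp only [Precedes, Set.mem_ofPred_eq]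
      have h3 : ‖z.2 - x.2‖ ≤ ‖z.2 - (x.2 + v)‖ + ‖v‖ := by
        have := norm_add_le (z.2 - (x.2 + v)) v
        rwa [show z.2 - (x.2 + v) + v = z.2 - x.2 by abel] at this
      have h4 : ‖y.2 - z.2‖ ≤ ‖y.2 - v - z.2‖ + ‖v‖ := by
        have := norm_add_le (y.2 - v - z.2) v
        rwa [show y.2 - v - z.2 + v = y.2 - z.2 by abel] at this
      constructor <;> linarith

end Geometry

/-! ## Nets of observables -/

section Observables

variable {s : ℕ} {A : Type u} [CStarAlgebra A] (N : ObservableNet s A)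

theorem ObservableNet.le_compl {O O₁ : DoubleCone s} (h : SpacelikeSep O₁ O) :
    N.alg O₁ ≤ N.compl O :=
  (le_iSup (fun O₁ : {O₁ : DoubleCone s // SpacelikeSep O₁ O} => N.alg O₁.1) ⟨O₁, h⟩).trans
    (StarSubalgebra.le_topologicalClosure _)

theorem ObservableNet.compl_anti {O₁ O₂ : DoubleCone s} (h : O₁.1 ⊆ O₂.1) :
    N.compl O₂ ≤ N.compl O₁ :=
  StarSubalgebra.topologicalClosure_mono
    (iSup_le fun O => le_iSup (fun O : {O : DoubleCone s // SpacelikeSep O O₁} => N.alg O.1)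
      ⟨O.1, O.2.mono_right h⟩)

/-- A closed star subalgebra contains `A(O')` if it contains the algebras of the double cones that
are spacelike separated from `O`. -/
theorem ObservableNet.compl_le {O : DoubleCone s} {B : StarSubalgebra ℂ A}
    (hB : IsClosed (B : Set A)) (h : ∀ O₁, SpacelikeSep O₁ O → N.alg O₁ ≤ B) : N.compl O ≤ B :=
  StarSubalgebra.topologicalClosure_minimal (iSup_le fun O₁ => h O₁.1 O₁.2) hB

theorem ObservableNet.commute_compl (hm : N.Microcausality) {O : DoubleCone s} {a b : A}
    (ha : a ∈ N.alg O) (hb : b ∈ N.compl O) : a * b = b * a := by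
  have : N.compl O ≤ StarSubalgebra.centralizer ℂ (N.alg O : Set A) := by
    refine N.compl_le (Set.isClosed_centralizer _) fun O₁ h b hb => ?_
    rw [StarSubalgebra.mem_centralizer_iff]
    exact fun a ha => ⟨hm O O₁ h.symm a ha b hb, hm O O₁ h.symm _ (star_mem ha) b hb⟩
  exact ((StarSubalgebra.mem_centralizer_iff _).1 (this hb) a ha).1

/-- A closed set that contains all local elements contains everything. -/
theorem ObservableNet.induction_closed {P : A → Prop} (hP : IsClosed {a | P a})
    (h : ∀ O, ∀ a ∈ N.alg O, P a) (a : A) : P a := by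
  have h1 : (⋃ O, (N.alg O : Set A)) ⊆ {a | P a} := by
    intro a ha
    obtain ⟨O, hO⟩ := Set.mem_iUnion.1 ha
    exact h O a hO
  exact closure_minimal h1 hP (N.quasilocal a)

end Observables

/-! ## Local intertwiners -/

section Isometries

variable {E F : Type*} [NormedAddCommGroup E] [InnerProductSpace ℂ E] [CompleteSpace E]
  [NormedAddCommGroup F] [InnerProductSpace ℂ F] [CompleteSpace F]

theorem LinearIsometry.adjoint_apply_self (W : E →ₗᵢ[ℂ] F) (x : E) :
    (W.toContinuousLinearMap†) (W x) = x := by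
  apply ext_inner_left ℂ
  intro y
  rw [ContinuousLinearMap.adjoint_inner_right]
  exact W.inner_map_map y x

/-- A bounded operator with `W* W = 1` and `W W* = 1` is a unitary equivalence. -/
theorem exists_linearIsometryEquiv (W : E →L[ℂ] F) (h1 : ∀ x, (W†) (W x) = x)
    (h2 : ∀ y, W ((W†) y) = y) : ∃ U : E ≃ₗᵢ[ℂ] F, ∀ x, U x = W x := by
  have hn : ∀ x, ‖W x‖ = ‖x‖ := by
    intro x
    have h : (inner ℂ (W x) (W x) : ℂ) = inner ℂ x x := by
      rw [← ContinuousLinearMap.adjoint_inner_right, h1]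
    rw [inner_self_eq_norm_sq_to_K, inner_self_eq_norm_sq_to_K] at h
    have h2 : ‖W x‖ ^ 2 = ‖x‖ ^ 2 := by exact_mod_cast h
    exact (sq_eq_sq₀ (norm_nonneg _) (norm_nonneg _)).1 h2
  exact ⟨LinearIsometryEquiv.ofSurjective ⟨W.toLinearMap, hn⟩ fun y => ⟨_, h2 y⟩, fun x => rfl⟩

/-- Two isometries whose range projections add up to the identity generate infinitely many
isometries with orthogonal ranges. -/
theorem exists_orthogonal_isometries {e v w : E →L[ℂ] E} (he : IsStarProjection e)
    (hv : star v * v = 1) (hv' : v * star v = e) (hw : star w * w = 1)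
    (hw' : w * star w = 1 - e) :
    (∀ k, star (v ^ k * w) * (v ^ k * w) = 1) ∧
      ∀ k l, k ≠ l → star (v ^ k * w) * (v ^ l * w) = 0 := by
  have hvw : star v * w = 0 := by
    calc star v * w = star v * v * star v * (w * star w * w) := by
          rw [hv, one_mul, mul_assoc w, hw, mul_one]
      _ = star v * (e * (1 - e)) * w := by
          rw [mul_assoc (star v), hv', hw']
          simp only [mul_assoc]
      _ = 0 := by
          rw [mul_sub, mul_one, he.isIdempotentElem.eq, sub_self, mul_zero, zero_mul]
  have hwv : star w * v = 0 := by
    have := congrArg star hvw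
    rwa [star_mul, star_star, star_zero] at this
  have hpow : ∀ k, star (v ^ k) * v ^ k = 1 := by
    intro k
    induction k with
    | zero => simp
    | succ k ih =>
      rw [pow_succ, star_mul, mul_assoc, ← mul_assoc (star (v ^ k)), ih, one_mul, hv]
  have hlt : ∀ k l, k < l → star (v ^ k * w) * (v ^ l * w) = 0 := by
    intro k l hkl
    obtain ⟨m, rfl⟩ := Nat.exists_eq_add_of_lt hkl
    rw [star_mul, mul_assoc, add_assoc, pow_add, pow_succ', mul_assoc, ← mul_assoc (star (v ^ k)),
      hpow, one_mul, mul_assoc, ← mul_assoc (star w), hwv, zero_mul]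
  refine ⟨fun k => ?_, fun k l hkl => ?_⟩
  · rw [star_mul, mul_assoc, ← mul_assoc (star (v ^ k)), hpow, one_mul, hw]
  · rcases lt_or_gt_of_ne hkl with h | h
    · exact hlt k l h
    · have := congrArg star (hlt l k h)
      rwa [star_mul, star_star, star_zero] at this

end Isometries

-- Intertwiners for the algebras `A(O')`: the DHR property and separability

section LocalIntertwiners

variable {s : ℕ} {A : Type u} [CStarAlgebra A] (N : ObservableNet s A)

theorem Repn.hom_star (X : Repn.{u, v} A) (a : A) : star (X.hom a) = X.hom (star a) :=
  (map_star X.hom a).symm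

theorem Repn.hom_mul_apply (X : Repn.{u, v} A) (a b : A) (x : X.carrier) :
    X.hom (a * b) x = X.hom a (X.hom b x) := by
  rw [map_mul]
  rfl

theorem Repn.continuous_hom (X : Repn.{u, v} A) : Continuous X.hom :=
  AddMonoidHomClass.continuous_of_bound X.hom 1 fun a => by
    rw [one_mul]
    exact NonUnitalStarAlgHom.norm_apply_le X.hom a

theorem Repn.continuous_hom_apply (X : Repn.{u, v} A) (x : X.carrier) :
    Continuous fun a => X.hom a x :=
  (ContinuousLinearMap.apply ℂ X.carrier x).continuous.comp
    X.continuous_hom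

/-- The bounded operators that intertwine the restrictions of two representations to `A(O')`. -/
def localIntertwiners (X Y : Repn.{u, v} A) (O : DoubleCone s) :
    Submodule ℂ (X.carrier →L[ℂ] Y.carrier) where
  carrier := {S | ∀ a ∈ N.compl O, ∀ x, S (X.hom a x) = Y.hom a (S x)}
  add_mem' {S T} hS hT a ha x := by
    rw [add_apply, add_apply, hS a ha, hT a ha, map_add]
  zero_mem' a _ x := by simp
  smul_mem' c S hS a ha x := by
    rw [smul_apply, smul_apply, hS a ha, map_smul]

variable {N} {X Y Z : Repn.{u, v} A} {O : DoubleCone s}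

theorem isClosed_localIntertwiners :
    IsClosed (localIntertwiners N X Y O : Set (X.carrier →L[ℂ] Y.carrier)) := by
  have : (localIntertwiners N X Y O : Set (X.carrier →L[ℂ] Y.carrier)) =
      ⋂ a : N.compl O, ⋂ x, {S | S (X.hom a x) = Y.hom a (S x)} := by
    ext S
    simp only [Set.mem_iInter]
    exact ⟨fun h a x => h a a.2 x, fun h a ha x => h ⟨a, ha⟩ x⟩
  rw [this]
  refine isClosed_iInter fun a => isClosed_iInter fun x => isClosed_eq ?_ ?_
  · exact (ContinuousLinearMap.apply ℂ _ _).continuous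
  · exact (Y.hom (a : A)).continuous.comp (ContinuousLinearMap.apply ℂ _ _).continuous

theorem adjoint_mem_localIntertwiners {S : X.carrier →L[ℂ] Y.carrier}
    (hS : S ∈ localIntertwiners N X Y O) : S† ∈ localIntertwiners N Y X O := by
  intro a ha x
  apply ext_inner_left ℂ
  intro y
  rw [ContinuousLinearMap.adjoint_inner_right, ← ContinuousLinearMap.adjoint_inner_left,
    ← ContinuousLinearMap.adjoint_inner_left (X.hom a), ← ContinuousLinearMap.star_eq_adjoint,
    ← ContinuousLinearMap.star_eq_adjoint, Repn.hom_star, Repn.hom_star,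
    ← hS _ (star_mem ha), ContinuousLinearMap.adjoint_inner_right]

theorem comp_mem_localIntertwiners {S : X.carrier →L[ℂ] Y.carrier} {T : Y.carrier →L[ℂ] Z.carrier}
    (hT : T ∈ localIntertwiners N Y Z O) (hS : S ∈ localIntertwiners N X Y O) :
    T ∘L S ∈ localIntertwiners N X Z O := fun a ha x => by
  rw [ContinuousLinearMap.comp_apply, ContinuousLinearMap.comp_apply, hS a ha, hT a ha]

theorem localIntertwiners_mono {O₁ : DoubleCone s} (h : O₁.1 ⊆ O.1) :
    localIntertwiners N X Y O₁ ≤ localIntertwiners N X Y O :=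
  fun _ hS a ha x => hS a (N.compl_anti h ha) x

/-- Haag duality as it is used throughout: a bounded operator is a local observable in the weak
closure as soon as it commutes with `A(O')`. -/
theorem mem_localVN_iff {π₀ : Repn.{u, v} A} (hdual : HaagDuality N π₀)
    {T : π₀.carrier →L[ℂ] π₀.carrier} : T ∈ localVN N π₀ O ↔ T ∈ localIntertwiners N π₀ π₀ O := by
  rw [← hdual, Set.mem_centralizer_iff]
  constructor
  · intro h a ha x
    exact (congrArg (fun S : π₀.carrier →L[ℂ] π₀.carrier => S x) (h _ ⟨a, ha, rfl⟩)).symm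
  · rintro h _ ⟨a, ha, rfl⟩
    ext x
    exact (h a ha x).symm

/-- Every local algebra of the vacuum representation contains a sequence of isometries with
mutually orthogonal ranges. -/
theorem exists_local_isometries {π₀ : Repn.{u, v} A} (hB : PropertyB (localVN N π₀))
    (hdual : HaagDuality N π₀) (hnontriv : Nontriviality N π₀) (O : DoubleCone s) :
    ∃ t : ℕ → (π₀.carrier →L[ℂ] π₀.carrier), (∀ k, t k ∈ localIntertwiners N π₀ π₀ O) ∧
      (∀ k, star (t k) * t k = 1) ∧ ∀ k l, k ≠ l → star (t k) * t l = 0 := by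
  -- Property B enlarges the region, so the projection is found in a smaller cone.
  obtain ⟨O₀, hO₀⟩ := exists_closure_subset O
  obtain ⟨a, ha, hna⟩ := hnontriv O₀
  obtain ⟨e, he, he0, he1, hcomm⟩ := exists_projection_of_ne_smul (π₀.hom a) hna
  have heO : e ∈ localVN N π₀ O₀ := by
    intro S hS
    refine hcomm S (hS _ ⟨a, ha, rfl⟩).symm ?_
    rw [Repn.hom_star]
    exact (hS _ ⟨star a, star_mem ha, rfl⟩).symm
  have heO' : 1 - e ∈ localVN N π₀ O₀ := by
    intro S hS
    rw [mul_sub, sub_mul, mul_one, one_mul, heO S hS]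
  obtain ⟨v, hv, hv1, hv2⟩ := hB O₀ O hO₀ e heO he he0
  obtain ⟨w, hw, hw1, hw2⟩ := hB O₀ O hO₀ (1 - e) heO' he.one_sub (sub_ne_zero.2 he1.symm)
  obtain ⟨h1, h2⟩ := exists_orthogonal_isometries he hv1 hv2 hw1 hw2
  refine ⟨fun k => v ^ k * w, fun k => ?_, h1, h2⟩
  rw [mem_localVN_iff hdual] at hv hw
  have hpow : ∀ k, v ^ k ∈ localIntertwiners N π₀ π₀ O := by
    intro k
    induction k with
    | zero => exact fun a _ x => by simp
    | succ k ih =>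
      rw [pow_succ]
      exact comp_mem_localIntertwiners ih hv
  exact comp_mem_localIntertwiners (hpow k) hw

variable (N) in
/-- For every double cone `O`, the space of `X` is generated by the intertwiners from `π₀` to `X`
for `A(O')`. -/
def LocallyGenerated (π₀ X : Repn.{u, v} A) : Prop :=
  ∀ O : DoubleCone s, Dense (Submodule.span ℂ
    {y : X.carrier | ∃ S ∈ localIntertwiners N π₀ X O, ∃ x, y = S x} : Set X.carrier)

/-- The restrictions of a nonzero, separable and locally generated representation to the algebras
`A(O')` are unitarily equivalent to those of the vacuum representation. -/
theorem LocallyGenerated.isDHR {π₀ : Repn.{u, v} A} (hB : PropertyB (localVN N π₀))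
    (hdual : HaagDuality N π₀) (hnontriv : Nontriviality N π₀) (hX : LocallyGenerated N π₀ X)
    [Nontrivial X.carrier] [SeparableSpace X.carrier] : IsDHR N π₀ X := by
  intro O
  obtain ⟨O₁, hO₁⟩ := exists_closure_subset O
  obtain ⟨t, htO, ht1, ht2⟩ := exists_local_isometries hB hdual hnontriv O₁
  -- Here the space of operators is that of the local intertwiners itself, with `Λ` the identity.
  obtain ⟨T, hT, hTd⟩ := exists_denseRange (localIntertwiners N π₀ X O₁)
    isClosed_localIntertwiners (ContinuousLinearMap.id ℂ _) t ht1 ht2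
    (fun S hS k => ⟨_, comp_mem_localIntertwiners hS (adjoint_mem_localIntertwiners (htO k)), rfl⟩)
    (hX O₁)
  -- The polar decomposition is applied to `T†`, which is injective because `T` has dense range;
  -- this embeds `X` into the vacuum space.
  have hJ := adjoint_mem_localIntertwiners hT
  obtain ⟨u, hu⟩ := exists_polar_isometry (T†) (adjoint_injective_of_denseRange T hTd)
  have hu' : u.toContinuousLinearMap ∈ localIntertwiners N X π₀ O₁ := by
    intro a ha x
    refine hu (X.hom a) (π₀.hom a) (hJ a ha) (fun x => ?_) x
    rw [Repn.hom_star, Repn.hom_star]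
    exact hJ _ (star_mem ha) x
  set w := u.toContinuousLinearMap with hw
  have hww : ∀ x, (w†) (w x) = x := u.adjoint_apply_self
  set p : π₀.carrier →L[ℂ] π₀.carrier := w ∘L w† with hp
  have hpO : p ∈ localVN N π₀ O₁ :=
    (mem_localVN_iff hdual).2
      (comp_mem_localIntertwiners hu' (adjoint_mem_localIntertwiners hu'))
  have hpp : IsStarProjection p := by
    refine ⟨?_, ?_⟩
    · ext x
      change w ((w†) (w ((w†) x))) = w ((w†) x)
      rw [hww]
    · rw [isSelfAdjoint_iff, ContinuousLinearMap.star_eq_adjoint, hp,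
        ContinuousLinearMap.adjoint_comp, ContinuousLinearMap.adjoint_adjoint]
  have hp0 : p ≠ 0 := by
    intro h0
    obtain ⟨x, hx⟩ := exists_ne (0 : X.carrier)
    apply hx
    have h1 : p (w x) = w x := congrArg w (hww x)
    rw [h0, zero_apply] at h1
    rw [← hww x, ← h1, map_zero]
  obtain ⟨y, hy, hy1, hy2⟩ := hB O₁ O hO₁ p hpO hpp hp0
  rw [mem_localVN_iff hdual] at hy
  have hO : O₁.1 ⊆ O.1 := subset_closure.trans hO₁
  have hW : (y† ∘L w) ∈ localIntertwiners N X π₀ O :=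
    comp_mem_localIntertwiners (adjoint_mem_localIntertwiners hy) (localIntertwiners_mono hO hu')
  have hyy : ∀ x, (y†) (y x) = x := fun x =>
    congrArg (fun S : π₀.carrier →L[ℂ] π₀.carrier => S x) hy1
  have hyy' : ∀ x, y ((y†) x) = w ((w†) x) := fun x =>
    congrArg (fun S : π₀.carrier →L[ℂ] π₀.carrier => S x) hy2
  -- The isometries `y` and `w` have the same range projection `p`, so `y† w` is unitary.
  obtain ⟨U, hU⟩ := exists_linearIsometryEquiv (y† ∘L w)
    (fun x => by
      rw [ContinuousLinearMap.adjoint_comp, ContinuousLinearMap.adjoint_adjoint]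
      change (w†) (y ((y†) (w x))) = x
      rw [hyy', hww, hww])
    (fun x => by
      rw [ContinuousLinearMap.adjoint_comp, ContinuousLinearMap.adjoint_adjoint]
      change (y†) (w ((w†) (y x))) = x
      rw [← hyy', hyy, hyy])
  refine ⟨U, fun a ha x => ?_⟩
  rw [hU, hU]
  exact hW a ha x

/-- The vectors generated by the observables from a given vector of a locally generated
representation form a separable set. -/
theorem LocallyGenerated.isSeparable_range {π₀ : Repn.{u, v} A} [SeparableSpace π₀.carrier]
    (hs : 1 ≤ s) (hX : LocallyGenerated N π₀ X) (x : X.carrier) :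
    IsSeparable (Set.range fun a => X.hom a x) := by
  have hloc : ∀ O : DoubleCone s, IsSeparable ((fun a => X.hom a x) '' (N.alg O : Set A)) := by
    intro O
    obtain ⟨O₂, hO₂⟩ := exists_spacelikeSep hs O
    -- Hence an intertwiner for `A(O₂')` intertwines all of `A(O)`, and the orbit of a vector `S h`
    -- under `A(O)` stays in the separable range of `S`.
    have hle : N.alg O ≤ N.compl O₂ := N.le_compl hO₂.symm
    have hspan : ∀ y ∈ Submodule.span ℂ
        {y : X.carrier | ∃ S ∈ localIntertwiners N π₀ X O₂, ∃ x, y = S x},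
        IsSeparable ((fun a => X.hom a y) '' (N.alg O : Set A)) := by
      intro y hy
      induction hy using Submodule.span_induction with
      | mem y hy =>
        obtain ⟨S, hS, h, rfl⟩ := hy
        refine (TopologicalSpace.isSeparable_range S.continuous).mono ?_
        rintro _ ⟨a, ha, rfl⟩
        exact ⟨_, hS a (hle ha) h⟩
      | zero =>
        refine (Set.finite_singleton (0 : X.carrier)).isSeparable.mono ?_
        rintro _ ⟨a, _, rfl⟩
        simp
      | add y z _ _ hy hz =>
        refine ((hy.prod hz).image (f := fun p : X.carrier × X.carrier => p.1 + p.2)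
          continuous_add).mono ?_
        rintro _ ⟨a, ha, rfl⟩
        exact ⟨(X.hom a y, X.hom a z), ⟨⟨a, ha, rfl⟩, ⟨a, ha, rfl⟩⟩, (map_add _ _ _).symm⟩
      | smul c y _ hy =>
        refine (hy.image (continuous_const_smul c)).mono ?_
        rintro _ ⟨a, ha, rfl⟩
        exact ⟨X.hom a y, ⟨a, ha, rfl⟩, (map_smul _ _ _).symm⟩
    -- One sequence approximates `x`, and hence `a x` for all `a` at once, so a countable union
    -- suffices.
    obtain ⟨f, hf, hlim⟩ := mem_closure_iff_seq_limit.1 (hX O₂ x)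
    refine ((IsSeparable.iUnion fun n => hspan (f n) (hf n)).closure).mono ?_
    rintro _ ⟨a, ha, rfl⟩
    exact mem_closure_of_tendsto (((X.hom a).continuous.tendsto x).comp hlim)
      (Filter.Eventually.of_forall fun n => Set.mem_iUnion.2 ⟨n, a, ha, rfl⟩)
  refine ((IsSeparable.iUnion fun n => hloc (bigCone s n)).closure).mono ?_
  rintro _ ⟨a, rfl⟩
  refine N.induction_closed (P := fun a => X.hom a x ∈
    closure (⋃ n, (fun a => X.hom a x) '' (N.alg (bigCone s n) : Set A)))
    (isClosed_closure.preimage (X.continuous_hom_apply x)) (fun O a ha => ?_) a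
  obtain ⟨n, hn⟩ := exists_subset_bigCone O
  exact subset_closure (Set.mem_iUnion.2 ⟨n, a, N.isotony _ _ hn ha, rfl⟩)

/-- A locally generated representation that has a separable cyclic subset is separable. -/
theorem LocallyGenerated.separableSpace {π₀ : Repn.{u, v} A} [SeparableSpace π₀.carrier]
    (hs : 1 ≤ s) (hX : LocallyGenerated N π₀ X) {D : Set X.carrier} (hD : IsSeparable D)
    (hcyc : Dense (Submodule.span ℂ {y : X.carrier | ∃ a, ∃ x ∈ D, y = X.hom a x} :
      Set X.carrier)) : SeparableSpace X.carrier := by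
  obtain ⟨c, -, hc, hDc⟩ := hD.exists_countable_dense_subset
  have h1 : IsSeparable (⋃ x ∈ c, Set.range fun a => X.hom a x) := by
    have := hc.to_subtype
    rw [Set.biUnion_eq_iUnion]
    exact IsSeparable.iUnion fun x => hX.isSeparable_range hs x.1
  have h2 : IsSeparable {y : X.carrier | ∃ a, ∃ x ∈ D, y = X.hom a x} := by
    refine h1.closure.mono ?_
    rintro _ ⟨a, x, hx, rfl⟩
    have h3 : X.hom a x ∈ closure (X.hom a '' c) :=
      image_closure_subset_closure_image (X.hom a).continuous ⟨x, hDc hx, rfl⟩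
    refine closure_mono ?_ h3
    rintro _ ⟨y, hy, rfl⟩
    exact Set.mem_biUnion hy ⟨a, rfl⟩
  have h3 := (h2.span (R := ℂ)).closure
  rw [hcyc.closure_eq] at h3
  exact isSeparable_univ_iff.1 h3

/-- The projection onto the closure of the orbit commutes with the representation, hence is a
scalar; it fixes `x ≠ 0`, so the scalar is one. -/
theorem Repn.IsIrreducible.dense_range (hX : X.IsIrreducible) {x : X.carrier} (hx : x ≠ 0) :
    DenseRange fun a => X.hom a x := by
  let L : A →ₗ[ℂ] X.carrier :=
    (ContinuousLinearMap.apply ℂ X.carrier x).toLinearMap ∘ₗ X.hom.toAlgHom.toLinearMap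
  let K : Submodule ℂ X.carrier := (LinearMap.range L).topologicalClosure
  have : CompleteSpace K := (Submodule.isClosed_topologicalClosure _).completeSpace_coe
  have hinv : ∀ a, ∀ y ∈ K, X.hom a y ∈ K := by
    intro a y hy
    have hy' : y ∈ closure (Set.range L) := hy
    have h := image_closure_subset_closure_image (X.hom a).continuous ⟨y, hy', rfl⟩
    refine closure_mono ?_ h
    rintro _ ⟨_, ⟨b, rfl⟩, rfl⟩
    exact ⟨a * b, X.hom_mul_apply a b x⟩
  obtain ⟨c, hc⟩ := hX.2 K.starProjection fun a => by
    ext y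
    exact starProjection_commute K (X.hom a) (hinv a)
      (by rw [Repn.hom_star]; exact hinv _) y
  have hxK : x ∈ K := Submodule.le_topologicalClosure _ ⟨1, by
    change X.hom 1 x = x
    rw [map_one]; rfl⟩
  have h1 : c • x = x := by
    have := K.starProjection_eq_self_iff.2 hxK
    rwa [hc] at this
  have h2 : c = 1 := by
    have : (c - 1) • x = 0 := by rw [sub_smul, h1, one_smul, sub_self]
    exact sub_eq_zero.1 ((smul_eq_zero.1 this).resolve_right hx)
  intro y
  have hy : y ∈ K := K.starProjection_eq_self_iff.1 (by rw [hc, h2, one_smul]; rfl)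
  exact hy

theorem LocallyGenerated.separableSpace_of_isIrreducible {π₀ : Repn.{u, v} A}
    [SeparableSpace π₀.carrier] (hs : 1 ≤ s) (hX : LocallyGenerated N π₀ X)
    (hirr : X.IsIrreducible) : SeparableSpace X.carrier := by
  have := hirr.1
  obtain ⟨x, hx⟩ := exists_ne (0 : X.carrier)
  have h := (hX.isSeparable_range hs x).closure
  rw [(hirr.dense_range hx).closure_range] at h
  exact isSeparable_univ_iff.1 h

end LocalIntertwiners

/-! ## Representations generated by a field system -/

section FieldSystem

variable {s : ℕ} {A : Type u} [CStarAlgebra A] {N : ObservableNet s A}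

theorem Repn.Hom.comm_apply {X Y : Repn.{u, v} A} (f : Repn.Hom X Y) (a : A) (x : X.carrier) :
    f.op (X.hom a x) = Y.hom a (f.op x) :=
  congrArg (fun T : X.carrier →L[ℂ] Y.carrier => T x) (f.comm a)

theorem Repn.adjoint_comm {X Y : Repn.{u, v} A} {T : X.carrier →L[ℂ] Y.carrier}
    (hT : ∀ a x, T (X.hom a x) = Y.hom a (T x)) (a : A) (y : Y.carrier) :
    (T†) (Y.hom a y) = X.hom a ((T†) y) := by
  apply ext_inner_left ℂ
  intro x
  rw [ContinuousLinearMap.adjoint_inner_right, ← ContinuousLinearMap.adjoint_inner_left,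
    ← ContinuousLinearMap.adjoint_inner_left (X.hom a), ← ContinuousLinearMap.star_eq_adjoint,
    ← ContinuousLinearMap.star_eq_adjoint, Repn.hom_star, Repn.hom_star, ← hT,
    ContinuousLinearMap.adjoint_inner_right]

/-- The intertwiner with a given underlying operator. -/
def Repn.Hom.mk' {X Y : Repn.{u, v} A} (T : X.carrier →L[ℂ] Y.carrier)
    (hT : ∀ a x, T (X.hom a x) = Y.hom a (T x)) : Repn.Hom X Y :=
  ⟨T, fun a => ContinuousLinearMap.ext (hT a)⟩

namespace FieldSystem

variable {π₀ : Repn.{u, v} A} (𝓕 : FieldSystem N π₀)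

/-- The vacuum isometry as a bounded operator. -/
noncomputable abbrev vacOp : π₀.carrier →L[ℂ] 𝓕.rep.carrier := 𝓕.vac.toContinuousLinearMap

theorem field_comm_compl {O : DoubleCone s} {T : 𝓕.rep.carrier →L[ℂ] 𝓕.rep.carrier}
    (hT : T ∈ 𝓕.field O) {a : A} (ha : a ∈ N.compl O) : T * 𝓕.rep.hom a = 𝓕.rep.hom a * T := by
  let B : StarSubalgebra ℂ A :=
    (StarSubalgebra.centralizer ℂ (𝓕.field O : Set _)).comap 𝓕.rep.hom
  have hB : IsClosed (B : Set A) := (Set.isClosed_centralizer _).preimage 𝓕.rep.continuous_hom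
  have hle : N.compl O ≤ B := by
    refine N.compl_le hB fun O₁ h b hb => ?_
    change 𝓕.rep.hom b ∈ StarSubalgebra.centralizer ℂ _
    rw [StarSubalgebra.mem_centralizer_iff]
    exact fun S hS => ⟨𝓕.relative_locality O O₁ h.symm S hS b hb,
      𝓕.relative_locality O O₁ h.symm _ (star_mem hS) b hb⟩
  have h := hle ha
  change 𝓕.rep.hom a ∈ StarSubalgebra.centralizer ℂ _ at h
  exact ((StarSubalgebra.mem_centralizer_iff _).1 h T hT).1

theorem field_comp_vac_mem {O : DoubleCone s} {T : 𝓕.rep.carrier →L[ℂ] 𝓕.rep.carrier}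
    (hT : T ∈ 𝓕.field O) : T ∘L 𝓕.vacOp ∈ localIntertwiners N π₀ 𝓕.rep O := by
  intro a ha x
  change T (𝓕.vac (π₀.hom a x)) = 𝓕.rep.hom a (T (𝓕.vac x))
  rw [𝓕.vac_intertwines]
  exact congrArg (fun S : 𝓕.rep.carrier →L[ℂ] 𝓕.rep.carrier => S (𝓕.vac x))
    (𝓕.field_comm_compl hT ha)

/-- Representations generated by intertwiners from the field representation are locally
generated. -/
theorem locallyGenerated {X : Repn.{u, v} A}
    (hX : Dense (Submodule.span ℂ {y : X.carrier | ∃ f : Repn.Hom 𝓕.rep X, ∃ z, y = f.op z} :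
      Set X.carrier)) : LocallyGenerated N π₀ X := by
  intro O
  set D := {y : X.carrier | ∃ S ∈ localIntertwiners N π₀ X O, ∃ x, y = S x}
  have h1 : ∀ f : Repn.Hom 𝓕.rep X, ∀ z, f.op z ∈ closure (Submodule.span ℂ D : Set X.carrier) := by
    intro f z
    have h2 := image_closure_subset_closure_image f.op.continuous ⟨z, 𝓕.cyclic O z, rfl⟩
    refine closure_mono ?_ h2
    rintro _ ⟨y, hy, rfl⟩
    change f.op.toLinearMap y ∈ Submodule.span ℂ D
    have h3 := Submodule.mem_map_of_mem (f := f.op.toLinearMap) hy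
    rw [Submodule.map_span] at h3
    refine Submodule.span_mono ?_ h3
    rintro _ ⟨_, ⟨T, hT, x, rfl⟩, rfl⟩
    refine ⟨f.op ∘L (T ∘L 𝓕.vacOp), fun a ha x => ?_, x, rfl⟩
    rw [ContinuousLinearMap.comp_apply, 𝓕.field_comp_vac_mem hT a ha, f.comm_apply]
    rfl
  have h4 : Submodule.span ℂ {y : X.carrier | ∃ f : Repn.Hom 𝓕.rep X, ∃ z, y = f.op z} ≤
      (Submodule.span ℂ D).topologicalClosure := by
    rw [Submodule.span_le]
    rintro _ ⟨f, z, rfl⟩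
    exact h1 f z
  intro y
  have h5 := closure_minimal (SetLike.coe_subset_coe.2 h4)
    (Submodule.isClosed_topologicalClosure (Submodule.span ℂ D))
  exact h5 (hX y)

/-- The adjoint of the embedding is an intertwiner from the field representation onto `X`. -/
theorem locallyGenerated_of_isSubrep {X : Repn.{u, v} A} (hX : X.IsSubrep 𝓕.rep) :
    LocallyGenerated N π₀ X := by
  obtain ⟨W, hW⟩ := hX
  refine 𝓕.locallyGenerated ?_
  have h := Repn.adjoint_comm (T := W.toContinuousLinearMap) fun a x => (hW a x).symm
  have : Submodule.span ℂ {y : X.carrier | ∃ f : Repn.Hom 𝓕.rep X, ∃ z, y = f.op z} = ⊤ := by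
    rw [eq_top_iff]
    intro y _
    exact Submodule.subset_span ⟨Repn.Hom.mk' _ h, W y, (W.adjoint_apply_self y).symm⟩
  rw [this]
  exact dense_univ

/-- Each irreducible summand is itself a subrepresentation of the field representation, hence
separable, and finitely many of their ranges span the space. -/
theorem separableSpace_of_isFiniteSum (hs : 1 ≤ s) (hsep : SeparableSpace π₀.carrier)
    {X : Repn.{u, v} A} (hX : X.IsSubrep 𝓕.rep) (hfin : X.IsFiniteSum) :
    SeparableSpace X.carrier := by
  obtain ⟨W, hW⟩ := hX
  obtain ⟨n, Y, w, hirr, hw, hsum⟩ := hfin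
  have hYsep : ∀ i, SeparableSpace (Y i).carrier := by
    intro i
    have hiso : ∀ y, ‖(w i).op y‖ = ‖y‖ :=
      (ContinuousLinearMap.norm_map_iff_adjoint_comp_self _).2 (hw i)
    have hsub : (Y i).IsSubrep 𝓕.rep :=
      ⟨W.comp ⟨(w i).op.toLinearMap, hiso⟩, fun a x => by
        change 𝓕.rep.hom a (W ((w i).op x)) = W ((w i).op ((Y i).hom a x))
        rw [hW, (w i).comm_apply]⟩
    exact (𝓕.locallyGenerated_of_isSubrep hsub).separableSpace_of_isIrreducible hs (hirr i)
  have h1 : IsSeparable (⋃ i, Set.range (w i).op) :=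
    IsSeparable.iUnion fun i => isSeparable_range (w i).op.continuous
  have h2 := h1.span (R := ℂ)
  refine isSeparable_univ_iff.1 (h2.mono fun x _ => ?_)
  have h3 := congrArg (fun T : X.carrier →L[ℂ] X.carrier => T x) hsum
  have h4 : ∑ i, (w i).op (((w i).op†) x) = x := by
    simpa only [sum_apply, ContinuousLinearMap.comp_apply,
      ContinuousLinearMap.id_apply] using h3
  rw [SetLike.mem_coe, ← h4]
  exact Submodule.sum_mem _ fun i _ => Submodule.subset_span (Set.mem_iUnion.2 ⟨i, _, rfl⟩)

theorem isDHR_iff {ω₀ : A →ₗ[ℂ] ℂ} {Ω : π₀.carrier} (hGNS : IsGNS ω₀ π₀ Ω)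
    (hB : PropertyB (localVN N π₀)) (hdual : HaagDuality N π₀)
    (hsep : SeparableSpace π₀.carrier) (hnontriv : Nontriviality N π₀)
    {X : Repn.{u, v} A} (hX : X.IsSubrep 𝓕.rep) :
    IsDHR N π₀ X ↔ Nontrivial X.carrier ∧ SeparableSpace X.carrier := by
  constructor
  · intro h
    obtain ⟨U, -⟩ := h (bigCone s 0)
    have : Nontrivial π₀.carrier := ⟨⟨Ω, 0, fun h0 => by
      have := hGNS.norm_eq
      rw [h0, norm_zero] at this
      exact zero_ne_one this⟩⟩
    exact ⟨U.toEquiv.nontrivial, U.symm.surjective.denseRange.separableSpace U.symm.continuous⟩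
  · rintro ⟨h1, h2⟩
    exact (𝓕.locallyGenerated_of_isSubrep hX).isDHR hB hdual hnontriv

end FieldSystem

end FieldSystem

/-! ## Averages over compact groups of unitaries -/

section Average

open MeasureTheory

-- Strong integrals of operator-valued functions on compact spaces

section StrongIntegral

variable {G : Type*} [TopologicalSpace G] [CompactSpace G] [MeasurableSpace G] [BorelSpace G]
  (μ : Measure G) [IsFiniteMeasure μ]
  {E F : Type*} [NormedAddCommGroup E] [InnerProductSpace ℂ E] [CompleteSpace E]
  [NormedAddCommGroup F] [InnerProductSpace ℂ F] [CompleteSpace F]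

theorem integrable_of_continuous {f : G → F} (hf : Continuous f) : Integrable f μ :=
  hf.integrable_of_hasCompactSupport (HasCompactSupport.of_compactSpace f)

/-- Strongly continuous functions on a compact space have a strong integral. -/
theorem exists_strongIntegral (f : G → E →L[ℂ] F) (hf : ∀ x, Continuous fun g => f g x) :
    ∃ T : E →L[ℂ] F, ∀ x, T x = ∫ g, f g x ∂μ := by
  -- Pointwise boundedness on the compact space becomes a uniform bound, which makes the integral a
  -- bounded operator.
  obtain ⟨C, hC⟩ := banach_steinhaus (g := f) fun x => by
    obtain ⟨C, hC⟩ := (isCompact_range (hf x).norm).bddAbove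
    exact ⟨C, fun g => hC ⟨g, rfl⟩⟩
  refine ⟨LinearMap.mkContinuous
    { toFun := fun x => ∫ g, f g x ∂μ
      map_add' := fun x y => by
        simp only [map_add]
        exact integral_add (integrable_of_continuous μ (hf x)) (integrable_of_continuous μ (hf y))
      map_smul' := fun c x => by
        simp only [map_smul, RingHom.id_apply]
        exact integral_smul c _ } (C * μ.real Set.univ) fun x => ?_, fun x => rfl⟩
  have h : ∀ g, ‖f g x‖ ≤ C * ‖x‖ := fun g => (f g).le_of_opNorm_le (hC g) x
  exact (norm_integral_le_of_norm_le_const (Filter.Eventually.of_forall h)).trans_eq (by ring)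

end StrongIntegral

-- Compact groups of unitaries: weighted averages and finite-dimensional invariant subspaces

section Group

variable {G : Type*} [Group G] {H : Type*} [NormedAddCommGroup H] [InnerProductSpace ℂ H]
  [CompleteSpace H] (U : G →* unitary (H →L[ℂ] H))

theorem unitary_inv_apply (g : G) (x : H) :
    (U g⁻¹ : H →L[ℂ] H) ((U g : H →L[ℂ] H) x) = x := by
  rw [← mul_apply_eq_comp, ← Submonoid.coe_mul, ← map_mul, inv_mul_cancel, map_one]
  rfl

theorem unitary_apply_inv (g : G) (x : H) :
    (U g : H →L[ℂ] H) ((U g⁻¹ : H →L[ℂ] H) x) = x := by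
  simpa using unitary_inv_apply U g⁻¹ x

theorem unitary_mul_apply (g h : G) (x : H) :
    (U (g * h) : H →L[ℂ] H) x = (U g : H →L[ℂ] H) ((U h : H →L[ℂ] H) x) := by
  rw [map_mul]
  rfl

theorem unitary_star (g : G) : star (U g : H →L[ℂ] H) = (U g⁻¹ : H →L[ℂ] H) := by
  rw [map_inv]
  rfl

theorem unitary_inner_left (g : G) (x y : H) :
    inner ℂ ((U g : H →L[ℂ] H) x) y = inner ℂ x ((U g⁻¹ : H →L[ℂ] H) y) := by
  rw [← unitary_star, ContinuousLinearMap.star_eq_adjoint, ContinuousLinearMap.adjoint_inner_right]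

theorem unitary_inner_right (g : G) (x y : H) :
    inner ℂ x ((U g : H →L[ℂ] H) y) = inner ℂ ((U g⁻¹ : H →L[ℂ] H) x) y := by
  rw [unitary_inner_left, inv_inv]

theorem unitary_norm (g : G) (x : H) : ‖(U g : H →L[ℂ] H) x‖ = ‖x‖ := by
  have h : (inner ℂ ((U g : H →L[ℂ] H) x) ((U g : H →L[ℂ] H) x) : ℂ) = inner ℂ x x := by
    rw [unitary_inner_left, unitary_inv_apply]
  rw [inner_self_eq_norm_sq_to_K, inner_self_eq_norm_sq_to_K] at h
  have h2 : ‖(U g : H →L[ℂ] H) x‖ ^ 2 = ‖x‖ ^ 2 := by exact_mod_cast h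
  exact (sq_eq_sq₀ (norm_nonneg _) (norm_nonneg _)).1 h2

variable [TopologicalSpace G]

theorem continuous_unitary_apply
    (hU : ∀ x, Continuous fun g => (U g : H →L[ℂ] H) x) :
    Continuous fun p : G × H => (U p.1 : H →L[ℂ] H) p.2 := by
  rw [continuous_iff_continuousAt]
  rintro ⟨g, x⟩
  rw [ContinuousAt, tendsto_iff_norm_sub_tendsto_zero]
  have h1 : Filter.Tendsto (fun p : G × H => ‖p.2 - x‖ +
      ‖(U p.1 : H →L[ℂ] H) x - (U g : H →L[ℂ] H) x‖) (nhds (g, x)) (nhds 0) := by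
    have : Continuous fun p : G × H => ‖p.2 - x‖ +
      ‖(U p.1 : H →L[ℂ] H) x - (U g : H →L[ℂ] H) x‖ :=
      (continuous_snd.sub continuous_const).norm.add
        (((hU x).comp continuous_fst).sub continuous_const).norm
    simpa using this.tendsto (g, x)
  refine squeeze_zero (fun _ => norm_nonneg _) (fun p => ?_) h1
  calc ‖(U p.1 : H →L[ℂ] H) p.2 - (U g : H →L[ℂ] H) x‖
      = ‖(U p.1 : H →L[ℂ] H) (p.2 - x) + ((U p.1 : H →L[ℂ] H) x - (U g : H →L[ℂ] H) x)‖ := by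
        rw [map_sub, sub_add_sub_cancel]
    _ ≤ _ := (norm_add_le _ _).trans_eq (by rw [unitary_norm])

variable [IsTopologicalGroup G]

theorem continuous_conj_apply
    (hU : ∀ x, Continuous fun g => (U g : H →L[ℂ] H) x) (T : H →L[ℂ] H) (x : H) :
    Continuous fun g => (U g : H →L[ℂ] H) (T ((U g⁻¹ : H →L[ℂ] H) x)) :=
  (continuous_unitary_apply U hU).comp
    (continuous_id.prodMk (T.continuous.comp ((hU x).comp continuous_inv)))

variable [CompactSpace G] [MeasurableSpace G] [BorelSpace G] (μ : Measure G)

/-- Weighted averages of an operator over a compact group of unitaries. -/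
theorem exists_average [IsFiniteMeasure μ]
    (hU : ∀ x, Continuous fun g => (U g : H →L[ℂ] H) x) (f : G → ℂ) (hf : Continuous f)
    (T : H →L[ℂ] H) :
    ∃ R : H →L[ℂ] H, ∀ x,
      R x = ∫ g, f g • (U g : H →L[ℂ] H) (T ((U g⁻¹ : H →L[ℂ] H) x)) ∂μ :=
  exists_strongIntegral μ (fun g => f g • ((U g : H →L[ℂ] H) ∘L T ∘L (U g⁻¹ : H →L[ℂ] H)))
    fun x => hf.smul (continuous_conj_apply U hU T x)

theorem integrable_conj_apply [IsFiniteMeasure μ]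
    (hU : ∀ x, Continuous fun g => (U g : H →L[ℂ] H) x) {f : G → ℂ} (hf : Continuous f)
    (T : H →L[ℂ] H) (x : H) :
    Integrable (fun g => f g • (U g : H →L[ℂ] H) (T ((U g⁻¹ : H →L[ℂ] H) x))) μ :=
  integrable_of_continuous μ (hf.smul (continuous_conj_apply U hU T x))

/-- Whatever commutes with all conjugates of `T` passes under the integral, so the average lies in
the bicommutant of `M`, which is `M`. -/
theorem average_mem_commutant [IsFiniteMeasure μ]
    (hU : ∀ x, Continuous fun g => (U g : H →L[ℂ] H) x) {f : G → ℂ} (hf : Continuous f)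
    {T R : H →L[ℂ] H}
    (hR : ∀ x, R x = ∫ g, f g • (U g : H →L[ℂ] H) (T ((U g⁻¹ : H →L[ℂ] H) x)) ∂μ)
    (M : VonNeumannAlgebra H)
    (hM : ∀ g, (U g : H →L[ℂ] H) * T * (U g⁻¹ : H →L[ℂ] H) ∈ M) : R ∈ M := by
  rw [← SetLike.mem_coe, ← M.centralizer_centralizer]
  intro S hS
  ext x
  change S (R x) = R (S x)
  rw [hR, hR, ← S.integral_comp_comm (integrable_conj_apply U μ hU hf T x)]
  refine integral_congr_ae (Filter.Eventually.of_forall fun g => ?_)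
  change S (f g • _) = _
  rw [map_smul]
  congr 1
  exact (congrArg (fun Z : H →L[ℂ] H => Z x) (hS _ (hM g))).symm

/-- Covariance of weighted averages. -/
theorem average_conj [IsFiniteMeasure μ] [μ.IsMulLeftInvariant]
    (hU : ∀ x, Continuous fun g => (U g : H →L[ℂ] H) x) {f : G → ℂ} (hf : Continuous f)
    {T R : H →L[ℂ] H}
    (hR : ∀ x, R x = ∫ g, f g • (U g : H →L[ℂ] H) (T ((U g⁻¹ : H →L[ℂ] H) x)) ∂μ)
    (h : G) (x : H) :
    (U h : H →L[ℂ] H) (R ((U h⁻¹ : H →L[ℂ] H) x)) =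
      ∫ g, f (h⁻¹ * g) • (U g : H →L[ℂ] H) (T ((U g⁻¹ : H →L[ℂ] H) x)) ∂μ := by
  rw [hR, ← (U h : H →L[ℂ] H).integral_comp_comm
    (integrable_conj_apply U μ hU hf T _),
    ← integral_mul_left_eq_self (fun g => f (h⁻¹ * g) •
      (U g : H →L[ℂ] H) (T ((U g⁻¹ : H →L[ℂ] H) x))) h]
  refine integral_congr_ae (Filter.Eventually.of_forall fun g => ?_)
  simp only [map_smul, inv_mul_cancel_left, mul_inv_rev, unitary_mul_apply]

/-- Averaging over the group is faithful on positive operators. -/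
theorem eq_zero_of_average_eq_zero [IsFiniteMeasure μ] [μ.IsOpenPosMeasure]
    (hU : ∀ x, Continuous fun g => (U g : H →L[ℂ] H) x) {T R : H →L[ℂ] H}
    (hR : ∀ x, R x = ∫ g, (U g : H →L[ℂ] H) ((star T * T) ((U g⁻¹ : H →L[ℂ] H) x)) ∂μ)
    (h0 : R = 0) : T = 0 := by
  ext x
  by_contra hx
  have hc : Continuous fun g => ‖T ((U g⁻¹ : H →L[ℂ] H) x)‖ ^ 2 :=
    (T.continuous.comp ((hU x).comp continuous_inv)).norm.pow 2
  have hpos : 0 < ∫ g, ‖T ((U g⁻¹ : H →L[ℂ] H) x)‖ ^ 2 ∂μ := by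
    refine hc.integral_pos_of_hasCompactSupport_nonneg_nonzero
      (HasCompactSupport.of_compactSpace _) (fun g => by positivity) (x := 1) ?_
    rw [inv_one, map_one]
    exact pow_ne_zero 2 (norm_ne_zero_iff.2 hx)
  have h1 : (inner ℂ x (R x) : ℂ) = ((∫ g, ‖T ((U g⁻¹ : H →L[ℂ] H) x)‖ ^ 2 ∂μ : ℝ) : ℂ) := by
    rw [hR, ← integral_inner
      (integrable_of_continuous μ (continuous_conj_apply U hU (star T * T) x)),
      ← integral_complex_ofReal]
    refine integral_congr_ae (Filter.Eventually.of_forall fun g => ?_)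
    change inner ℂ x ((U g : H →L[ℂ] H) (star T (T ((U g⁻¹ : H →L[ℂ] H) x)))) = _
    rw [unitary_inner_right, ContinuousLinearMap.star_eq_adjoint,
      ContinuousLinearMap.adjoint_inner_right, inner_self_eq_norm_sq_to_K]
    simp
  rw [h0, zero_apply, inner_zero_right] at h1
  exact hpos.ne' (Complex.ofReal_eq_zero.1 h1.symm)

/-- The closed invariant subspace generated by a nonzero vector contains a finite-dimensional
invariant subspace, spanned by averages of the orbit of the vector. -/
theorem exists_finite_invariant [IsProbabilityMeasure μ] [μ.IsMulLeftInvariant]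
    [μ.IsOpenPosMeasure] (hU : ∀ x, Continuous fun g => (U g : H →L[ℂ] H) x)
    {y : H} (hy : y ≠ 0) :
    ∃ (n : ℕ) (z : Fin (n + 1) → H), Orthonormal ℂ z ∧
      (∀ i, ∃ f : G → ℂ, Continuous f ∧ z i = ∫ g, f g • (U g : H →L[ℂ] H) y ∂μ) ∧
      ∀ g i, (U g : H →L[ℂ] H) (z i) =
        ∑ k, (inner ℂ (z k) ((U g : H →L[ℂ] H) (z i)) : ℂ) • z k := by
  -- Averaging the rank-one operators on the orbit of `y` gives a nonzero compact self-adjoint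
  -- operator `K` commuting with the group; an eigenspace for a nonzero eigenvalue is the desired
  -- subspace.
  obtain ⟨K, hK⟩ := exists_strongIntegral μ
    (fun g => InnerProductSpace.rankOne ℂ ((U g : H →L[ℂ] H) y) ((U g : H →L[ℂ] H) y))
    (fun z => by
      simp only [InnerProductSpace.rankOne_apply]
      exact ((hU y).inner continuous_const).smul (hU y))
  simp only [InnerProductSpace.rankOne_apply] at hK
  have hc : ∀ z, Continuous fun g => (inner ℂ ((U g : H →L[ℂ] H) y) z : ℂ) :=
    fun z => (hU y).inner continuous_const
  have hint : ∀ z, Integrable (fun g => (inner ℂ ((U g : H →L[ℂ] H) y) z : ℂ) •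
      (U g : H →L[ℂ] H) y) μ := fun z => integrable_of_continuous μ ((hc z).smul (hU y))
  have hsymm : K.toLinearMap.IsSymmetric := by
    intro z w
    change inner ℂ (K z) w = inner ℂ z (K w)
    rw [hK, hK, ← integral_inner (hint w), ← inner_conj_symm, ← integral_inner (hint z),
      ← integral_conj]
    refine integral_congr_ae (Filter.Eventually.of_forall fun g => ?_)
    simp only [inner_smul_right, map_mul, inner_conj_symm]
    ring
  have hcomm : ∀ g z, (U g : H →L[ℂ] H) (K z) = K ((U g : H →L[ℂ] H) z) := by
    intro h z
    rw [hK, hK, ← (U h : H →L[ℂ] H).integral_comp_comm (hint z),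
      ← integral_mul_left_eq_self (fun g => (inner ℂ ((U g : H →L[ℂ] H) y)
        ((U h : H →L[ℂ] H) z) : ℂ) • (U g : H →L[ℂ] H) y) h]
    refine integral_congr_ae (Filter.Eventually.of_forall fun g => ?_)
    simp only [map_smul, unitary_mul_apply]
    rw [unitary_inner_left U h, unitary_inv_apply]
  have hcompact : IsCompactOperator K := by
    rw [isCompactOperator_iff_exists_mem_nhds_image_subset_compact]
    -- `K` maps the unit ball into the closed convex hull of this compact set, since `|⟨U g y, z⟩| ≤
    -- ‖y‖` there.
    set C : Set H := (fun p : ℂ × G => p.1 • (U p.2 : H →L[ℂ] H) y) ''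
      (Metric.closedBall 0 ‖y‖ ×ˢ Set.univ)
    have hC : IsCompact C :=
      ((isCompact_closedBall _ _).prod isCompact_univ).image
        (continuous_fst.smul ((hU y).comp continuous_snd))
    refine ⟨Metric.closedBall 0 1, Metric.closedBall_mem_nhds 0 one_pos,
      closure (convexHull ℝ C),
      ((totallyBounded_convexHull.2 hC.totallyBounded).closure).isCompact_of_isClosed
        isClosed_closure, ?_⟩
    rintro _ ⟨z, hz, rfl⟩
    rw [hK]
    refine ((convex_convexHull ℝ C).closure).integral_mem isClosed_closure
      (Filter.Eventually.of_forall fun g => ?_) (hint z)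
    refine subset_closure (subset_convexHull ℝ C ⟨(_, g), ⟨?_, trivial⟩, rfl⟩)
    rw [mem_closedBall_zero_iff] at hz ⊢
    refine (norm_inner_le_norm _ _).trans ?_
    rw [unitary_norm]
    exact mul_le_of_le_one_right (norm_nonneg y) hz
  have hK0 : K ≠ 0 := by
    intro h0
    have hpos : 0 < ∫ g, ‖(inner ℂ ((U g : H →L[ℂ] H) y) y : ℂ)‖ ^ 2 ∂μ := by
      refine ((hc y).norm.pow 2).integral_pos_of_hasCompactSupport_nonneg_nonzero
        (HasCompactSupport.of_compactSpace _) (fun g => by positivity) (x := 1) ?_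
      rw [map_one]
      exact pow_ne_zero 2 (norm_ne_zero_iff.2 (inner_self_ne_zero.2 hy))
    have h1 : (inner ℂ y (K y) : ℂ) =
        ((∫ g, ‖(inner ℂ ((U g : H →L[ℂ] H) y) y : ℂ)‖ ^ 2 ∂μ : ℝ) : ℂ) := by
      rw [hK, ← integral_inner (hint y), ← integral_complex_ofReal]
      refine integral_congr_ae (Filter.Eventually.of_forall fun g => ?_)
      simp only [inner_smul_right]
      rw [← inner_conj_symm y, RCLike.mul_conj]
      simp
    rw [h0, zero_apply, inner_zero_right] at h1
    exact hpos.ne' (Complex.ofReal_eq_zero.1 h1.symm)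
  have hev : ∃ l : ℂ, Module.End.HasEigenvalue K.toLinearMap l ∧ l ≠ 0 := by
    by_contra hcon
    push Not at hcon
    exact hK0
      ((ContinuousLinearMap.eq_zero_of_forall_hasEigenvalue_eq_zero hcompact hsymm).1 hcon)
  obtain ⟨l, hl, hl0⟩ := hev
  set V := Module.End.eigenspace K.toLinearMap l with hV
  have hfd : FiniteDimensional ℂ V :=
    ContinuousLinearMap.finite_dimensional_eigenspace hcompact l hl0
  have hnt : Nontrivial V := Submodule.nontrivial_iff_ne_bot.2 hl
  obtain ⟨n, hn⟩ := Nat.exists_eq_succ_of_ne_zero (Module.finrank_pos (R := ℂ) (M := V)).ne'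
  let b : OrthonormalBasis (Fin (n + 1)) ℂ V := (stdOrthonormalBasis ℂ V).reindex (finCongr hn)
  have hinv : ∀ g, ∀ w ∈ V, (U g : H →L[ℂ] H) w ∈ V := by
    intro g w hw
    rw [hV, Module.End.mem_eigenspace_iff] at hw ⊢
    change K _ = _
    rw [← hcomm, show K w = l • w from hw, map_smul]
  refine ⟨n, fun i => b i, b.orthonormal.comp_linearIsometry V.subtypeₗᵢ, fun i => ?_,
    fun g i => ?_⟩
  · refine ⟨fun g => l⁻¹ * inner ℂ ((U g : H →L[ℂ] H) y) (b i : H), continuous_const.mul (hc _), ?_⟩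
    simp only [mul_smul]
    rw [integral_smul, ← hK]
    have h1 : K (b i : H) = l • (b i : H) := Module.End.mem_eigenspace_iff.1 (b i).2
    rw [h1, smul_smul, inv_mul_cancel₀ hl0, one_smul]
  · have h1 := b.sum_repr' (⟨_, hinv g _ (b i).2⟩ : V)
    exact (congrArg Subtype.val h1).symm.trans (by simp)

end Group

end Average

/-! ## Density of irreducible operator algebras -/

section Density

variable (ι : Type*) [Fintype ι] {H : Type*} [NormedAddCommGroup H] [InnerProductSpace ℂ H]
  [CompleteSpace H]

/-- The diagonal action of an operator on a finite power of a Hilbert space. -/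
noncomputable def diagOp (T : H →L[ℂ] H) :
    PiLp 2 (fun _ : ι => H) →L[ℂ] PiLp 2 (fun _ : ι => H) :=
  (PiLp.continuousLinearEquiv 2 ℂ fun _ : ι => H).symm.toContinuousLinearMap ∘L
    ContinuousLinearMap.pi fun i => T ∘L PiLp.proj 2 (fun _ : ι => H) i

variable {ι}

@[simp]
theorem diagOp_apply (T : H →L[ℂ] H) (x : PiLp 2 (fun _ : ι => H)) (i : ι) :
    diagOp ι T x i = T (x i) := rfl

theorem star_diagOp (T : H →L[ℂ] H) : star (diagOp ι T) = diagOp ι (star T) := by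
  rw [ContinuousLinearMap.star_eq_adjoint]
  symm
  rw [ContinuousLinearMap.eq_adjoint_iff]
  intro x y
  simp only [PiLp.inner_apply, diagOp_apply]
  refine Finset.sum_congr rfl fun i _ => ?_
  rw [ContinuousLinearMap.star_eq_adjoint, ContinuousLinearMap.adjoint_inner_left]

variable (ι H) in
/-- The diagonal representation of the bounded operators on a finite power of a Hilbert space. -/
noncomputable def diagHom :
    (H →L[ℂ] H) →⋆ₐ[ℂ] (PiLp 2 (fun _ : ι => H) →L[ℂ] PiLp 2 (fun _ : ι => H)) where
  toFun := diagOp ι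
  map_one' := rfl
  map_mul' _ _ := rfl
  map_zero' := rfl
  map_add' _ _ := rfl
  commutes' _ := rfl
  map_star' T := (star_diagOp T).symm

/-- An irreducible star algebra of operators acts densely on finite orthonormal families. -/
theorem exists_approx_of_irreducible (𝒟 : StarSubalgebra ℂ (H →L[ℂ] H))
    (hirr : ∀ T : H →L[ℂ] H, (∀ S ∈ 𝒟, T * S = S * T) → ∃ c : ℂ, T = c • 1)
    {z : ι → H} (hz : Orthonormal ℂ z) (η : ι → H) {ε : ℝ} (hε : 0 < ε) :
    ∃ T ∈ 𝒟, ∀ i, ‖T (z i) - η i‖ < ε := by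
  classical
  set z' : PiLp 2 (fun _ : ι => H) := WithLp.toLp 2 z with hz'
  let L : 𝒟 →ₗ[ℂ] PiLp 2 (fun _ : ι => H) :=
    (ContinuousLinearMap.apply ℂ _ z').toLinearMap ∘ₗ
      (diagHom ι H).toAlgHom.toLinearMap ∘ₗ 𝒟.subtype.toAlgHom.toLinearMap
  let M := (LinearMap.range L).topologicalClosure
  have : CompleteSpace M := (Submodule.isClosed_topologicalClosure _).completeSpace_coe
  have hinv : ∀ S ∈ 𝒟, ∀ y ∈ M, diagOp ι S y ∈ M := by
    intro S hS y hy
    have hy' : y ∈ closure (Set.range L) := hy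
    have h := image_closure_subset_closure_image (diagOp ι S).continuous ⟨y, hy', rfl⟩
    refine closure_mono ?_ h
    rintro _ ⟨_, ⟨b, rfl⟩, rfl⟩
    exact ⟨⟨S, hS⟩ * b, rfl⟩
  set Q := M.starProjection with hQ
  have hcomm : ∀ S ∈ 𝒟, ∀ y, Q (diagOp ι S y) = diagOp ι S (Q y) := fun S hS y =>
    starProjection_commute M (diagOp ι S) (hinv S hS)
      (by rw [star_diagOp]; exact hinv _ (star_mem hS)) y
  let inj : ι → (H →L[ℂ] PiLp 2 (fun _ : ι => H)) := fun j =>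
    (PiLp.continuousLinearEquiv 2 ℂ fun _ : ι => H).symm.toContinuousLinearMap ∘L
      ContinuousLinearMap.single ℂ (fun _ : ι => H) j
  have hinj : ∀ S j y, inj j (S y) = diagOp ι S (inj j y) := by
    intro S j y
    ext i
    change (Pi.single j (S y) : ι → H) i = S ((Pi.single j y : ι → H) i)
    by_cases hij : i = j
    · subst hij; simp
    · simp [hij]
  have hsum : ∀ x : PiLp 2 (fun _ : ι => H), x = ∑ j, inj j (x j) := by
    intro x
    ext i
    change x i = PiLp.proj 2 (𝕜 := ℂ) (fun _ : ι => H) i (∑ j, inj j (x j))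
    rw [map_sum]
    change x i = ∑ j, (Pi.single j (x j) : ι → H) i
    rw [Finset.sum_eq_single i]
    · simp
    · intro j _ hj
      simp [hj.symm]
    · simp
  -- The matrix entries of the projection `Q` commute with the irreducible algebra and are therefore
  -- scalars; so `Q` commutes with every diagonal operator, not only with those from `𝒟`.
  have hentry : ∀ i j, ∃ c : ℂ, ∀ y, (Q (inj j y)) i = c • y := by
    intro i j
    obtain ⟨c, hc⟩ := hirr (PiLp.proj 2 (fun _ : ι => H) i ∘L Q ∘L inj j) fun S hS => by
      ext y
      change (Q (inj j (S y))) i = S ((Q (inj j y)) i)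
      rw [hinj, hcomm S hS]
      rfl
    exact ⟨c, fun y => congrArg (fun T : H →L[ℂ] H => T y) hc⟩
  choose c hc using hentry
  have hQx : ∀ x i, (Q x) i = ∑ j, c i j • x j := by
    intro x i
    conv_lhs => rw [hsum x]
    change PiLp.proj 2 (𝕜 := ℂ) (fun _ : ι => H) i (Q _) = _
    rw [map_sum, map_sum]
    exact Finset.sum_congr rfl fun j _ => hc i j _
  have hzM : z' ∈ M := Submodule.le_topologicalClosure _ ⟨1, rfl⟩
  -- Some bounded operator takes each `z i` to `η i`; its diagonal action preserves `M`, so the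
  -- tuple `η` is a limit of tuples `(T (z i))_i` with `T` in `𝒟`.
  set B : H →L[ℂ] H := ∑ i, InnerProductSpace.rankOne ℂ (η i) (z i) with hB
  have hBz : ∀ j, B (z j) = η j := by
    intro j
    rw [hB, sum_apply]
    simp only [InnerProductSpace.rankOne_apply]
    rw [Finset.sum_eq_single j]
    · rw [orthonormal_iff_ite.1 hz, if_pos rfl, one_smul]
    · intro i _ hij
      rw [orthonormal_iff_ite.1 hz, if_neg hij, zero_smul]
    · simp
  have hBM : diagOp ι B z' ∈ M := by
    rw [← M.starProjection_eq_self_iff]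
    ext i
    have h1 : Q z' = z' := M.starProjection_eq_self_iff.2 hzM
    rw [hQx]
    simp only [diagOp_apply]
    conv_rhs => rw [← h1, hQx, map_sum]
    simp only [map_smul]
  obtain ⟨T, hT⟩ := Metric.mem_closure_range_iff.1
    (show diagOp ι B z' ∈ closure (Set.range L) from hBM) ε hε
  refine ⟨T, T.2, fun i => ?_⟩
  rw [dist_comm, dist_eq_norm] at hT
  refine lt_of_le_of_lt ?_ hT
  have h2 := PiLp.norm_apply_le (L T - diagOp ι B z') i
  have h3 : (L T - diagOp ι B z') i = (T : H →L[ℂ] H) (z i) - B (z i) := rfl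
  rwa [h3, hBz] at h2

end Density

/-! ## The gauge group -/

noncomputable section Gauge

open MeasureTheory

variable {s : ℕ} {A : Type u} [CStarAlgebra A] {N : ObservableNet s A}

namespace FieldSystem

variable {π₀ : Repn.{u, v} A} (𝓕 : FieldSystem N π₀)

/-- The gauge group with the strong operator topology. -/
def GaugeGroup : Type v := 𝓕.gauge

instance : Group 𝓕.GaugeGroup := inferInstanceAs (Group 𝓕.gauge)

/-- The defining representation of the gauge group. -/
def gaugeHom : 𝓕.GaugeGroup →* unitary (𝓕.rep.carrier →L[ℂ] 𝓕.rep.carrier) :=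
  𝓕.gauge.subtype

/-- A gauge transformation as an element of the topological gauge group. -/
def gaugeMk (g : unitary (𝓕.rep.carrier →L[ℂ] 𝓕.rep.carrier)) (hg : g ∈ 𝓕.gauge) :
    𝓕.GaugeGroup := (⟨g, hg⟩ : 𝓕.gauge)

theorem gaugeHom_mk (g : unitary (𝓕.rep.carrier →L[ℂ] 𝓕.rep.carrier)) (hg : g ∈ 𝓕.gauge) :
    𝓕.gaugeHom (𝓕.gaugeMk g hg) = g := rfl

theorem gaugeHom_mem (g : 𝓕.GaugeGroup) : 𝓕.gaugeHom g ∈ 𝓕.gauge := Subtype.property g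

/-- The evaluation of gauge transformations on all vectors. -/
def gaugeEval (g : 𝓕.GaugeGroup) (x : 𝓕.rep.carrier) : 𝓕.rep.carrier :=
  (𝓕.gaugeHom g : 𝓕.rep.carrier →L[ℂ] 𝓕.rep.carrier) x

instance : TopologicalSpace 𝓕.GaugeGroup := .induced 𝓕.gaugeEval inferInstance

theorem continuous_gauge (x : 𝓕.rep.carrier) :
    Continuous fun g => (𝓕.gaugeHom g : 𝓕.rep.carrier →L[ℂ] 𝓕.rep.carrier) x :=
  (continuous_apply x).comp continuous_induced_dom

instance : IsTopologicalGroup 𝓕.GaugeGroup where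
  continuous_mul := by
    rw [continuous_induced_rng, continuous_pi_iff]
    intro x
    have h := (continuous_unitary_apply 𝓕.gaugeHom 𝓕.continuous_gauge).comp
      (continuous_fst.prodMk ((𝓕.continuous_gauge x).comp continuous_snd))
    convert h using 2 with p
    exact unitary_mul_apply 𝓕.gaugeHom p.1 p.2 x
  continuous_inv := by
    rw [continuous_induced_rng, continuous_pi_iff]
    intro x
    rw [continuous_iff_continuousAt]
    intro g
    rw [ContinuousAt, tendsto_iff_norm_sub_tendsto_zero]
    -- By unitarity `‖k⁻¹ x - g⁻¹ x‖ = ‖x - k y‖`, so continuity of inversion reduces to continuity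
    -- of the action on `y`.
    set y := (𝓕.gaugeHom g⁻¹ : 𝓕.rep.carrier →L[ℂ] 𝓕.rep.carrier) x with hy
    have h := ((𝓕.continuous_gauge y).tendsto g).const_sub x |>.norm
    rw [hy, unitary_apply_inv, sub_self, norm_zero] at h
    refine h.congr fun k => ?_
    change _ = ‖(𝓕.gaugeHom k⁻¹ : 𝓕.rep.carrier →L[ℂ] 𝓕.rep.carrier) x - y‖
    rw [← unitary_norm 𝓕.gaugeHom k (_ - y), map_sub, unitary_apply_inv]

instance : CompactSpace 𝓕.GaugeGroup := by
  have h : Topology.IsInducing 𝓕.gaugeEval := ⟨rfl⟩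
  rw [← isCompact_univ_iff, h.isCompact_iff]
  convert 𝓕.compact using 1
  ext f
  constructor
  · rintro ⟨g, -, rfl⟩
    exact ⟨𝓕.gaugeHom g, 𝓕.gaugeHom_mem g, rfl⟩
  · rintro ⟨g, hg, rfl⟩
    exact ⟨𝓕.gaugeMk g hg, trivial, rfl⟩

instance : MeasurableSpace 𝓕.GaugeGroup := borel _

instance : BorelSpace 𝓕.GaugeGroup := ⟨rfl⟩

/-- The normalized Haar measure of the gauge group. -/
def haar : Measure 𝓕.GaugeGroup := Measure.haarMeasure ⊤

instance : 𝓕.haar.IsMulLeftInvariant :=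
  inferInstanceAs (Measure.haarMeasure _).IsMulLeftInvariant

instance : 𝓕.haar.IsOpenPosMeasure :=
  inferInstanceAs (Measure.haarMeasure _).IsOpenPosMeasure

instance : IsProbabilityMeasure 𝓕.haar :=
  ⟨by simpa [haar] using Measure.haarMeasure_self (K₀ := (⊤ : PositiveCompacts 𝓕.GaugeGroup))⟩

theorem gauge_vac (g : 𝓕.GaugeGroup) (x : π₀.carrier) :
    (𝓕.gaugeHom g : 𝓕.rep.carrier →L[ℂ] 𝓕.rep.carrier) (𝓕.vac x) = 𝓕.vac x :=
  𝓕.vac_invariant _ (𝓕.gaugeHom_mem g) x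

theorem gauge_conj_mem {O : DoubleCone s} {T : 𝓕.rep.carrier →L[ℂ] 𝓕.rep.carrier}
    (hT : T ∈ 𝓕.field O) (g : 𝓕.GaugeGroup) :
    (𝓕.gaugeHom g : 𝓕.rep.carrier →L[ℂ] 𝓕.rep.carrier) * T *
      (𝓕.gaugeHom g⁻¹ : 𝓕.rep.carrier →L[ℂ] 𝓕.rep.carrier) ∈ 𝓕.field O := by
  rw [← unitary_star]
  exact 𝓕.gauge_field _ (𝓕.gaugeHom_mem g) O T hT

theorem mem_localVN_of_invariant {O : DoubleCone s} {T : 𝓕.rep.carrier →L[ℂ] 𝓕.rep.carrier}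
    (hT : T ∈ 𝓕.field O) (h : ∀ g x, (𝓕.gaugeHom g : 𝓕.rep.carrier →L[ℂ] 𝓕.rep.carrier)
      (T ((𝓕.gaugeHom g⁻¹ : 𝓕.rep.carrier →L[ℂ] 𝓕.rep.carrier) x)) = T x) :
    T ∈ localVN N 𝓕.rep O := by
  rw [𝓕.fixed_points]
  refine ⟨hT, fun g hg => ?_⟩
  rw [← 𝓕.gaugeHom_mk g hg, unitary_star]
  exact ContinuousLinearMap.ext (h (𝓕.gaugeMk g hg))

theorem hom_mem_localVN {X : Repn.{u, v} A} {O : DoubleCone s} {a : A} (ha : a ∈ N.alg O) :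
    X.hom a ∈ localVN N X O :=
  fun _ hS => (hS _ ⟨a, ha, rfl⟩).symm

theorem localVN_subset_field (O : DoubleCone s) {T : 𝓕.rep.carrier →L[ℂ] 𝓕.rep.carrier}
    (hT : T ∈ localVN N 𝓕.rep O) : T ∈ 𝓕.field O := by
  rw [𝓕.fixed_points] at hT
  exact hT.1

theorem hom_mem_field {O : DoubleCone s} {a : A} (ha : a ∈ N.alg O) :
    𝓕.rep.hom a ∈ 𝓕.field O :=
  𝓕.localVN_subset_field O (hom_mem_localVN ha)

/-- Local observables are fixed points of the gauge group, and they are dense in `A`. -/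
theorem gauge_comm (g : 𝓕.GaugeGroup) (a : A) (x : 𝓕.rep.carrier) :
    (𝓕.gaugeHom g : 𝓕.rep.carrier →L[ℂ] 𝓕.rep.carrier) (𝓕.rep.hom a x) =
      𝓕.rep.hom a ((𝓕.gaugeHom g : 𝓕.rep.carrier →L[ℂ] 𝓕.rep.carrier) x) := by
  refine N.induction_closed (P := fun a =>
    (𝓕.gaugeHom g : 𝓕.rep.carrier →L[ℂ] 𝓕.rep.carrier) (𝓕.rep.hom a x) =
      𝓕.rep.hom a ((𝓕.gaugeHom g : 𝓕.rep.carrier →L[ℂ] 𝓕.rep.carrier) x))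
    (isClosed_eq ((ContinuousLinearMap.continuous _).comp (𝓕.rep.continuous_hom_apply _))
      (𝓕.rep.continuous_hom_apply _)) (fun O a ha => ?_) a
  have h := hom_mem_localVN (X := 𝓕.rep) ha
  rw [𝓕.fixed_points] at h
  have h1 := congrArg (fun T : 𝓕.rep.carrier →L[ℂ] 𝓕.rep.carrier =>
    T ((𝓕.gaugeHom g : 𝓕.rep.carrier →L[ℂ] 𝓕.rep.carrier) x)) (h.2 _ (𝓕.gaugeHom_mem g))
  rw [unitary_star] at h1
  simp only [mul_apply_eq_comp] at h1
  rwa [unitary_inv_apply] at h1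

/-- The mean of an element of a local field algebra over the gauge group is a local observable. -/
theorem exists_mean {O : DoubleCone s} {T : 𝓕.rep.carrier →L[ℂ] 𝓕.rep.carrier}
    (hT : T ∈ 𝓕.field O) : ∃ R ∈ localVN N 𝓕.rep O, ∀ x,
      R x = ∫ g, (𝓕.gaugeHom g : 𝓕.rep.carrier →L[ℂ] 𝓕.rep.carrier)
        (T ((𝓕.gaugeHom g⁻¹ : 𝓕.rep.carrier →L[ℂ] 𝓕.rep.carrier) x)) ∂𝓕.haar := by
  obtain ⟨R, hR⟩ := exists_average 𝓕.gaugeHom 𝓕.haar 𝓕.continuous_gauge (fun _ => 1)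
    continuous_const T
  refine ⟨R, 𝓕.mem_localVN_of_invariant ?_ fun g x => ?_, fun x => ?_⟩
  · exact average_mem_commutant 𝓕.gaugeHom 𝓕.haar 𝓕.continuous_gauge continuous_const hR _
      (𝓕.gauge_conj_mem hT)
  · rw [average_conj 𝓕.gaugeHom 𝓕.haar 𝓕.continuous_gauge continuous_const hR, hR]
  · rw [hR]
    simp only [one_smul]

/-- Fields in a spacelike separated cone commute with `T`, and the vacuum subspace is cyclic for
them. This works for observables only, as spacelike separated fields need not commute with each
other. -/
theorem localVN_eq_zero (hs : 1 ≤ s) {O : DoubleCone s}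
    {T : 𝓕.rep.carrier →L[ℂ] 𝓕.rep.carrier} (hT : T ∈ localVN N 𝓕.rep O)
    (h : ∀ x, T (𝓕.vac x) = 0) : T = 0 := by
  obtain ⟨O₂, hO₂⟩ := exists_spacelikeSep hs O
  have h1 : ∀ y ∈ Submodule.span ℂ
      {y : 𝓕.rep.carrier | ∃ S ∈ 𝓕.field O₂, ∃ x, y = S (𝓕.vac x)}, T y = 0 := by
    intro y hy
    induction hy using Submodule.span_induction with
    | mem y hy =>
      obtain ⟨S, hS, x, rfl⟩ := hy
      have hc : S * T = T * S := by
        refine hT S ?_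
        rintro _ ⟨a, ha, rfl⟩
        exact (𝓕.relative_locality O₂ O hO₂ S hS a ha).symm
      have h2 := congrArg (fun R : 𝓕.rep.carrier →L[ℂ] 𝓕.rep.carrier => R (𝓕.vac x)) hc
      simp only [mul_apply_eq_comp] at h2
      rw [← h2, h, map_zero]
    | zero => exact map_zero T
    | add y z _ _ hy hz => rw [map_add, hy, hz, add_zero]
    | smul c y _ hy => rw [map_smul, hy, smul_zero]
  ext y
  have := (𝓕.cyclic O₂).induction (P := fun y => T y = 0) h1
    (isClosed_eq T.continuous continuous_const) y
  exact this

/-- The vacuum subspace is separating for the local field algebras. -/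
theorem field_eq_zero (hs : 1 ≤ s) {O : DoubleCone s}
    {T : 𝓕.rep.carrier →L[ℂ] 𝓕.rep.carrier} (hT : T ∈ 𝓕.field O)
    (h : ∀ x, T (𝓕.vac x) = 0) : T = 0 := by
  -- The mean of `T* T` is a local observable; it vanishes on the gauge-invariant vacuum vectors
  -- when `T` does, and averaging is faithful on positive operators.
  obtain ⟨R, hR, hRx⟩ := 𝓕.exists_mean (mul_mem (star_mem hT) hT)
  refine eq_zero_of_average_eq_zero 𝓕.gaugeHom 𝓕.haar 𝓕.continuous_gauge hRx
    (𝓕.localVN_eq_zero hs hR fun x => ?_)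
  rw [hRx]
  simp only [gauge_vac, mul_apply_eq_comp, h, map_zero, integral_zero]

/-- Identities between local fields can thus be checked on the vacuum subspace. -/
theorem field_ext (hs : 1 ≤ s) {O : DoubleCone s}
    {T S : 𝓕.rep.carrier →L[ℂ] 𝓕.rep.carrier} (hT : T ∈ 𝓕.field O) (hS : S ∈ 𝓕.field O)
    (h : ∀ x, T (𝓕.vac x) = S (𝓕.vac x)) : T = S :=
  sub_eq_zero.1 (𝓕.field_eq_zero hs (sub_mem hT hS) fun x => by
    rw [sub_apply, h, sub_self])

/-- The star algebra of all local fields. -/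
def localFields : StarSubalgebra ℂ (𝓕.rep.carrier →L[ℂ] 𝓕.rep.carrier) where
  carrier := {T | ∃ O, T ∈ 𝓕.field O}
  mul_mem' := by
    rintro T S ⟨O₁, hT⟩ ⟨O₂, hS⟩
    obtain ⟨O, h1, h2⟩ := exists_subset_both O₁ O₂
    exact ⟨O, mul_mem (𝓕.isotony _ _ h1 _ hT) (𝓕.isotony _ _ h2 _ hS)⟩
  add_mem' := by
    rintro T S ⟨O₁, hT⟩ ⟨O₂, hS⟩
    obtain ⟨O, h1, h2⟩ := exists_subset_both O₁ O₂
    exact ⟨O, add_mem (𝓕.isotony _ _ h1 _ hT) (𝓕.isotony _ _ h2 _ hS)⟩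
  algebraMap_mem' c := ⟨bigCone s 0, (𝓕.field _).algebraMap_mem' c⟩
  star_mem' := by
    rintro T ⟨O, hT⟩
    exact ⟨O, star_mem hT⟩

end FieldSystem

end Gauge

/-! ## Localized endomorphisms from DHR representations -/

section Endomorphisms

variable {s : ℕ} {A : Type u} [CStarAlgebra A] {N : ObservableNet s A} {π₀ : Repn.{u, v} A}

/-- Vacuum representations that satisfy Haag duality and identify the local algebras with von
Neumann algebras. -/
structure IsLocalVacuum (N : ObservableNet s A) (π₀ : Repn.{u, v} A) : Prop where
  micro : N.Microcausality
  dual : HaagDuality N π₀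
  inj : Function.Injective π₀.hom
  weaklyClosed : ∀ O, localVN N π₀ O = π₀.hom '' (N.alg O : Set A)

namespace IsLocalVacuum

theorem ext (h : IsLocalVacuum N π₀) {a b : A} (hab : ∀ x, π₀.hom a x = π₀.hom b x) : a = b :=
  h.inj (ContinuousLinearMap.ext hab)

/-- Combines Haag duality with weak closedness; it is the source of all elements of `A` constructed
below. -/
theorem exists_local (h : IsLocalVacuum N π₀) {O : DoubleCone s}
    {T : π₀.carrier →L[ℂ] π₀.carrier} (hT : T ∈ localIntertwiners N π₀ π₀ O) :
    ∃ a ∈ N.alg O, ∀ x, π₀.hom a x = T x := by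
  rw [← mem_localVN_iff h.dual, h.weaklyClosed] at hT
  obtain ⟨a, ha, rfl⟩ := hT
  exact ⟨a, ha, fun _ => rfl⟩

theorem isometry (h : IsLocalVacuum N π₀) : Isometry π₀.hom :=
  AddMonoidHomClass.isometry_of_norm π₀.hom (NonUnitalStarAlgHom.norm_map π₀.hom h.inj)

theorem isClosed_range (h : IsLocalVacuum N π₀) : IsClosed (Set.range π₀.hom) :=
  h.isometry.isClosedEmbedding.isClosed_range

variable {X Y : Repn.{u, v} A}

/-- Local intertwiners between DHR representations, transported to the vacuum Hilbert space, are
local observables. -/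
theorem exists_transport (h : IsLocalVacuum N π₀) {O : DoubleCone s}
    {U : X.carrier ≃ₗᵢ[ℂ] π₀.carrier}
    (hU : ∀ a ∈ N.compl O, ∀ x, U (X.hom a x) = π₀.hom a (U x))
    {V : Y.carrier ≃ₗᵢ[ℂ] π₀.carrier}
    (hV : ∀ a ∈ N.compl O, ∀ x, V (Y.hom a x) = π₀.hom a (V x))
    {T : X.carrier →L[ℂ] Y.carrier} (hT : T ∈ localIntertwiners N X Y O) :
    ∃ t ∈ N.alg O, ∀ x, π₀.hom t (U x) = V (T x) := by
  have hUs : ∀ a ∈ N.compl O, ∀ x, U.symm (π₀.hom a x) = X.hom a (U.symm x) := by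
    intro a ha x
    rw [LinearIsometryEquiv.symm_apply_eq, hU a ha, LinearIsometryEquiv.apply_symm_apply]
  obtain ⟨t, ht, htx⟩ := h.exists_local (O := O)
    (T := V.toContinuousLinearEquiv.toContinuousLinearMap ∘L T ∘L
      U.symm.toContinuousLinearEquiv.toContinuousLinearMap) fun a ha x => by
    change V (T (U.symm (π₀.hom a x))) = π₀.hom a (V (T (U.symm x)))
    rw [hUs a ha, hT a ha, hV a ha]
  refine ⟨t, ht, fun x => ?_⟩
  rw [htx]
  change V (T (U.symm (U x))) = _
  rw [LinearIsometryEquiv.symm_apply_apply]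

/-- A DHR representation is, up to unitary equivalence, the vacuum representation composed with an
endomorphism. -/
theorem exists_endo (h : IsLocalVacuum N π₀) {O : DoubleCone s}
    {U : X.carrier ≃ₗᵢ[ℂ] π₀.carrier}
    (hU : ∀ a ∈ N.compl O, ∀ x, U (X.hom a x) = π₀.hom a (U x)) :
    ∃ ρ : A →⋆ₐ[ℂ] A, IsLocalizedIn N ρ O ∧
      ∀ a x, π₀.hom (ρ a) (U x) = U (X.hom a x) := by
  let C : A → (π₀.carrier →L[ℂ] π₀.carrier) := fun a =>
    U.toContinuousLinearEquiv.toContinuousLinearMap ∘L X.hom a ∘L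
      U.symm.toContinuousLinearEquiv.toContinuousLinearMap
  have hC : Continuous C :=
    continuous_const.clm_comp (X.continuous_hom.clm_comp continuous_const)
  have hmem : ∀ a, C a ∈ Set.range π₀.hom := by
    refine N.induction_closed (P := fun a => C a ∈ Set.range π₀.hom)
      (h.isClosed_range.preimage hC) fun O₁ a ha => ?_
    -- For `O₂` containing `O` and `O₁`, microcausality makes `X.hom a` an intertwiner for `A(O₂')`,
    -- so it becomes a local observable on the vacuum space. Closedness of the range of `π₀` gives
    -- the rest.
    obtain ⟨O₂, h1, h2⟩ := exists_subset_both O O₁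
    have ha2 := N.isotony _ _ h2 ha
    obtain ⟨t, -, ht⟩ := h.exists_transport (O := O₂) (T := X.hom a)
      (fun b hb => hU b (N.compl_anti h1 hb)) (fun b hb => hU b (N.compl_anti h1 hb))
      (fun b hb x => by
        rw [← X.hom_mul_apply, ← X.hom_mul_apply, N.commute_compl h.micro ha2 hb])
    refine ⟨t, ContinuousLinearMap.ext fun x => ?_⟩
    have := ht (U.symm x)
    rw [LinearIsometryEquiv.apply_symm_apply] at this
    exact this
  choose f hf using hmem
  have hfx : ∀ a x, π₀.hom (f a) (U x) = U (X.hom a x) := by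
    intro a x
    rw [hf]
    change U (X.hom a (U.symm (U x))) = _
    rw [LinearIsometryEquiv.symm_apply_apply]
  have hext : ∀ a b, (∀ x, π₀.hom a (U x) = π₀.hom b (U x)) → a = b := fun a b hab =>
    h.ext fun x => by simpa using hab (U.symm x)
  refine ⟨
    { toFun := f
      map_one' := hext _ _ fun x => by rw [hfx, map_one, map_one]; rfl
      map_mul' := fun a b => hext _ _ fun x => by
        rw [hfx, Repn.hom_mul_apply, Repn.hom_mul_apply, hfx, hfx]
      map_zero' := hext _ _ fun x => by rw [hfx, map_zero, map_zero]; simp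
      map_add' := fun a b => hext _ _ fun x => by
        rw [hfx, map_add, map_add, add_apply, add_apply, hfx, hfx, map_add]
      commutes' := fun c => hext _ _ fun x => by
        rw [hfx, AlgHomClass.commutes, AlgHomClass.commutes]
        simp [Algebra.algebraMap_eq_smul_one]
      map_star' := fun a => hext _ _ fun x => by
        apply ext_inner_left ℂ
        intro y
        obtain ⟨y, rfl⟩ := U.surjective y
        rw [hfx, U.inner_map_map, ← Repn.hom_star, ← Repn.hom_star,
          ContinuousLinearMap.star_eq_adjoint, ContinuousLinearMap.star_eq_adjoint,
          ContinuousLinearMap.adjoint_inner_right, ContinuousLinearMap.adjoint_inner_right, hfx,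
          U.inner_map_map] },
    fun a ha => hext _ _ fun x => (hfx a x).trans (hU a ha x), hfx⟩

theorem intertwines (h : IsLocalVacuum N π₀) {U : X.carrier ≃ₗᵢ[ℂ] π₀.carrier} {ρ : A →⋆ₐ[ℂ] A}
    (hρ : ∀ a x, π₀.hom (ρ a) (U x) = U (X.hom a x))
    {V : Y.carrier ≃ₗᵢ[ℂ] π₀.carrier} {σ : A →⋆ₐ[ℂ] A}
    (hσ : ∀ a x, π₀.hom (σ a) (V x) = V (Y.hom a x))
    {T : X.carrier →L[ℂ] Y.carrier} (hT : ∀ a x, T (X.hom a x) = Y.hom a (T x))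
    {t : A} (ht : ∀ x, π₀.hom t (U x) = V (T x)) : Intertwines ρ σ t := by
  intro a
  refine h.ext fun x => ?_
  obtain ⟨x, rfl⟩ := U.surjective x
  rw [Repn.hom_mul_apply, Repn.hom_mul_apply, hρ, ht, ht, hσ, hT]

/-- Localizing `X` in `O₁` by another unitary `V` gives an endomorphism `σ`; the operator `V U⁻¹` is
the identity of `X` transported to the vacuum space, hence a local observable, and it is unitary. -/
theorem isTransportable (h : IsLocalVacuum N π₀) (hX : IsDHR N π₀ X)
    {O : DoubleCone s} {U : X.carrier ≃ₗᵢ[ℂ] π₀.carrier}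
    (hU : ∀ a ∈ N.compl O, ∀ x, U (X.hom a x) = π₀.hom a (U x)) {ρ : A →⋆ₐ[ℂ] A}
    (hρ : ∀ a x, π₀.hom (ρ a) (U x) = U (X.hom a x)) : IsTransportable N ρ := by
  intro O₁
  obtain ⟨V, hV⟩ := hX O₁
  obtain ⟨σ, hσO, hσ⟩ := h.exists_endo hV
  obtain ⟨O₂, h1, h2⟩ := exists_subset_both O O₁
  have hU' : ∀ a ∈ N.compl O₂, ∀ x, U (X.hom a x) = π₀.hom a (U x) :=
    fun b hb => hU b (N.compl_anti h1 hb)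
  have hV' : ∀ a ∈ N.compl O₂, ∀ x, V (X.hom a x) = π₀.hom a (V x) :=
    fun b hb => hV b (N.compl_anti h2 hb)
  obtain ⟨t, -, ht⟩ := h.exists_transport hU' hV'
    (T := ContinuousLinearMap.id ℂ _) (fun _ _ _ => rfl)
  refine ⟨σ, hσO, t, ?_, h.intertwines hρ hσ (T := ContinuousLinearMap.id ℂ _)
    (fun _ _ => rfl) ht⟩
  have hstar : ∀ x, π₀.hom (star t) (V x) = U x := by
    intro x
    apply ext_inner_left ℂ
    intro y
    obtain ⟨y, rfl⟩ := U.surjective y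
    rw [← Repn.hom_star, ContinuousLinearMap.star_eq_adjoint,
      ContinuousLinearMap.adjoint_inner_right, ht, U.inner_map_map]
    exact V.inner_map_map y x
  have h_one : ∀ x, π₀.hom 1 x = x := fun x => by rw [map_one]; rfl
  rw [Unitary.mem_iff]
  constructor
  · refine h.ext fun x => ?_
    obtain ⟨x, rfl⟩ := U.surjective x
    rw [Repn.hom_mul_apply, ht, h_one]
    exact hstar x
  · refine h.ext fun x => ?_
    obtain ⟨x, rfl⟩ := V.surjective x
    rw [Repn.hom_mul_apply, hstar, h_one, ht]
    rfl

end IsLocalVacuum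

end Endomorphisms

/-! ## Multiplets of fields -/

noncomputable section Multiplets

open MeasureTheory

variable {s : ℕ} {A : Type u} [CStarAlgebra A] {N : ObservableNet s A} {π₀ : Repn.{u, v} A}

namespace FieldSystem

variable (𝓕 : FieldSystem N π₀)

/-- The action of a gauge transformation on the field Hilbert space. -/
abbrev act (g : 𝓕.GaugeGroup) : 𝓕.rep.carrier →L[ℂ] 𝓕.rep.carrier := 𝓕.gaugeHom g

theorem act_act_inv (g : 𝓕.GaugeGroup) (x : 𝓕.rep.carrier) : 𝓕.act g (𝓕.act g⁻¹ x) = x :=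
  unitary_apply_inv 𝓕.gaugeHom g x

theorem act_inv_act (g : 𝓕.GaugeGroup) (x : 𝓕.rep.carrier) : 𝓕.act g⁻¹ (𝓕.act g x) = x :=
  unitary_inv_apply 𝓕.gaugeHom g x

/-- A finite-dimensional gauge-invariant space of intertwiners from `X` to the field
representation, with an orthonormal basis `w` and the matrix `D` of the gauge group. -/
structure Multiplet (X : Repn.{u, v} A) where
  n : ℕ
  w : Fin (n + 1) → (X.carrier →L[ℂ] 𝓕.rep.carrier)
  comm : ∀ i a x, w i (X.hom a x) = 𝓕.rep.hom a (w i x)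
  ortho : ∀ i j x, ((w i)†) (w j x) = if i = j then x else 0
  D : Fin (n + 1) → Fin (n + 1) → 𝓕.GaugeGroup → ℂ
  cont : ∀ k i, Continuous (D k i)
  trans : ∀ g i x, 𝓕.act g (w i x) = ∑ k, D k i g • w k x
  D_one : ∀ k i, D k i 1 = if k = i then 1 else 0
  D_mul : ∀ k i g h, D k i (g * h) = ∑ l, D k l g * D l i h
  D_inv : ∀ k i g, D k i g⁻¹ = starRingEnd ℂ (D i k g)
  D_norm : ∀ k i g, ‖D k i g‖ ≤ 1

/-- Irreducible subrepresentations of the field representation belong to multiplets. -/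
theorem nonempty_multiplet {X : Repn.{u, v} A} (hX : X.IsSubrep 𝓕.rep) (hirr : X.IsIrreducible) :
    Nonempty (𝓕.Multiplet X) := by
  classical
  obtain ⟨W, hW⟩ := hX
  have := hirr.1
  obtain ⟨x₀, hx₀⟩ := exists_norm_eq X.carrier zero_le_one
  have hx0 : x₀ ≠ 0 := by
    rintro rfl
    rw [norm_zero] at hx₀
    exact zero_ne_one hx₀
  obtain ⟨n, z, hz, hzW, hzU⟩ := exists_finite_invariant 𝓕.gaugeHom 𝓕.haar 𝓕.continuous_gauge
    (y := W x₀) (by rwa [Ne, ← W.map_zero, W.injective.eq_iff])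
  choose f hf hzf using hzW
  -- The weights that produce `z i` from the orbit of `W x₀` also average the embedding `W` itself,
  -- giving intertwiners with `w i x₀ = z i`.
  have hwex : ∀ i, ∃ w : X.carrier →L[ℂ] 𝓕.rep.carrier,
      ∀ x, w x = ∫ g, f i g • 𝓕.act g (W x) ∂𝓕.haar := fun i =>
    exists_strongIntegral 𝓕.haar (fun g => f i g • (𝓕.act g ∘L W.toContinuousLinearMap))
      fun x => (hf i).smul (𝓕.continuous_gauge (W x))
  choose w hw using hwex
  have hcomm : ∀ i a x, w i (X.hom a x) = 𝓕.rep.hom a (w i x) := by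
    intro i a x
    have hint : Integrable (fun g => f i g • 𝓕.act g (W x)) 𝓕.haar :=
      integrable_of_continuous 𝓕.haar ((hf i).smul (𝓕.continuous_gauge (W x)))
    rw [hw, hw, ← (𝓕.rep.hom a).integral_comp_comm hint]
    refine integral_congr_ae (Filter.Eventually.of_forall fun g => ?_)
    simp only [map_smul]
    rw [← hW]
    exact congrArg (f i g • ·) (𝓕.gauge_comm g a (W x))
  have hwz : ∀ i, w i x₀ = z i := fun i => by rw [hw, hzf]
  -- By irreducibility `v† v'` is a scalar, read off at the unit vector `x₀`. Intertwiners are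
  -- therefore determined by their values there, and the relations among the `z i` carry over to the
  -- `w i`.
  have hscal : ∀ v v' : X.carrier →L[ℂ] 𝓕.rep.carrier,
      (∀ a x, v (X.hom a x) = 𝓕.rep.hom a (v x)) →
      (∀ a x, v' (X.hom a x) = 𝓕.rep.hom a (v' x)) →
      ∀ x, (v†) (v' x) = (inner ℂ (v x₀) (v' x₀) : ℂ) • x := by
    intro v v' hv hv'
    obtain ⟨c, hc⟩ := hirr.2 (v† ∘L v') fun a => by
      ext x
      change (v†) (v' (X.hom a x)) = X.hom a ((v†) (v' x))
      rw [hv', Repn.adjoint_comm hv]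
    have hc' : ∀ x, (v†) (v' x) = c • x := fun x =>
      congrArg (fun T : X.carrier →L[ℂ] X.carrier => T x) hc
    intro x
    rw [hc', ← ContinuousLinearMap.adjoint_inner_right, hc', inner_smul_right,
      inner_self_eq_norm_sq_to_K, hx₀]
    simp
  have htrans : ∀ g i x, 𝓕.act g (w i x) =
      ∑ k, (inner ℂ (z k) (𝓕.act g (z i)) : ℂ) • w k x := by
    intro g i x
    set v : X.carrier →L[ℂ] 𝓕.rep.carrier :=
      𝓕.act g ∘L w i - ∑ k, (inner ℂ (z k) (𝓕.act g (z i)) : ℂ) • w k with hv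
    have hvx : ∀ x, v x = 𝓕.act g (w i x) -
        ∑ k, (inner ℂ (z k) (𝓕.act g (z i)) : ℂ) • w k x := fun x => by
      rw [hv, sub_apply, sum_apply]
      rfl
    have hvc : ∀ a x, v (X.hom a x) = 𝓕.rep.hom a (v x) := by
      intro a x
      rw [hvx, hvx, hcomm, map_sub, map_sum]
      congr 1
      · exact 𝓕.gauge_comm g a _
      · exact Finset.sum_congr rfl fun k _ => by rw [hcomm, map_smul]
    have hv0 : v x₀ = 0 := by
      rw [hvx]
      simp only [hwz]
      exact sub_eq_zero.2 (hzU g i)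
    have h1 : v x = 0 := by
      have h2 := hscal v v hvc hvc x
      rw [hv0, inner_zero_left, zero_smul] at h2
      rw [← inner_self_eq_zero (𝕜 := ℂ), ← ContinuousLinearMap.adjoint_inner_right, h2,
        inner_zero_right]
    rw [hvx] at h1
    exact sub_eq_zero.1 h1
  have hznorm : ∀ i, ‖z i‖ = 1 := hz.1
  refine ⟨⟨n, w, hcomm, fun i j x => ?_, fun k i g => inner ℂ (z k) (𝓕.act g (z i)),
    fun k i => continuous_const.inner (𝓕.continuous_gauge _), htrans, fun k i => ?_,
    fun k i g h => ?_, fun k i g => ?_, fun k i g => ?_⟩⟩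
  · rw [hscal _ _ (hcomm i) (hcomm j), hwz, hwz, orthonormal_iff_ite.1 hz]
    split_ifs <;> simp
  · rw [← orthonormal_iff_ite.1 hz, act, map_one]
    rfl
  · have h1 : 𝓕.act (g * h) (z i) = 𝓕.act g (𝓕.act h (z i)) :=
      unitary_mul_apply 𝓕.gaugeHom g h (z i)
    rw [h1]
    conv_lhs => rw [hzU h i, map_sum, inner_sum]
    refine Finset.sum_congr rfl fun l _ => ?_
    rw [map_smul, inner_smul_right, mul_comm]
  · rw [inner_conj_symm]
    exact (unitary_inner_left 𝓕.gaugeHom g _ _).symm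
  · refine (norm_inner_le_norm _ _).trans ?_
    rw [hznorm, unitary_norm, hznorm, one_mul]

namespace Multiplet

variable {𝓕} {X : Repn.{u, v} A} (m : 𝓕.Multiplet X)

/-- Elements of `π(A(O))''` act on the components of a multiplet in the same way. -/
theorem localVN_apply {O : DoubleCone s} {R : 𝓕.rep.carrier →L[ℂ] 𝓕.rep.carrier}
    (hR : R ∈ localVN N 𝓕.rep O) (i : Fin (m.n + 1)) (x : X.carrier) :
    R (m.w i x) = m.w i (((m.w 0)†) (R (m.w 0 x))) := by
  -- The operator `w i (w 0)†` commutes with `π(A)`, hence with the bicommutant.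
  have h1 : R * (m.w i ∘L (m.w 0)†) = (m.w i ∘L (m.w 0)†) * R := by
    refine (hR _ ?_).symm
    rintro _ ⟨a, -, rfl⟩
    ext y
    change 𝓕.rep.hom a (m.w i (((m.w 0)†) y)) = m.w i (((m.w 0)†) (𝓕.rep.hom a y))
    rw [Repn.adjoint_comm (m.comm 0), m.comm]
  have h2 := congrArg (fun T : 𝓕.rep.carrier →L[ℂ] 𝓕.rep.carrier => T (m.w 0 x)) h1
  change R (m.w i (((m.w 0)†) (m.w 0 x))) = _ at h2
  rw [m.ortho, if_pos rfl] at h2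
  exact h2

/-- Vectors that transform like a multiplet are the components of a vector of `X`. -/
theorem eq_of_covariant [Nontrivial X.carrier] {η : Fin (m.n + 1) → 𝓕.rep.carrier}
    (hη : ∀ g i, 𝓕.act g (η i) = ∑ k, m.D k i g • η k) (i : Fin (m.n + 1)) :
    η i = m.w i (((m.w 0)†) (η 0)) := by
  classical
  obtain ⟨x₀, hx₀⟩ := exists_norm_eq X.carrier zero_le_one
  have hz : Orthonormal ℂ fun i => m.w i x₀ := by
    rw [orthonormal_iff_ite]
    intro i j
    rw [← ContinuousLinearMap.adjoint_inner_right, m.ortho]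
    split_ifs
    · rw [inner_self_eq_norm_sq_to_K, hx₀]
      simp
    · exact inner_zero_right _
  set p := m.w i ∘L (m.w 0)† with hp
  have key : ∀ ε > 0, ‖η i - p (η 0)‖ ≤ (1 + ‖p‖) * ((m.n + 1) * ε) := by
    intro ε hε
    -- A local field `T` takes the orthonormal vectors `w j x₀` close to `η j`. Its mean `R` still
    -- does, because both families transform with the same matrices, and `R`, being an observable,
    -- acts alike on all components.
    obtain ⟨T, ⟨O, hT⟩, hTε⟩ := exists_approx_of_irreducible 𝓕.localFields
      (fun T hT => 𝓕.irreducible T fun O S hS => hT S ⟨O, hS⟩) hz η hε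
    obtain ⟨R, hR, hRx⟩ := 𝓕.exists_mean hT
    have happrox : ∀ j, ‖R (m.w j x₀) - η j‖ ≤ (m.n + 1) * ε := by
      intro j
      have h1 : R (m.w j x₀) - η j =
          ∫ g, (𝓕.act g (T (𝓕.act g⁻¹ (m.w j x₀))) - η j) ∂𝓕.haar := by
        rw [hRx, integral_sub (integrable_of_continuous 𝓕.haar
          (continuous_conj_apply 𝓕.gaugeHom 𝓕.continuous_gauge T _)) (integrable_const _),
          integral_const]
        simp
      rw [h1]
      refine (norm_integral_le_of_norm_le_const (C := (m.n + 1) * ε)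
        (Filter.Eventually.of_forall fun g => ?_)).trans_eq (by simp)
      have h2 : 𝓕.act g (T (𝓕.act g⁻¹ (m.w j x₀))) - η j =
          𝓕.act g (∑ k, m.D k j g⁻¹ • (T (m.w k x₀) - η k)) := by
        conv_lhs => rw [← 𝓕.act_act_inv g (η j), ← map_sub, m.trans, hη, map_sum,
          ← Finset.sum_sub_distrib]
        simp only [map_smul, smul_sub]
      rw [h2]
      refine (unitary_norm 𝓕.gaugeHom g _).trans_le ((norm_sum_le _ _).trans ?_)
      calc ∑ k, ‖m.D k j g⁻¹ • (T (m.w k x₀) - η k)‖ ≤ ∑ _k : Fin (m.n + 1), ε := by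
            refine Finset.sum_le_sum fun k _ => ?_
            rw [norm_smul]
            exact (mul_le_of_le_one_left (norm_nonneg _) (m.D_norm _ _ _)).trans (hTε k).le
        _ = (m.n + 1) * ε := by simp
    have h3 : η i - p (η 0) = -(R (m.w i x₀) - η i) + p (R (m.w 0 x₀) - η 0) := by
      rw [map_sub, m.localVN_apply hR i x₀]
      change _ = -(p (R (m.w 0 x₀)) - η i) + _
      abel
    rw [h3]
    refine (norm_add_le _ _).trans ?_
    rw [norm_neg, add_mul, one_mul]
    exact add_le_add (happrox i) ((p.le_opNorm _).trans
      (mul_le_mul_of_nonneg_left (happrox 0) (norm_nonneg _)))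
  have h0 : ‖η i - p (η 0)‖ ≤ 0 := by
    refine le_of_forall_pos_le_add fun δ hδ => ?_
    have hpos : 0 < (1 + ‖p‖) * (m.n + 1) := by positivity
    refine (key (δ / ((1 + ‖p‖) * (m.n + 1))) (div_pos hδ hpos)).trans_eq ?_
    rw [← mul_assoc, mul_div_cancel₀ _ hpos.ne', zero_add]
  exact sub_eq_zero.1 (norm_eq_zero.1 (le_antisymm h0 (norm_nonneg _)))

/-- Averaging a local field against matrix elements produces a multiplet of local fields. -/
theorem exists_fields [Nontrivial X.carrier] {O : DoubleCone s}
    {T : 𝓕.rep.carrier →L[ℂ] 𝓕.rep.carrier} (hT : T ∈ 𝓕.field O) :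
    ∃ R : Fin (m.n + 1) → (𝓕.rep.carrier →L[ℂ] 𝓕.rep.carrier), (∀ i, R i ∈ 𝓕.field O) ∧
      (∀ g i x, 𝓕.act g (R i (𝓕.act g⁻¹ x)) = ∑ k, m.D k i g • R k x) ∧
      ∀ i x, R i (𝓕.vac x) = m.w i (((m.w 0)†) (T (𝓕.vac x))) := by
  have hfc : ∀ i, Continuous fun g => starRingEnd ℂ (m.D i 0 g) :=
    fun i => Complex.continuous_conj.comp (m.cont i 0)
  -- `R i` is the integral of the conjugates of `T` against the complex conjugate of the matrix
  -- element `D i 0`.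
  choose R hR using fun i => exists_average 𝓕.gaugeHom 𝓕.haar 𝓕.continuous_gauge _ (hfc i) T
  have hint : ∀ i x, Integrable (fun g => starRingEnd ℂ (m.D i 0 g) •
      𝓕.act g (T (𝓕.act g⁻¹ x))) 𝓕.haar := fun i x =>
    integrable_conj_apply 𝓕.gaugeHom 𝓕.haar 𝓕.continuous_gauge (hfc i) T x
  have hRO : ∀ i, R i ∈ 𝓕.field O := fun i =>
    average_mem_commutant 𝓕.gaugeHom 𝓕.haar 𝓕.continuous_gauge (hfc i) (hR i) _
      (𝓕.gauge_conj_mem hT)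
  have hRcov : ∀ g i x, 𝓕.act g (R i (𝓕.act g⁻¹ x)) = ∑ k, m.D k i g • R k x := by
    intro h i x
    refine (average_conj 𝓕.gaugeHom 𝓕.haar 𝓕.continuous_gauge (hfc i) (hR i) h x).trans ?_
    simp only [hR]
    simp_rw [← integral_smul]
    have hint2 : ∀ k, Integrable (fun g => m.D k i h • starRingEnd ℂ (m.D k 0 g) •
        𝓕.act g (T (𝓕.act g⁻¹ x))) 𝓕.haar := fun k => (hint k x).smul (m.D k i h)
    rw [← integral_finsetSum _ fun k _ => hint2 k]
    refine integral_congr_ae (Filter.Eventually.of_forall fun g => ?_)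
    simp only [m.D_mul, m.D_inv, map_sum, map_mul, starRingEnd_self_apply, Finset.sum_smul,
      mul_smul]
  have hη : ∀ x i, R i (𝓕.vac x) = m.w i (((m.w 0)†) (R 0 (𝓕.vac x))) := by
    intro x i
    refine m.eq_of_covariant (η := fun i => R i (𝓕.vac x)) (fun g i => ?_) i
    rw [← hRcov, act, act, 𝓕.gauge_vac]
  -- Summing over `i` before integrating collapses the matrix elements, since `∑ conj(D i 0 g) (w
  -- i)† g = (g w 0)† g = (w 0)†`. This fixes the normalizing factor `n + 1`.
  have hsum : ∀ x, (m.n + 1 : ℂ) • ((m.w 0)†) (R 0 (𝓕.vac x)) = ((m.w 0)†) (T (𝓕.vac x)) := by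
    intro x
    have h1 : ∑ i, ((m.w i)†) (R i (𝓕.vac x)) = (m.n + 1 : ℂ) • ((m.w 0)†) (R 0 (𝓕.vac x)) := by
      have : ∀ i, ((m.w i)†) (R i (𝓕.vac x)) = ((m.w 0)†) (R 0 (𝓕.vac x)) := fun i => by
        rw [hη x i, m.ortho, if_pos rfl]
      simp only [this, Finset.sum_const, Finset.card_univ, Fintype.card_fin]
      rw [← Nat.cast_smul_eq_nsmul ℂ]
      push_cast
      rfl
    rw [← h1]
    have h2 : ∀ i, ((m.w i)†) (R i (𝓕.vac x)) =
        ∫ g, starRingEnd ℂ (m.D i 0 g) •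
          ((m.w i)†) (𝓕.act g (T (𝓕.act g⁻¹ (𝓕.vac x)))) ∂𝓕.haar := by
      intro i
      rw [hR i, ← ((m.w i)†).integral_comp_comm (hint i _)]
      simp only [map_smul]
    simp only [h2]
    rw [← integral_finsetSum _ fun i _ => by
      simpa only [map_smul] using ((m.w i)†).integrable_comp (hint i (𝓕.vac x))]
    have h3 : ∀ g, ∑ i, starRingEnd ℂ (m.D i 0 g) •
        ((m.w i)†) (𝓕.act g (T (𝓕.act g⁻¹ (𝓕.vac x)))) = ((m.w 0)†) (T (𝓕.vac x)) := by
      intro g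
      have hv : 𝓕.act g⁻¹ (𝓕.vac x) = 𝓕.vac x := 𝓕.gauge_vac _ x
      rw [hv]
      apply ext_inner_left ℂ
      intro y
      rw [inner_sum]
      simp only [inner_smul_right, ContinuousLinearMap.adjoint_inner_right]
      have h4 := unitary_inner_left 𝓕.gaugeHom g (m.w 0 y) (𝓕.act g (T (𝓕.vac x)))
      rw [unitary_inv_apply] at h4
      rw [← h4, show (𝓕.gaugeHom g : 𝓕.rep.carrier →L[ℂ] 𝓕.rep.carrier) (m.w 0 y) =
        𝓕.act g (m.w 0 y) from rfl, m.trans, sum_inner]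
      simp only [inner_smul_left]
    simp only [h3, integral_const]
    simp
  refine ⟨fun i => (m.n + 1 : ℂ) • R i, fun i => ?_, fun g i x => ?_, fun i x => ?_⟩
  · change (m.n + 1 : ℂ) • R i ∈ _
    rw [← smul_one_mul]
    refine mul_mem ?_ (hRO i)
    have := (𝓕.field O).algebraMap_mem' (m.n + 1 : ℂ)
    rwa [Algebra.algebraMap_eq_smul_one] at this
  · simp only [smul_apply, map_smul, hRcov, Finset.smul_sum]
    exact Finset.sum_congr rfl fun k _ => smul_comm _ _ _
  · rw [smul_apply, hη, ← map_smul, hsum]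

end Multiplet

end FieldSystem

end Multiplets

/-! ## Isometric multiplets of fields -/

section FieldMultiplets

variable {s : ℕ} {A : Type u} [CStarAlgebra A] {N : ObservableNet s A} {π₀ : Repn.{u, v} A}

namespace FieldSystem

variable (𝓕 : FieldSystem N π₀)

theorem adjoint_vac_comm (a : A) (y : 𝓕.rep.carrier) :
    (𝓕.vacOp†) (𝓕.rep.hom a y) = π₀.hom a ((𝓕.vacOp†) y) :=
  Repn.adjoint_comm (T := 𝓕.vacOp) 𝓕.vac_intertwines a y

theorem adjoint_vac_apply (x : π₀.carrier) : (𝓕.vacOp†) (𝓕.vac x) = x :=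
  𝓕.vac.adjoint_apply_self x

/-- The local von Neumann algebras of the field representation are generated by, hence equal to,
the local algebras of observables. -/
theorem exists_eq_hom (h : IsLocalVacuum N π₀) (hs : 1 ≤ s) {O : DoubleCone s}
    {B : 𝓕.rep.carrier →L[ℂ] 𝓕.rep.carrier} (hB : B ∈ localVN N 𝓕.rep O) :
    ∃ b ∈ N.alg O, B = 𝓕.rep.hom b := by
  have hBO := 𝓕.localVN_subset_field O hB
  obtain ⟨b, hb, hbx⟩ := h.exists_local (O := O) (T := 𝓕.vacOp† ∘L B ∘L 𝓕.vacOp)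
    fun a ha x => by
      change (𝓕.vacOp†) (B (𝓕.vac (π₀.hom a x))) = π₀.hom a ((𝓕.vacOp†) (B (𝓕.vac x)))
      rw [← 𝓕.adjoint_vac_comm]
      exact congrArg (𝓕.vacOp†) (𝓕.field_comp_vac_mem hBO a ha x)
  refine ⟨b, hb, 𝓕.field_ext hs hBO (𝓕.hom_mem_field hb) fun x => ?_⟩
  -- The projection onto the vacuum subspace commutes with `π(A)`, hence with `B`; so `B` preserves
  -- that subspace and agrees there with `π(b)`.
  have h1 : (𝓕.vacOp ∘L 𝓕.vacOp†) * B = B * (𝓕.vacOp ∘L 𝓕.vacOp†) := by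
    refine hB _ ?_
    rintro _ ⟨a, -, rfl⟩
    ext y
    change 𝓕.rep.hom a (𝓕.vac ((𝓕.vacOp†) y)) = 𝓕.vac ((𝓕.vacOp†) (𝓕.rep.hom a y))
    rw [𝓕.adjoint_vac_comm, 𝓕.vac_intertwines]
  have h2 := congrArg (fun T : 𝓕.rep.carrier →L[ℂ] 𝓕.rep.carrier => T (𝓕.vac x)) h1
  change 𝓕.vac ((𝓕.vacOp†) (B (𝓕.vac x))) = B (𝓕.vac ((𝓕.vacOp†) (𝓕.vac x))) at h2
  rw [𝓕.adjoint_vac_apply] at h2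
  rw [← h2, ← 𝓕.vac_intertwines, hbx]
  rfl

/-- Since `b` commutes with the fields in a spacelike separated cone, its range contains all `S V
π₀(b) x`; these vectors are total because `π₀(b)` has dense range and the vacuum subspace is cyclic.
-/
theorem denseRange_hom (hs : 1 ≤ s) {O : DoubleCone s} {b : A} (hb : b ∈ N.alg O)
    (hd : DenseRange (π₀.hom b)) : DenseRange (𝓕.rep.hom b) := by
  obtain ⟨O₂, hO₂⟩ := exists_spacelikeSep hs O
  let K : Submodule ℂ 𝓕.rep.carrier :=
    (LinearMap.range (𝓕.rep.hom b).toLinearMap).topologicalClosure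
  have hK : Submodule.span ℂ
      {y : 𝓕.rep.carrier | ∃ S ∈ 𝓕.field O₂, ∃ x, y = S (𝓕.vac x)} ≤ K := by
    rw [Submodule.span_le]
    rintro _ ⟨S, hS, x, rfl⟩
    have h1 : ∀ x, S (𝓕.vac (π₀.hom b x)) ∈ K := by
      intro x
      refine Submodule.le_topologicalClosure _ ⟨S (𝓕.vac x), ?_⟩
      rw [𝓕.vac_intertwines]
      exact (congrArg (fun T : 𝓕.rep.carrier →L[ℂ] 𝓕.rep.carrier => T (𝓕.vac x))
        (𝓕.relative_locality O₂ O hO₂ S hS b hb)).symm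
    exact hd.induction_on (p := fun z => S (𝓕.vac z) ∈ K) x
      ((Submodule.isClosed_topologicalClosure _).preimage
        (S.continuous.comp 𝓕.vac.continuous)) h1
  intro y
  exact closure_minimal (SetLike.coe_subset_coe.2 hK)
    (Submodule.isClosed_topologicalClosure _) (𝓕.cyclic O₂ y)

theorem mem_field_of_comm {O : DoubleCone s} {T : 𝓕.rep.carrier →L[ℂ] 𝓕.rep.carrier}
    (hT : ∀ C ∈ (𝓕.field O).commutant, C * T = T * C) : T ∈ 𝓕.field O := by
  rw [← VonNeumannAlgebra.commutant_commutant (𝓕.field O), VonNeumannAlgebra.mem_commutant_iff]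
  exact hT

/-- Finitely many local fields that realize the representation `X` on the field Hilbert space. -/
structure IsFieldMultiplet (X : Repn.{u, v} A) (U : X.carrier ≃ₗᵢ[ℂ] π₀.carrier)
    (O : DoubleCone s) {ι : Type*} [Fintype ι]
    (T : ι → (𝓕.rep.carrier →L[ℂ] 𝓕.rep.carrier)) : Prop where
  mem : ∀ i, T i ∈ 𝓕.field O
  vac : ∀ i, ∃ w : Repn.Hom X 𝓕.rep, ∀ x, T i (𝓕.vac x) = w.op (U.symm x)
  sum : ∑ i, star (T i) * T i = 1
  inv : ∀ a g x, 𝓕.act g (∑ i, T i (𝓕.rep.hom a (((T i)†) x))) =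
    ∑ i, T i (𝓕.rep.hom a (((T i)†) (𝓕.act g x)))

namespace Multiplet

variable {𝓕} {X : Repn.{u, v} A} (m : 𝓕.Multiplet X)

theorem sum_conj_mul (g : 𝓕.GaugeGroup) (k l : Fin (m.n + 1)) :
    ∑ i, m.D k i g * starRingEnd ℂ (m.D l i g) = if k = l then 1 else 0 := by
  simp only [← m.D_inv]
  rw [← m.D_mul, mul_inv_cancel, m.D_one]

/-- Unitarity of the matrices `D` makes the sum gauge invariant, hence an observable, which is
identified on the vacuum subspace. There each of the `n + 1` isometries `w i` contributes the same
amount. -/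
theorem sum_covariant {O : DoubleCone s} (h : IsLocalVacuum N π₀) (hs : 1 ≤ s)
    {R : Fin (m.n + 1) → (𝓕.rep.carrier →L[ℂ] 𝓕.rep.carrier)} (hR : ∀ i, R i ∈ 𝓕.field O)
    (hcov : ∀ g i x, 𝓕.act g (R i (𝓕.act g⁻¹ x)) = ∑ k, m.D k i g • R k x)
    {S : π₀.carrier → X.carrier} (hS : ∀ i x, R i (𝓕.vac x) = m.w i (S x)) {c : A}
    (hc : ∀ y x, inner ℂ (S y) (S x) = (inner ℂ y (π₀.hom c x) : ℂ)) :
    ∑ i, star (R i) * R i = (m.n + 1 : ℂ) • 𝓕.rep.hom c := by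
  classical
  set B := ∑ i, star (R i) * R i with hBdef
  have hBx : ∀ y x, inner ℂ y (B x) = (∑ i, inner ℂ (R i y) (R i x) : ℂ) := by
    intro y x
    rw [hBdef, sum_apply, inner_sum]
    refine Finset.sum_congr rfl fun i _ => ?_
    rw [mul_apply_eq_comp, ContinuousLinearMap.star_eq_adjoint,
      ContinuousLinearMap.adjoint_inner_right]
  have hB : B ∈ localVN N 𝓕.rep O := by
    refine 𝓕.mem_localVN_of_invariant
      (sum_mem fun i _ => mul_mem (star_mem (hR i)) (hR i)) fun g x => ?_
    apply ext_inner_left ℂ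
    intro y
    have h1 : inner ℂ y (𝓕.act g (B (𝓕.act g⁻¹ x))) =
        (inner ℂ (𝓕.act g⁻¹ y) (B (𝓕.act g⁻¹ x)) : ℂ) :=
      unitary_inner_right 𝓕.gaugeHom g _ _
    refine h1.trans ?_
    rw [hBx, hBx]
    have h2 : ∀ i, inner ℂ (R i (𝓕.act g⁻¹ y)) (R i (𝓕.act g⁻¹ x)) =
        (∑ k, ∑ l, m.D l i g * starRingEnd ℂ (m.D k i g) * inner ℂ (R k y) (R l x) : ℂ) := by
      intro i
      have h3 := unitary_inner_left 𝓕.gaugeHom g (R i (𝓕.act g⁻¹ y))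
        (𝓕.act g (R i (𝓕.act g⁻¹ x)))
      rw [unitary_inv_apply] at h3
      rw [← h3]
      change inner ℂ (𝓕.act g (R i (𝓕.act g⁻¹ y))) (𝓕.act g (R i (𝓕.act g⁻¹ x))) = _
      rw [hcov, hcov, sum_inner]
      refine Finset.sum_congr rfl fun k _ => ?_
      rw [inner_sum]
      refine Finset.sum_congr rfl fun l _ => ?_
      rw [inner_smul_left, inner_smul_right]
      ring
    simp only [h2]
    rw [Finset.sum_comm]
    refine Finset.sum_congr rfl fun k _ => ?_
    rw [Finset.sum_comm]
    simp only [← Finset.sum_mul, m.sum_conj_mul]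
    simp
  obtain ⟨b, hb, hBb⟩ := 𝓕.exists_eq_hom h hs hB
  have hbc : b = (m.n + 1 : ℂ) • c := by
    refine h.ext fun x => ?_
    apply ext_inner_left ℂ
    intro y
    rw [map_smul, smul_apply, inner_smul_right, ← hc, ← 𝓕.vac.inner_map_map y,
      𝓕.vac_intertwines, ← hBb, hBx]
    simp only [hS, ← ContinuousLinearMap.adjoint_inner_right, m.ortho]
    simp
  rw [hBb, hbc, map_smul]

/-- The matrices acting on `R i` and on its adjoint cancel by unitarity of `D`. -/
theorem sum_covariant_conj {R : Fin (m.n + 1) → (𝓕.rep.carrier →L[ℂ] 𝓕.rep.carrier)}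
    (hcov : ∀ g i x, 𝓕.act g (R i (𝓕.act g⁻¹ x)) = ∑ k, m.D k i g • R k x)
    {C : 𝓕.rep.carrier →L[ℂ] 𝓕.rep.carrier} (hC : ∀ g x, 𝓕.act g (C x) = C (𝓕.act g x))
    (g : 𝓕.GaugeGroup) (x : 𝓕.rep.carrier) :
    𝓕.act g (∑ i, R i (C (((R i)†) x))) = ∑ i, R i (C (((R i)†) (𝓕.act g x))) := by
  classical
  have h1 : ∀ i z, 𝓕.act g (R i z) = ∑ k, m.D k i g • R k (𝓕.act g z) := fun i z => by
    rw [← hcov, 𝓕.act_inv_act]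
  have h2 : ∀ i z, 𝓕.act g (((R i)†) z) =
      ∑ k, starRingEnd ℂ (m.D k i g) • ((R k)†) (𝓕.act g z) := by
    intro i z
    apply ext_inner_left ℂ
    intro y
    have h3 : inner ℂ y (𝓕.act g (((R i)†) z)) = (inner ℂ (R i (𝓕.act g⁻¹ y)) z : ℂ) := by
      rw [← ContinuousLinearMap.adjoint_inner_right]
      exact unitary_inner_right 𝓕.gaugeHom g _ _
    have h4 : inner ℂ (R i (𝓕.act g⁻¹ y)) z =
        (inner ℂ (𝓕.act g (R i (𝓕.act g⁻¹ y))) (𝓕.act g z) : ℂ) := by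
      have := unitary_inner_left 𝓕.gaugeHom g (R i (𝓕.act g⁻¹ y)) (𝓕.act g z)
      rw [unitary_inv_apply] at this
      exact this.symm
    rw [h3, h4, hcov, sum_inner, inner_sum]
    refine Finset.sum_congr rfl fun k _ => ?_
    rw [inner_smul_left, inner_smul_right, ContinuousLinearMap.adjoint_inner_right]
  rw [map_sum]
  simp only [h1, hC, h2, map_sum, map_smul, Finset.smul_sum, smul_smul]
  rw [Finset.sum_comm]
  refine Finset.sum_congr rfl fun k _ => ?_
  rw [Finset.sum_comm]
  simp only [← Finset.sum_smul, m.sum_conj_mul, ite_smul, one_smul, zero_smul,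
    Finset.sum_ite_eq, Finset.mem_univ, if_true]

/-- Irreducible representations are realized by local fields. -/
theorem exists_isFieldMultiplet [Nontrivial X.carrier] [SeparableSpace X.carrier]
    (h : IsLocalVacuum N π₀) (hs : 1 ≤ s) (hB : PropertyB (localVN N π₀))
    (hnontriv : Nontriviality N π₀) {O : DoubleCone s} {U : X.carrier ≃ₗᵢ[ℂ] π₀.carrier}
    (hU : ∀ a ∈ N.compl O, ∀ x, U (X.hom a x) = π₀.hom a (U x)) :
    ∃ T : Fin (m.n + 1) → (𝓕.rep.carrier →L[ℂ] 𝓕.rep.carrier),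
      𝓕.IsFieldMultiplet X U O T := by
  obtain ⟨t, htO, ht1, ht2⟩ := exists_local_isometries hB h.dual hnontriv O
  -- `Λ T = (w 0)† T V`. The field algebra supplies enough such operators to find one with dense
  -- range.
  let Λ : (𝓕.rep.carrier →L[ℂ] 𝓕.rep.carrier) →L[ℂ] (π₀.carrier →L[ℂ] X.carrier) :=
    (ContinuousLinearMap.compL ℂ π₀.carrier 𝓕.rep.carrier X.carrier ((m.w 0)†)) ∘L
      (ContinuousLinearMap.compL ℂ π₀.carrier 𝓕.rep.carrier 𝓕.rep.carrier).flip 𝓕.vacOp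
  have hΛ : ∀ T x, Λ T x = ((m.w 0)†) (T (𝓕.vac x)) := fun _ _ => rfl
  obtain ⟨T, hT, hTd⟩ := exists_denseRange
    (Subalgebra.toSubmodule (𝓕.field O).toStarSubalgebra.toSubalgebra)
    (by
      change IsClosed (𝓕.field O : Set (𝓕.rep.carrier →L[ℂ] 𝓕.rep.carrier))
      rw [← VonNeumannAlgebra.centralizer_centralizer]
      exact Set.isClosed_centralizer _) Λ t ht1 ht2
    (fun T hT k => by
      obtain ⟨a, ha, hax⟩ := h.exists_local (htO k)
      have hta : t k = π₀.hom a := (ContinuousLinearMap.ext hax).symm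
      refine ⟨T * 𝓕.rep.hom (star a), show _ ∈ 𝓕.field O from
        mul_mem (show T ∈ 𝓕.field O from hT) (𝓕.hom_mem_field (star_mem ha)), ?_⟩
      ext x
      rw [hta, Repn.hom_star]
      change ((m.w 0)†) (T (𝓕.rep.hom (star a) (𝓕.vac x))) =
        ((m.w 0)†) (T (𝓕.vac (π₀.hom (star a) x)))
      rw [𝓕.vac_intertwines])
    (by
      have h1 : Submodule.span ℂ {y : 𝓕.rep.carrier | ∃ T ∈ 𝓕.field O, ∃ x, y = T (𝓕.vac x)} ≤
          (Submodule.span ℂ {y : X.carrier | ∃ T ∈ 𝓕.field O, ∃ x, y = Λ T x}).comap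
            ((m.w 0)†).toLinearMap := by
        rw [Submodule.span_le]
        rintro _ ⟨T, hT, x, rfl⟩
        exact Submodule.subset_span ⟨T, hT, x, rfl⟩
      intro x
      have h2 := image_closure_subset_closure_image ((m.w 0)†).continuous
        ⟨m.w 0 x, 𝓕.cyclic O _, rfl⟩
      rw [m.ortho, if_pos rfl] at h2
      refine closure_mono ?_ h2
      rintro _ ⟨y, hy, rfl⟩
      exact h1 hy)
  obtain ⟨R, hRO, hRcov, hRv⟩ := m.exists_fields (show T ∈ 𝓕.field O from hT)
  -- Transported by `U`, the operator `Λ T` becomes a local observable `b` with dense range;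
  -- dividing the multiplet `R` by `b` removes the dependence on `T`.
  obtain ⟨b, hb, hbx⟩ := h.exists_local (O := O)
    (T := U.toContinuousLinearEquiv.toContinuousLinearMap ∘L Λ T) fun a ha x => by
      change U (((m.w 0)†) (T (𝓕.vac (π₀.hom a x)))) = π₀.hom a (U (((m.w 0)†) (T (𝓕.vac x))))
      rw [← hU a ha, ← Repn.adjoint_comm (m.comm 0)]
      exact congrArg (fun y => U (((m.w 0)†) y)) (𝓕.field_comp_vac_mem hT a ha x)
  have hbx' : ∀ x, U.symm (π₀.hom b x) = Λ T x := fun x => by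
    rw [hbx]
    exact U.symm_apply_apply _
  have hbd : DenseRange (π₀.hom b) := by
    have h1 := (U.surjective.denseRange).comp hTd U.continuous
    convert h1 using 1
    ext x
    exact hbx x
  have hbD := 𝓕.denseRange_hom hs hb hbd
  have hsumR := m.sum_covariant h hs hRO hRcov (S := Λ T) (c := star b * b) hRv fun y x => by
    rw [← hbx', ← hbx', U.symm.inner_map_map, Repn.hom_mul_apply, ← Repn.hom_star,
      ContinuousLinearMap.star_eq_adjoint, ContinuousLinearMap.adjoint_inner_right]
  have hbound : ∀ i y, ‖R i y‖ ≤ Real.sqrt (m.n + 1) * ‖𝓕.rep.hom b y‖ := by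
    intro i y
    have h1 : ∑ k, ‖R k y‖ ^ 2 = (m.n + 1 : ℝ) * ‖𝓕.rep.hom b y‖ ^ 2 := by
      have h2 := congrArg (fun T : 𝓕.rep.carrier →L[ℂ] 𝓕.rep.carrier =>
        (inner ℂ y (T y) : ℂ)) hsumR
      simp only [sum_apply, inner_sum, smul_apply, inner_smul_right, mul_apply_eq_comp,
        Repn.hom_mul_apply, ← Repn.hom_star, ContinuousLinearMap.star_eq_adjoint,
        ContinuousLinearMap.adjoint_inner_right, inner_self_eq_norm_sq_to_K] at h2
      refine Complex.ofReal_injective ?_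
      push_cast
      exact h2
    have h2 : ‖R i y‖ ^ 2 ≤ (Real.sqrt (m.n + 1) * ‖𝓕.rep.hom b y‖) ^ 2 := by
      rw [mul_pow, Real.sq_sqrt (by positivity), ← h1]
      exact Finset.single_le_sum (f := fun k => ‖R k y‖ ^ 2) (fun _ _ => sq_nonneg _)
        (Finset.mem_univ i)
    exact (sq_le_sq₀ (norm_nonneg _) (by positivity)).1 h2
  -- From `∑ R i* R i = (n + 1) π(b* b)` it follows that `π(b) y ↦ R i y` is bounded. Density of the
  -- range of `π(b)` passes locality and covariance from `R` to `Q`.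
  choose Q hQ _ using fun i => exists_extension (𝓕.rep.hom b).toLinearMap (R i).toLinearMap
    (Real.sqrt (m.n + 1)) (hbound i)
  have hQR : ∀ i y, Q i (𝓕.rep.hom b y) = R i y := hQ
  have hQO : ∀ i, Q i ∈ 𝓕.field O := by
    intro i
    refine 𝓕.mem_field_of_comm fun C hC => ext_of_denseRange hbD fun y => ?_
    have hC' := fun S hS => congrArg (fun T : 𝓕.rep.carrier →L[ℂ] 𝓕.rep.carrier => T y)
      (VonNeumannAlgebra.mem_commutant_iff.1 hC S hS)
    simp only [mul_apply_eq_comp] at hC' ⊢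
    rw [hQR, ← hC' _ (𝓕.hom_mem_field hb), hQR, hC' _ (hRO i)]
  have hQcov : ∀ g i x, 𝓕.act g (Q i (𝓕.act g⁻¹ x)) = ∑ k, m.D k i g • Q k x := by
    intro g i x
    have h1 : 𝓕.act g ∘L Q i ∘L 𝓕.act g⁻¹ = ∑ k, m.D k i g • Q k := by
      refine ext_of_denseRange hbD fun y => ?_
      change 𝓕.act g (Q i (𝓕.act g⁻¹ (𝓕.rep.hom b y))) = _
      have h2 : 𝓕.act g⁻¹ (𝓕.rep.hom b y) = 𝓕.rep.hom b (𝓕.act g⁻¹ y) := 𝓕.gauge_comm _ _ _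
      rw [h2, hQR, hRcov, sum_apply]
      exact Finset.sum_congr rfl fun k _ => by rw [smul_apply, hQR]
    have h2 : 𝓕.act g (Q i (𝓕.act g⁻¹ x)) = (∑ k, m.D k i g • Q k) x :=
      congrArg (fun T : 𝓕.rep.carrier →L[ℂ] 𝓕.rep.carrier => T x) h1
    rw [h2, sum_apply]
    rfl
  have hQv : ∀ i x, Q i (𝓕.vac x) = m.w i (U.symm x) := by
    intro i
    have h1 : Q i ∘L 𝓕.vacOp = m.w i ∘L U.symm.toContinuousLinearEquiv.toContinuousLinearMap := by
      refine ext_of_denseRange hbd fun x => ?_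
      change Q i (𝓕.vac (π₀.hom b x)) = m.w i (U.symm (π₀.hom b x))
      rw [𝓕.vac_intertwines, hQR, hRv, hbx', hΛ]
    exact fun x => congrArg (fun T : π₀.carrier →L[ℂ] 𝓕.rep.carrier => T x) h1
  have hsumQ := m.sum_covariant h hs hQO hQcov (S := U.symm) (c := 1) hQv fun y x => by
    rw [U.symm.inner_map_map, map_one]
    rfl
  -- `∑ Q i* Q i = n + 1`, so this factor normalizes the sum to one.
  set c : ℂ := (((Real.sqrt (m.n + 1))⁻¹ : ℝ) : ℂ) with hc
  have hcc : starRingEnd ℂ c * c * (m.n + 1) = 1 := by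
    have h1 : (m.n + 1 : ℝ) ≠ 0 := by positivity
    have h2 : (Real.sqrt (m.n + 1))⁻¹ * (Real.sqrt (m.n + 1))⁻¹ * (m.n + 1 : ℝ) = 1 := by
      rw [← mul_inv, Real.mul_self_sqrt (by positivity), inv_mul_cancel₀ h1]
    rw [hc, Complex.conj_ofReal]
    exact_mod_cast h2
  refine ⟨fun i => c • Q i, ⟨fun i => ?_, fun i => ?_, ?_, fun a g x => ?_⟩⟩
  · exact (𝓕.field O).toStarSubalgebra.smul_mem (hQO i) c
  · refine ⟨Repn.Hom.mk' (c • m.w i) fun a x => ?_, fun x => ?_⟩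
    · rw [smul_apply, smul_apply, m.comm, map_smul]
    · rw [smul_apply, hQv]
      rfl
  · simp only [star_smul, smul_mul_smul_comm, ← Finset.smul_sum]
    rw [hsumQ, smul_smul, map_one, Complex.star_def, hcc, one_smul]
  · refine m.sum_covariant_conj (R := fun i => c • Q i) (fun g i x => ?_)
      (fun g x => 𝓕.gauge_comm g a x) g x
    simp only [smul_apply, map_smul, hQcov, Finset.smul_sum]
    exact Finset.sum_congr rfl fun k _ => smul_comm _ _ _

end Multiplet

end FieldSystem

end FieldMultiplets

/-! ## Finite direct sums -/

section FiniteSums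

variable {s : ℕ} {A : Type u} [CStarAlgebra A] {N : ObservableNet s A} {π₀ : Repn.{u, v} A}

namespace FieldSystem

variable (𝓕 : FieldSystem N π₀)

/-- Finite direct sums of irreducible representations are realized by local fields. -/
theorem exists_isFieldMultiplet_of_isFiniteSum (h : IsLocalVacuum N π₀) (hs : 1 ≤ s)
    (hB : PropertyB (localVN N π₀)) (hsep : SeparableSpace π₀.carrier)
    (hnontriv : Nontriviality N π₀) {X : Repn.{u, v} A} (hX : X.IsSubrep 𝓕.rep)
    (hfin : X.IsFiniteSum) {O : DoubleCone s} {U : X.carrier ≃ₗᵢ[ℂ] π₀.carrier}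
    (hU : ∀ a ∈ N.compl O, ∀ x, U (X.hom a x) = π₀.hom a (U x)) :
    ∃ (ι : Type) (_ : Fintype ι) (T : ι → (𝓕.rep.carrier →L[ℂ] 𝓕.rep.carrier)),
      𝓕.IsFieldMultiplet X U O T := by
  obtain ⟨W, hW⟩ := hX
  obtain ⟨n, Y, w, hirr, hw, hsum⟩ := hfin
  -- Every summand has its own unitary `V` and multiplet; the observable `c` is the projection onto
  -- the summand, transported to the vacuum space.
  have key : ∀ α, ∃ (k : ℕ) (V : (Y α).carrier ≃ₗᵢ[ℂ] π₀.carrier)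
      (T : Fin k → (𝓕.rep.carrier →L[ℂ] 𝓕.rep.carrier)) (c : A),
      𝓕.IsFieldMultiplet (Y α) V O T ∧ c ∈ N.alg O ∧
      ∀ x, π₀.hom c (U x) = V (((w α).op†) x) := by
    intro α
    have hiso : ∀ y, ‖(w α).op y‖ = ‖y‖ :=
      (ContinuousLinearMap.norm_map_iff_adjoint_comp_self _).2 (hw α)
    have hsub : (Y α).IsSubrep 𝓕.rep :=
      ⟨W.comp ⟨(w α).op.toLinearMap, hiso⟩, fun a x => by
        change 𝓕.rep.hom a (W ((w α).op x)) = W ((w α).op ((Y α).hom a x))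
        rw [hW, (w α).comm_apply]⟩
    have hg := 𝓕.locallyGenerated_of_isSubrep hsub
    have h1 := hg.separableSpace_of_isIrreducible hs (hirr α)
    have h2 := (hirr α).1
    obtain ⟨V, hV⟩ := hg.isDHR hB h.dual hnontriv O
    obtain ⟨m⟩ := 𝓕.nonempty_multiplet hsub (hirr α)
    obtain ⟨T, hT⟩ := m.exists_isFieldMultiplet h hs hB hnontriv hV
    obtain ⟨c, hc, hcx⟩ := h.exists_transport hU hV (T := (w α).op†)
      (fun a _ x => Repn.adjoint_comm (w α).comm_apply a x)
    exact ⟨_, V, T, c, hT, hc, hcx⟩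
  choose k V T c hT hc hcx using key
  refine ⟨Σ α, Fin (k α), inferInstance, fun p => T p.1 p.2 * 𝓕.rep.hom (c p.1),
    ⟨fun p => mul_mem ((hT p.1).mem p.2) (𝓕.hom_mem_field (hc p.1)), fun p => ?_, ?_,
      fun a g x => ?_⟩⟩
  · obtain ⟨v, hv⟩ := (hT p.1).vac p.2
    refine ⟨Repn.Hom.mk' (v.op ∘L (w p.1).op†) fun a x => ?_, fun x => ?_⟩
    · change v.op (((w p.1).op†) (X.hom a x)) = _
      rw [Repn.adjoint_comm (w p.1).comm_apply, v.comm_apply]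
      rfl
    · have h1 := hcx p.1 (U.symm x)
      rw [U.apply_symm_apply] at h1
      change T p.1 p.2 (𝓕.rep.hom (c p.1) (𝓕.vac x)) = v.op (((w p.1).op†) (U.symm x))
      rw [← 𝓕.vac_intertwines, hv, h1, (V p.1).symm_apply_apply]
  · rw [Fintype.sum_sigma]
    have h1 : ∀ α, ∑ i, star (T α i * 𝓕.rep.hom (c α)) * (T α i * 𝓕.rep.hom (c α)) =
        𝓕.rep.hom (star (c α) * c α) := by
      intro α
      have h2 : ∀ i, star (T α i * 𝓕.rep.hom (c α)) * (T α i * 𝓕.rep.hom (c α)) =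
          𝓕.rep.hom (star (c α)) * (star (T α i) * T α i) * 𝓕.rep.hom (c α) := fun i => by
        rw [star_mul, Repn.hom_star]
        simp only [mul_assoc]
      simp only [h2]
      rw [← Finset.sum_mul, ← Finset.mul_sum, (hT α).sum, mul_one, map_mul]
    simp only [h1]
    rw [← map_sum]
    -- This is the resolution of the identity by the range projections of the `w α`.
    have h2 : ∑ α, star (c α) * c α = 1 := by
      refine h.ext fun x => ?_
      obtain ⟨x, rfl⟩ := U.surjective x
      apply ext_inner_left ℂ
      intro y
      obtain ⟨y, rfl⟩ := U.surjective y
      have h3 : ∑ α, (w α).op (((w α).op†) x) = x := by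
        have := congrArg (fun T : X.carrier →L[ℂ] X.carrier => T x) hsum
        simpa only [sum_apply, ContinuousLinearMap.comp_apply,
          ContinuousLinearMap.id_apply] using this
      rw [map_sum, sum_apply, inner_sum, map_one, one_apply_eq_self, U.inner_map_map]
      conv_rhs => rw [← h3, inner_sum]
      refine Finset.sum_congr rfl fun α _ => ?_
      rw [Repn.hom_mul_apply, ← Repn.hom_star, ContinuousLinearMap.star_eq_adjoint,
        ContinuousLinearMap.adjoint_inner_right, hcx, hcx, (V α).inner_map_map,
        ContinuousLinearMap.adjoint_inner_left]
    rw [h2, map_one]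
  · rw [Fintype.sum_sigma, Fintype.sum_sigma, map_sum]
    refine Finset.sum_congr rfl fun α _ => ?_
    have h1 : ∀ i z, (T α i * 𝓕.rep.hom (c α)) (𝓕.rep.hom a (((T α i * 𝓕.rep.hom (c α))†) z)) =
        T α i (𝓕.rep.hom (c α * a * star (c α)) (((T α i)†) z)) := by
      intro i z
      rw [← ContinuousLinearMap.star_eq_adjoint, star_mul, Repn.hom_star,
        mul_apply_eq_comp, mul_apply_eq_comp, Repn.hom_mul_apply, Repn.hom_mul_apply]
      rfl
    simp only [h1]
    exact (hT α).inv _ g x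

end FieldSystem

end FiniteSums

/-! ## The conjugate representation -/

section Conjugate

variable {s : ℕ} {A : Type u} [CStarAlgebra A] {N : ObservableNet s A} {π₀ : Repn.{u, v} A}

/-- The restriction of a representation to a closed invariant subspace. -/
noncomputable def Repn.restrict (X : Repn.{u, v} A) (K : Submodule ℂ X.carrier)
    (hK : IsClosed (K : Set X.carrier)) (hinv : ∀ a, ∀ x ∈ K, X.hom a x ∈ K) : Repn.{u, v} A :=
  { carrier := K
    complete := hK.completeSpace_coe
    hom :=
      letI : CompleteSpace K := hK.completeSpace_coe
      { toFun := fun a => ((X.hom a).comp K.subtypeL).codRestrict K fun x => hinv a x x.2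
        map_one' := by ext x; simp
        map_mul' := fun a b => by ext x; simp; rfl
        map_zero' := by ext x; simp
        map_add' := fun a b => by ext x; simp; rfl
        commutes' := fun c => by ext x; simp [Algebra.algebraMap_eq_smul_one]
        map_star' := fun a => by
          ext1 x
          apply ext_inner_left ℂ
          intro y
          rw [ContinuousLinearMap.star_eq_adjoint, ContinuousLinearMap.adjoint_inner_right]
          change Inner.inner ℂ (y : X.carrier) (X.hom (star a) x) =
            Inner.inner ℂ (X.hom a y) (x : X.carrier)
          rw [← Repn.hom_star, ContinuousLinearMap.star_eq_adjoint,
            ContinuousLinearMap.adjoint_inner_right] } }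

/-- The direct sum of copies of a representation. -/
noncomputable def Repn.diag (ι : Type) [Fintype ι] (X : Repn.{u, v} A) : Repn.{u, v} A :=
  { carrier := PiLp 2 (fun _ : ι => X.carrier)
    hom := (diagHom ι X.carrier).comp X.hom }

namespace FieldSystem

variable (𝓕 : FieldSystem N π₀)

/-- The components `p i` of the embedding intertwine and `y = ∑ (p i)† (p i y)`, so the adjoints of
the components generate `Y`. -/
theorem locallyGenerated_of_isometry {ι : Type} [Fintype ι] {Y : Repn.{u, v} A}
    (e : Y.carrier →ₗᵢ[ℂ] PiLp 2 (fun _ : ι => 𝓕.rep.carrier))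
    (he : ∀ a y i, e (Y.hom a y) i = 𝓕.rep.hom a (e y i)) : LocallyGenerated N π₀ Y := by
  refine 𝓕.locallyGenerated ?_
  let p : ι → Y.carrier →L[ℂ] 𝓕.rep.carrier := fun i =>
    PiLp.proj 2 (fun _ : ι => 𝓕.rep.carrier) i ∘L e.toContinuousLinearMap
  have hp : ∀ i a y, p i (Y.hom a y) = 𝓕.rep.hom a (p i y) := fun i a y => he a y i
  have htop : Submodule.span ℂ
      {y : Y.carrier | ∃ f : Repn.Hom 𝓕.rep Y, ∃ z, y = f.op z} = ⊤ := by
    rw [eq_top_iff]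
    intro y _
    have h1 : y = ∑ i, ((p i)†) (p i y) := by
      apply ext_inner_left ℂ
      intro z
      rw [inner_sum, ← e.inner_map_map, PiLp.inner_apply]
      exact Finset.sum_congr rfl fun i _ =>
        (ContinuousLinearMap.adjoint_inner_right (p i) z (p i y)).symm
    rw [h1]
    exact Submodule.sum_mem _ fun i _ =>
      Submodule.subset_span ⟨Repn.Hom.mk' _ (Repn.adjoint_comm (hp i)), _, rfl⟩
  rw [htop]
  exact dense_univ

/-- The cyclic representation generated by the adjoints of finitely many local fields. -/
theorem exists_conjugate_repn (hs : 1 ≤ s) (hB : PropertyB (localVN N π₀))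
    (hdual : HaagDuality N π₀) (hsep : SeparableSpace π₀.carrier)
    (hnontriv : Nontriviality N π₀) {O : DoubleCone s} {ι : Type} [Fintype ι]
    {T : ι → (𝓕.rep.carrier →L[ℂ] 𝓕.rep.carrier)} (hT : ∀ i, T i ∈ 𝓕.field O)
    (hT0 : ∃ i, T i ≠ 0) :
    ∃ (Y : Repn.{u, v} A) (j : π₀.carrier →L[ℂ] Y.carrier)
      (e : Y.carrier →ₗᵢ[ℂ] PiLp 2 (fun _ : ι => 𝓕.rep.carrier)),
      IsDHR N π₀ Y ∧ (∀ x i, e (j x) i = ((T i)†) (𝓕.vac x)) ∧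
      (∀ a y i, e (Y.hom a y) i = 𝓕.rep.hom a (e y i)) ∧
      Dense (Submodule.span ℂ {y : Y.carrier | ∃ a, ∃ x, y = Y.hom a (j x)} :
        Set Y.carrier) := by
  classical
  let E := PiLp 2 (fun _ : ι => 𝓕.rep.carrier)
  let Z := Repn.diag ι 𝓕.rep
  -- The vectors `(T i* V x)_i`; the conjugate representation is the closed invariant subspace they
  -- generate in a finite power of the field representation.
  let j₀ : π₀.carrier →L[ℂ] Z.carrier :=
    (PiLp.continuousLinearEquiv 2 ℂ (fun _ : ι => 𝓕.rep.carrier)).symm.toContinuousLinearMap ∘L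
      ContinuousLinearMap.pi fun i => (T i)† ∘L 𝓕.vacOp
  let D : Submodule ℂ Z.carrier := Submodule.span ℂ {y | ∃ a, ∃ x, y = Z.hom a (j₀ x)}
  let K : Submodule ℂ Z.carrier := D.topologicalClosure
  have hK : IsClosed (K : Set Z.carrier) := Submodule.isClosed_topologicalClosure _
  have hD : ∀ a, ∀ z ∈ D, Z.hom a z ∈ D := by
    intro a z hz
    have h1 := Submodule.mem_map_of_mem (f := (Z.hom a).toLinearMap) hz
    rw [Submodule.map_span] at h1
    refine Submodule.span_mono ?_ h1
    rintro _ ⟨_, ⟨b, x, rfl⟩, rfl⟩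
    exact ⟨a * b, x, (Z.hom_mul_apply a b _).symm⟩
  have hinv : ∀ a, ∀ z ∈ K, Z.hom a z ∈ K := by
    intro a z hz
    have h1 := image_closure_subset_closure_image (Z.hom a).continuous ⟨z, hz, rfl⟩
    refine closure_mono ?_ h1
    rintro _ ⟨y, hy, rfl⟩
    exact hD a y hy
  have hcK : CompleteSpace K := hK.completeSpace_coe
  have hjK : ∀ x, j₀ x ∈ K := fun x =>
    Submodule.le_topologicalClosure _ (Submodule.subset_span ⟨1, x, by rw [map_one]; rfl⟩)
  let Y := Z.restrict K hK hinv
  let j : π₀.carrier →L[ℂ] Y.carrier := j₀.codRestrict K hjK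
  let e : Y.carrier →ₗᵢ[ℂ] E := K.subtypeₗᵢ
  have hej : ∀ x i, e (j x) i = ((T i)†) (𝓕.vac x) := fun _ _ => rfl
  have hcyc : Dense (Submodule.span ℂ {y : Y.carrier | ∃ a, ∃ x, y = Y.hom a (j x)} :
      Set Y.carrier) := by
    intro y
    rw [e.isometry.isEmbedding.isInducing.closure_eq_preimage_closure_image]
    have h1 : e y ∈ closure (D : Set Z.carrier) := y.2
    refine closure_mono ?_ h1
    have h2 : D ≤ (Submodule.span ℂ {y : Y.carrier | ∃ a, ∃ x, y = Y.hom a (j x)}).map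
        e.toLinearMap := by
      rw [Submodule.map_span]
      refine Submodule.span_mono ?_
      rintro _ ⟨a, x, rfl⟩
      exact ⟨_, ⟨a, x, rfl⟩, rfl⟩
    exact h2
  have hgen := 𝓕.locallyGenerated_of_isometry e fun _ _ _ => rfl
  -- Were `Y` zero, all `T i*` would vanish on the vacuum subspace, which is separating for the
  -- local fields.
  have hnt : Nontrivial Y.carrier := by
    by_contra hno
    rw [not_nontrivial_iff_subsingleton] at hno
    obtain ⟨i, hi⟩ := hT0
    refine hi (star_eq_zero.1 (𝓕.field_eq_zero hs (star_mem (hT i)) fun x => ?_))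
    have h1 : e (j x) = 0 := by rw [Subsingleton.elim (j x) 0, map_zero]
    rw [ContinuousLinearMap.star_eq_adjoint, ← hej, h1]
    rfl
  have hYsep : SeparableSpace Y.carrier := by
    refine hgen.separableSpace hs (isSeparable_range j.continuous) ?_
    refine hcyc.mono (SetLike.coe_subset_coe.2 (Submodule.span_mono ?_))
    rintro y ⟨a, x, hy⟩
    exact ⟨a, j x, ⟨x, rfl⟩, hy⟩
  exact ⟨Y, j, e, hgen.isDHR hB hdual hnontriv, hej, fun _ _ _ => rfl, hcyc⟩

end FieldSystem

end Conjugate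

/-! ## Conjugate endomorphisms -/

section ConjugateEndomorphisms

variable {s : ℕ} {A : Type u} [CStarAlgebra A] {N : ObservableNet s A} {π₀ : Repn.{u, v} A}

/-- Applying `ρ`, which fixes `A(O₂')`, to `a c = c a` shows that `ρ a` commutes with `A(O₂')`; Haag
duality does the rest. -/
theorem IsLocalVacuum.map_mem (h : IsLocalVacuum N π₀) {ρ : A →⋆ₐ[ℂ] A} {O O₂ : DoubleCone s}
    (hρ : IsLocalizedIn N ρ O) (hO : O.1 ⊆ O₂.1) {a : A} (ha : a ∈ N.alg O₂) :
    ρ a ∈ N.alg O₂ := by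
  obtain ⟨b, hb, hbx⟩ := h.exists_local (O := O₂) (T := π₀.hom (ρ a)) fun c hc x => by
    rw [← Repn.hom_mul_apply, ← Repn.hom_mul_apply]
    have h1 := congrArg ρ (N.commute_compl h.micro ha hc)
    rw [map_mul, map_mul, hρ c (N.compl_anti hO hc)] at h1
    rw [h1]
  rwa [← h.ext hbx]

theorem continuous_starAlgHom (ρ : A →⋆ₐ[ℂ] A) : Continuous ρ :=
  AddMonoidHomClass.continuous_of_bound ρ 1 fun a => by
    rw [one_mul]
    exact NonUnitalStarAlgHom.norm_apply_le ρ a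

namespace FieldSystem.IsFieldMultiplet

variable {𝓕 : FieldSystem N π₀} {X : Repn.{u, v} A} {U : X.carrier ≃ₗᵢ[ℂ] π₀.carrier}
  {O : DoubleCone s} {ι : Type} [Fintype ι] {T : ι → (𝓕.rep.carrier →L[ℂ] 𝓕.rep.carrier)}

/-- The fields of a multiplet implement the endomorphism. -/
theorem apply_hom (hT : 𝓕.IsFieldMultiplet X U O T) (h : IsLocalVacuum N π₀) (hs : 1 ≤ s)
    {ρ : A →⋆ₐ[ℂ] A} (hρO : IsLocalizedIn N ρ O)
    (hρ : ∀ a x, π₀.hom (ρ a) (U x) = U (X.hom a x)) (i : ι) (a : A) (z : 𝓕.rep.carrier) :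
    T i (𝓕.rep.hom (ρ a) z) = 𝓕.rep.hom a (T i z) := by
  refine N.induction_closed
    (P := fun a => T i (𝓕.rep.hom (ρ a) z) = 𝓕.rep.hom a (T i z))
    (isClosed_eq ((T i).continuous.comp ((𝓕.rep.continuous_hom_apply z).comp
      (continuous_starAlgHom ρ))) (𝓕.rep.continuous_hom_apply _)) (fun O₁ a ha => ?_) a
  obtain ⟨O₂, h1, h2⟩ := exists_subset_both O O₁
  have ha2 := N.isotony _ _ h2 ha
  have hT2 := 𝓕.isotony _ _ h1 _ (hT.mem i)
  obtain ⟨w, hw⟩ := hT.vac i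
  refine congrArg (fun S : 𝓕.rep.carrier →L[ℂ] 𝓕.rep.carrier => S z)
    (𝓕.field_ext hs (mul_mem hT2 (𝓕.hom_mem_field (h.map_mem hρO h1 ha2)))
      (mul_mem (𝓕.hom_mem_field ha2) hT2) fun x => ?_)
  obtain ⟨x, rfl⟩ := U.surjective x
  rw [mul_apply_eq_comp, mul_apply_eq_comp, ← 𝓕.vac_intertwines, hρ, hw, hw,
    U.symm_apply_apply, U.symm_apply_apply, w.comm_apply]

theorem adjoint_apply_hom (hT : 𝓕.IsFieldMultiplet X U O T) (h : IsLocalVacuum N π₀) (hs : 1 ≤ s)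
    {ρ : A →⋆ₐ[ℂ] A} (hρO : IsLocalizedIn N ρ O)
    (hρ : ∀ a x, π₀.hom (ρ a) (U x) = U (X.hom a x)) (i : ι) (a : A) (z : 𝓕.rep.carrier) :
    ((T i)†) (𝓕.rep.hom a z) = 𝓕.rep.hom (ρ a) (((T i)†) z) :=
  Repn.adjoint_comm (X := ⟨𝓕.rep.carrier, 𝓕.rep.hom.comp ρ⟩) (Y := 𝓕.rep)
    (hT.apply_hom h hs hρO hρ i) a z

/-- The left inverse determined by a multiplet is implemented by observables. -/
theorem sum_hom_adjoint (hT : 𝓕.IsFieldMultiplet X U O T) (h : IsLocalVacuum N π₀) (hs : 1 ≤ s)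
    {φ : A → A} (hφ : Continuous φ)
    (hφT : ∀ a y x, (∑ i, inner ℂ (((T i)†) (𝓕.vac y)) (𝓕.rep.hom a (((T i)†) (𝓕.vac x))) : ℂ) =
      inner ℂ y (π₀.hom (φ a) x)) (a : A) (z : 𝓕.rep.carrier) :
    ∑ i, T i (𝓕.rep.hom a (((T i)†) z)) = 𝓕.rep.hom (φ a) z := by
  refine N.induction_closed
    (P := fun a => ∑ i, T i (𝓕.rep.hom a (((T i)†) z)) = 𝓕.rep.hom (φ a) z)
    (isClosed_eq (continuous_finsetSum _ fun i _ =>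
      (T i).continuous.comp (𝓕.rep.continuous_hom_apply _))
      ((𝓕.rep.continuous_hom_apply z).comp hφ)) (fun O₁ a ha => ?_) a
  obtain ⟨O₂, h1, h2⟩ := exists_subset_both O O₁
  have ha2 := N.isotony _ _ h2 ha
  have hT2 := fun i => 𝓕.isotony _ _ h1 _ (hT.mem i)
  set B := ∑ i, T i * 𝓕.rep.hom a * star (T i) with hB
  have hBx : ∀ z, B z = ∑ i, T i (𝓕.rep.hom a (((T i)†) z)) := fun z => by
    rw [hB, sum_apply]
    rfl
  -- The sum is a gauge-invariant local field, hence `π(b)`; its matrix elements between vacuum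
  -- vectors identify `b` with `φ a`.
  obtain ⟨b, -, hBb⟩ := 𝓕.exists_eq_hom h hs (B := B) (O := O₂)
    (𝓕.mem_localVN_of_invariant (sum_mem fun i _ =>
      mul_mem (mul_mem (hT2 i) (𝓕.hom_mem_field ha2)) (star_mem (hT2 i))) fun g x => by
        rw [hBx, hBx]
        refine (hT.inv a g _).trans ?_
        rw [𝓕.act_act_inv])
  have hbφ : b = φ a := by
    refine h.ext fun x => ?_
    apply ext_inner_left ℂ
    intro y
    rw [← hφT, ← 𝓕.vac.inner_map_map, 𝓕.vac_intertwines, ← hBb, hBx, inner_sum]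
    simp only [ContinuousLinearMap.adjoint_inner_left]
  rw [← hBx, hBb, hbφ]

end FieldSystem.IsFieldMultiplet

/-- Fields that implement a conjugate endomorphism. -/
theorem Repn.exists_implementers (X : Repn.{u, v} A) {ι : Type} [Fintype ι]
    (T : ι → (X.carrier →L[ℂ] X.carrier)) (σ : A →⋆ₐ[ℂ] A) (r : A)
    (hr : ∀ a z, ∑ i, T i (X.hom a (((T i)†) z)) = X.hom (star r * σ a * r) z) :
    ∃ Q : ι → (X.carrier →L[ℂ] X.carrier),
      (∀ i a z, Q i (X.hom (σ a) z) = X.hom a (Q i z)) ∧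
      ∀ i z, Q i (X.hom r z) = ((T i)†) z := by
  -- Formal sums stand for the vectors `σ(b) r y`, so `σ(b) r y ↦ b (T i)† y` needs no separate
  -- check of well-definedness: the identity of inner products below bounds `R i` by `C`.
  let C : (A →₀ X.carrier) →ₗ[ℂ] X.carrier :=
    Finsupp.lsum ℂ fun b => (X.hom (σ b * r)).toLinearMap
  let R : ι → (A →₀ X.carrier) →ₗ[ℂ] X.carrier := fun i =>
    Finsupp.lsum ℂ fun b => (X.hom b ∘L (T i)†).toLinearMap
  have hC : ∀ b y, C (Finsupp.single b y) = X.hom (σ b) (X.hom r y) := fun b y => by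
    rw [← Repn.hom_mul_apply]
    exact Finsupp.lsum_single _ _ _ _
  have hR : ∀ i b y, R i (Finsupp.single b y) = X.hom b (((T i)†) y) := fun i b y =>
    Finsupp.lsum_single _ _ _ _
  have hstar : ∀ a y z,
      Inner.inner ℂ (X.hom a y) z = (Inner.inner ℂ y (X.hom (star a) z) : ℂ) := by
    intro a y z
    rw [← Repn.hom_star, ContinuousLinearMap.star_eq_adjoint,
      ContinuousLinearMap.adjoint_inner_right]
  have hinner : ∀ f g, (∑ i, Inner.inner ℂ (R i f) (R i g) : ℂ) = Inner.inner ℂ (C f) (C g) := by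
    intro f g
    induction f using Finsupp.induction_linear with
    | zero => simp
    | add f f' hf hf' => simp only [map_add, inner_add_left, Finset.sum_add_distrib, hf, hf']
    | single b y =>
      induction g using Finsupp.induction_linear with
      | zero => simp
      | add g g' hg hg' => simp only [map_add, inner_add_right, Finset.sum_add_distrib, hg, hg']
      | single c z =>
        simp only [hC, hR, hstar, ContinuousLinearMap.adjoint_inner_left]
        rw [← inner_sum]
        simp only [← Repn.hom_mul_apply _ (star b)]
        rw [hr, map_mul σ, map_star]
        simp only [← Repn.hom_mul_apply, mul_assoc]
  have hbound : ∀ i f, ‖R i f‖ ≤ 1 * ‖C f‖ := by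
    intro i f
    have h1 : ∑ i, ‖R i f‖ ^ 2 = ‖C f‖ ^ 2 := by
      have h2 := hinner f f
      simp only [inner_self_eq_norm_sq_to_K] at h2
      refine Complex.ofReal_injective ?_
      push_cast
      exact h2
    rw [one_mul, ← sq_le_sq₀ (norm_nonneg _) (norm_nonneg _), ← h1]
    exact Finset.single_le_sum (f := fun k => ‖R k f‖ ^ 2) (fun _ _ => sq_nonneg _)
      (Finset.mem_univ i)
  choose Q hQ hQ0 using fun i => exists_extension C (R i) 1 (hbound i)
  have hCinv : ∀ a f, ∃ f', X.hom (σ a) (C f) = C f' ∧ ∀ i, X.hom a (R i f) = R i f' := by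
    intro a f
    induction f using Finsupp.induction_linear with
    | zero => exact ⟨0, by simp, fun i => by simp⟩
    | add f g hf hg =>
      obtain ⟨f', h1, h2⟩ := hf
      obtain ⟨g', h3, h4⟩ := hg
      exact ⟨f' + g', by rw [map_add, map_add, map_add, h1, h3], fun i => by
        rw [map_add, map_add, map_add, h2, h4]⟩
    | single b y =>
      refine ⟨Finsupp.single (a * b) y, ?_, fun i => ?_⟩
      · rw [hC, hC, ← Repn.hom_mul_apply, ← map_mul]
      · rw [hR, hR, ← Repn.hom_mul_apply]
  refine ⟨Q, fun i a z => ?_, fun i z => ?_⟩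
  · set E := Q i ∘L X.hom (σ a) - X.hom a ∘L Q i with hE
    have hEz : ∀ z, E z = Q i (X.hom (σ a) z) - X.hom a (Q i z) := fun _ => rfl
    have h1 : ∀ f, E (C f) = 0 := by
      intro f
      obtain ⟨f', h1, h2⟩ := hCinv a f
      rw [hEz, h1, hQ, hQ, h2, sub_self]
    have h2 : ∀ z ∈ (LinearMap.range C)ᗮ, E z = 0 := by
      intro z hz
      -- The range of `C` is invariant under the self-adjoint family `σ(A)`, so its orthogonal
      -- complement is too; on that complement `Q i` is zero.
      have h3 : X.hom (σ a) z ∈ (LinearMap.range C)ᗮ := by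
        rw [Submodule.mem_orthogonal]
        rintro _ ⟨f, rfl⟩
        obtain ⟨f', h4, -⟩ := hCinv (star a) f
        rw [← star_star (σ a), ← hstar, ← map_star, h4]
        exact (Submodule.mem_orthogonal _ _).1 hz _ ⟨f', rfl⟩
      rw [hEz, hQ0 i _ h3, hQ0 i _ hz, map_zero, sub_self]
    have h3 : ∀ y, (E†) y = 0 := by
      intro y
      have h4 : (E†) y ∈ (LinearMap.range C)ᗮ := by
        rw [Submodule.mem_orthogonal]
        rintro _ ⟨f, rfl⟩
        rw [ContinuousLinearMap.adjoint_inner_right, h1, inner_zero_left]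
      rw [← inner_self_eq_zero (𝕜 := ℂ), ContinuousLinearMap.adjoint_inner_left, h2 _ h4,
        inner_zero_right]
    have h4 : E z = 0 := by
      rw [← inner_self_eq_zero (𝕜 := ℂ), ← ContinuousLinearMap.adjoint_inner_right, h3,
        inner_zero_right]
    rw [hEz] at h4
    exact sub_eq_zero.1 h4
  · have h1 := hQ i (Finsupp.single 1 z)
    rw [hC, hR, map_one, map_one] at h1
    exact h1

/-- Endomorphisms that are implemented by multiplets of local fields have conjugates. -/
theorem FieldSystem.IsFieldMultiplet.finite {𝓕 : FieldSystem N π₀} {X : Repn.{u, v} A}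
    {U : X.carrier ≃ₗᵢ[ℂ] π₀.carrier} {O : DoubleCone s} {ι : Type} [Fintype ι]
    {T : ι → (𝓕.rep.carrier →L[ℂ] 𝓕.rep.carrier)} (hT : 𝓕.IsFieldMultiplet X U O T)
    (h : IsLocalVacuum N π₀) (hs : 1 ≤ s) (hB : PropertyB (localVN N π₀))
    (hsep : SeparableSpace π₀.carrier) (hnontriv : Nontriviality N π₀)
    [Nontrivial π₀.carrier] {ρ : Delta N} (hρO : IsLocalizedIn N ρ.endo O)
    (hρ : ∀ a x, π₀.hom (ρ.endo a) (U x) = U (X.hom a x)) : Delta.finite N ρ := by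
  have hT0 : ∃ i, T i ≠ 0 := by
    by_contra! h0
    have h1 := hT.sum
    simp only [h0, mul_zero, Finset.sum_const_zero] at h1
    obtain ⟨x, hx⟩ := exists_ne (0 : π₀.carrier)
    have h2 := congrArg (fun S : 𝓕.rep.carrier →L[ℂ] 𝓕.rep.carrier => S (𝓕.vac x)) h1
    exact hx (𝓕.vac.injective (h2.symm.trans 𝓕.vac.map_zero.symm))
  have hTc := hT.apply_hom h hs hρO hρ
  have hTc' := hT.adjoint_apply_hom h hs hρO hρ
  obtain ⟨Y, j, e, hY, hej, heY, hcyc⟩ :=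
    𝓕.exists_conjugate_repn hs hB h.dual hsep hnontriv hT.mem hT0
  obtain ⟨V, hV⟩ := hY O
  obtain ⟨σ, hσO, hσ⟩ := h.exists_endo hV
  -- `j` intertwines `π₀` with `Y ∘ ρ`; transported by `V` it becomes the arrow `r` from the
  -- identity to `σ ρ`.
  have hjρ : ∀ a x, j (π₀.hom a x) = Y.hom (ρ.endo a) (j x) := by
    intro a x
    refine e.injective (PiLp.ext fun i => ?_)
    rw [hej, heY, hej, 𝓕.vac_intertwines, hTc']
  obtain ⟨r, -, hr⟩ := h.exists_local (O := O)
    (T := V.toContinuousLinearEquiv.toContinuousLinearMap ∘L j) fun a ha x => by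
      change V (j (π₀.hom a x)) = π₀.hom a (V (j x))
      rw [hjρ, hρO a ha, hV a ha]
  replace hr : ∀ x, π₀.hom r x = V (j x) := hr
  have hleft : ∀ a z, ∑ i, T i (𝓕.rep.hom a (((T i)†) z)) =
      𝓕.rep.hom (star r * σ a * r) z := by
    refine hT.sum_hom_adjoint h hs (φ := fun a => star r * σ a * r)
      ((continuous_const.mul (continuous_starAlgHom σ)).mul continuous_const) fun a y x => ?_
    rw [Repn.hom_mul_apply, Repn.hom_mul_apply, ← Repn.hom_star,
      ContinuousLinearMap.star_eq_adjoint, ContinuousLinearMap.adjoint_inner_right, hr, hr, hσ,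
      V.inner_map_map, ← e.inner_map_map, PiLp.inner_apply]
    simp only [heY, hej]
  obtain ⟨Q, hQσ, hQr⟩ := 𝓕.rep.exists_implementers T σ r hleft
  -- The operator `∑ Q i T i` intertwines `π ∘ ρ ∘ σ` with `π`. Its compression to the vacuum space
  -- commutes with `A(O')`, so it is given by a local observable `q`.
  obtain ⟨q, -, hq⟩ := h.exists_local (O := O)
    (T := 𝓕.vacOp† ∘L (∑ i, Q i * T i) ∘L 𝓕.vacOp) fun a ha x => by
      change (𝓕.vacOp†) ((∑ i, Q i * T i) (𝓕.vac (π₀.hom a x))) =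
        π₀.hom a ((𝓕.vacOp†) ((∑ i, Q i * T i) (𝓕.vac x)))
      rw [← 𝓕.adjoint_vac_comm, 𝓕.vac_intertwines, sum_apply, sum_apply, map_sum (𝓕.rep.hom a)]
      congr 1
      refine Finset.sum_congr rfl fun i _ => ?_
      rw [mul_apply_eq_comp, mul_apply_eq_comp, ← hQσ, hσO a ha]
      conv_lhs => rw [← hρO a ha, hTc]
  replace hq : ∀ x, π₀.hom q x = (𝓕.vacOp†) (∑ i, Q i (T i (𝓕.vac x))) := fun x => by
    rw [hq]
    change (𝓕.vacOp†) ((∑ i, Q i * T i) (𝓕.vac x)) = _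
    rw [sum_apply]
    rfl
  have hqc : ∀ a, q * ρ.endo (σ a) = a * q := by
    intro a
    refine h.ext fun x => ?_
    rw [Repn.hom_mul_apply, Repn.hom_mul_apply, hq, hq, ← 𝓕.adjoint_vac_comm,
      map_sum (𝓕.rep.hom a)]
    simp only [𝓕.vac_intertwines, hTc, hQσ]
  have hqr : q * ρ.endo r = 1 := by
    refine h.ext fun x => ?_
    rw [Repn.hom_mul_apply, hq]
    simp only [𝓕.vac_intertwines, hTc, hQr]
    have h1 := congrArg (fun S : 𝓕.rep.carrier →L[ℂ] 𝓕.rep.carrier => S (𝓕.vac x)) hT.sum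
    have h2 : ∑ i, ((T i)†) (T i (𝓕.vac x)) = 𝓕.vac x := by
      simpa only [sum_apply, mul_apply_eq_comp, ContinuousLinearMap.star_eq_adjoint,
        one_apply_eq_self] using h1
    rw [h2, 𝓕.adjoint_vac_apply, map_one]
    rfl
  have hrc : ∀ a, r * a = σ (ρ.endo a) * r := by
    intro a
    refine h.ext fun x => ?_
    rw [Repn.hom_mul_apply, Repn.hom_mul_apply, hr, hr, hσ, hjρ]
  have hqr' : σ q * r = 1 := by
    -- The equation `q ρ(r) = 1` gives `σ(q) r = 1` on the vectors `σ(a) r x`, which are total by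
    -- cyclicity of the conjugate representation.
    have h1 : ∀ a, σ q * r * (σ a * r) = σ a * r := by
      intro a
      calc σ q * r * (σ a * r) = σ q * (r * σ a) * r := by simp only [mul_assoc]
        _ = σ (q * ρ.endo (σ a)) * (r * r) := by rw [hrc, map_mul]; simp only [mul_assoc]
        _ = σ a * (σ q * (r * r)) := by rw [hqc, map_mul, mul_assoc]
        _ = σ a * (σ (q * ρ.endo r) * r) := by rw [hrc, map_mul]; simp only [mul_assoc]
        _ = σ a * r := by rw [hqr, map_one, one_mul]
    have h2 : ∀ y ∈ Submodule.span ℂ {y : Y.carrier | ∃ a, ∃ x, y = Y.hom a (j x)},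
        π₀.hom (σ q * r) (V y) = V y := by
      intro y hy
      induction hy using Submodule.span_induction with
      | mem y hy =>
        obtain ⟨a, x, rfl⟩ := hy
        rw [← hσ, ← hr, ← π₀.hom_mul_apply (σ a), ← Repn.hom_mul_apply, h1]
      | zero => rw [map_zero, map_zero]
      | add y z _ _ hy hz => rw [map_add, map_add, hy, hz]
      | smul c y _ hy => rw [map_smul, map_smul, hy]
    refine h.ext fun x => ?_
    obtain ⟨y, rfl⟩ := V.surjective x
    rw [map_one]
    exact hcyc.induction (P := fun y => π₀.hom (σ q * r) (V y) = V y) h2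
      (isClosed_eq ((π₀.hom _).continuous.comp V.continuous) V.continuous) y
  refine ⟨⟨σ, ⟨O, hσO⟩, h.isTransportable hY hV hσ⟩, r, star q, ⟨hrc, fun a => ?_, ?_, ?_⟩⟩
  · have h1 := congrArg star (hqc (star a))
    simp only [star_mul, map_star, star_star] at h1
    exact h1.symm
  · simp only [Delta.tensorArrow, star_star, map_one, mul_one, one_mul]
    exact hqr
  · have h1 := congrArg star hqr'
    simp only [star_mul, star_one] at h1
    simp only [Delta.tensorArrow, map_one, mul_one, one_mul, map_star]
    exact h1

end ConjugateEndomorphisms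

-- The main theorem

theorem mainTheorem8 {s : ℕ} (hs : 1 ≤ s) {A : Type u} [CStarAlgebra A]
    (N : ObservableNet s A) (ω₀ : A →ₗ[ℂ] ℂ) (hω₀ : IsState ω₀)
    (π₀ : Repn.{u, v} A) (Ω : π₀.carrier) (hGNS : IsGNS ω₀ π₀ Ω)
    (hmicro : N.Microcausality)
    (hB : PropertyB (localVN N π₀))
    (hdual : HaagDuality N π₀)
    (hsep : SeparableSpace π₀.carrier)
    (hnontriv : Nontriviality N π₀)
    (𝓕 : FieldSystem N π₀) :
    -- a subrepresentation of `π` is DHR exactly when its space is nonzero and separable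
    (∀ X : Repn.{u, v} A, X.IsSubrep 𝓕.rep →
      (IsDHR N π₀ X ↔ Nontrivial X.carrier ∧ SeparableSpace X.carrier)) ∧
    -- this includes all irreducible subrepresentations and all finite direct sums of them
    (∀ X : Repn.{u, v} A, X.IsSubrep 𝓕.rep → X.IsFiniteSum → SeparableSpace X.carrier) ∧
    -- the faithful functor to DHR representations, identical on objects and arrows
    (∃ F : 𝓕.RepF.FullSubcategory ⥤ (IsDHR N π₀).FullSubcategory,
      F.Faithful ∧ F ⋙ (IsDHR N π₀).ι = 𝓕.RepF.ι) ∧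
    -- the faithful functor to `Δ`, inverse to `ρ ↦ π₀ ∘ ρ` up to unitary equivalence, which takes
    -- finite direct sums of irreducibles to `Δ_f`
    (Function.Injective π₀.hom →
      (∀ O, localVN N π₀ O = π₀.hom '' (N.alg O : Set A)) →
      ∃ Φ : 𝓕.RepF.FullSubcategory ⥤ Delta N,
        Φ.Faithful ∧
        (∃ e : Φ ⋙ Delta.toRepn N π₀ ≅ 𝓕.RepF.ι,
          ∀ X, Isometry (Repn.Hom.op (e.hom.app X))) ∧
        ∃ Φf : 𝓕.RepFfin.FullSubcategory ⥤ (Delta.finite N).FullSubcategory,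
          Φf.Faithful ∧
          Φf ⋙ (Delta.finite N).ι = ObjectProperty.ιOfLE 𝓕.repFfin_le ⋙ Φ) := by
  refine ⟨fun X hX => 𝓕.isDHR_iff hGNS hB hdual hsep hnontriv hX,
    fun X hX hfin => 𝓕.separableSpace_of_isFiniteSum hs hsep hX hfin, ?_, fun hinj hweak => ?_⟩
  · have hle : 𝓕.RepF ≤ IsDHR N π₀ := fun X hX =>
      (𝓕.isDHR_iff hGNS hB hdual hsep hnontriv hX.1).2 hX.2
    exact ⟨ObjectProperty.ιOfLE hle, inferInstance, rfl⟩
  · have h : IsLocalVacuum N π₀ := ⟨hmicro, hdual, hinj, hweak⟩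
    have hnt : Nontrivial π₀.carrier := ⟨⟨Ω, 0, fun h0 => by
      have := hGNS.norm_eq
      rw [h0, norm_zero] at this
      exact zero_ne_one this⟩⟩
    have hDHR : ∀ X : 𝓕.RepF.FullSubcategory, IsDHR N π₀ X.obj := fun X =>
      (𝓕.isDHR_iff hGNS hB hdual hsep hnontriv X.property.1).2 X.property.2
    -- All objects are localized in the same fixed cone, so each intertwiner is transported to an
    -- element of `A`.
    choose U hU using fun X => hDHR X (bigCone s 0)
    choose ρ hρO hρ using fun X => h.exists_endo (hU X)
    choose t _ ht using fun (X Y : 𝓕.RepF.FullSubcategory) (f : X ⟶ Y) =>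
      h.exists_transport (hU X) (hU Y) (T := Repn.Hom.op f.hom)
        fun a _ x => Repn.Hom.comm_apply f.hom a x
    have hext : ∀ (X : 𝓕.RepF.FullSubcategory) (a b : A),
        (∀ x, π₀.hom a (U X x) = π₀.hom b (U X x)) → a = b := fun X a b hab =>
      h.ext fun x => by simpa using hab ((U X).symm x)
    let Φ : 𝓕.RepF.FullSubcategory ⥤ Delta N :=
      { obj := fun X => ⟨ρ X, ⟨_, hρO X⟩, h.isTransportable (hDHR X) (hU X) (hρ X)⟩
        map := fun {X Y} f => Delta.Hom.mk (t X Y f)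
          (h.intertwines (hρ X) (hρ Y) (Repn.Hom.comm_apply f.hom) (ht X Y f))
        map_id := fun X => Delta.Hom.ext (hext X _ _ fun x => by
          rw [ht]
          change _ = π₀.hom 1 (U X x)
          rw [map_one]
          rfl)
        map_comp := fun {X Y Z} f g => Delta.Hom.ext (hext X _ _ fun x => by
          rw [ht]
          change _ = π₀.hom (t Y Z g * t X Y f) (U X x)
          rw [Repn.hom_mul_apply, ht, ht]
          rfl) }
    have hΦ : Φ.Faithful := ⟨fun {X Y} f g hfg => by
      have h1 : t X Y f = t X Y g := congrArg Delta.Hom.elt hfg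
      refine ObjectProperty.hom_ext _ (Repn.Hom.ext (ContinuousLinearMap.ext fun x => ?_))
      apply (U Y).injective
      rw [← ht, ← ht, h1]⟩
    refine ⟨Φ, hΦ, ⟨NatIso.ofComponents (fun X =>
      { hom := Repn.Hom.mk' (X := ⟨π₀.carrier, π₀.hom.comp (ρ X)⟩)
          (U X).symm.toContinuousLinearEquiv.toContinuousLinearMap fun a x => by
            change (U X).symm (π₀.hom (ρ X a) x) = X.obj.hom a ((U X).symm x)
            rw [LinearIsometryEquiv.symm_apply_eq, ← hρ, LinearIsometryEquiv.apply_symm_apply]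
        inv := Repn.Hom.mk' (Y := ⟨π₀.carrier, π₀.hom.comp (ρ X)⟩)
          (U X).toContinuousLinearEquiv.toContinuousLinearMap fun a x => (hρ X a x).symm
        hom_inv_id := Repn.Hom.ext (ContinuousLinearMap.ext (U X).apply_symm_apply)
        inv_hom_id := Repn.Hom.ext (ContinuousLinearMap.ext (U X).symm_apply_apply) })
      (fun {X Y} f => Repn.Hom.ext (ContinuousLinearMap.ext fun (x : π₀.carrier) => by
        change (U Y).symm (π₀.hom (t X Y f) x) = Repn.Hom.op f.hom ((U X).symm x)
        rw [LinearIsometryEquiv.symm_apply_eq, ← ht, LinearIsometryEquiv.apply_symm_apply])),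
      fun X => (U X).symm.isometry⟩, ?_⟩
    have hfin : ∀ X : 𝓕.RepFfin.FullSubcategory,
        Delta.finite N ((ObjectProperty.ιOfLE 𝓕.repFfin_le ⋙ Φ).obj X) := by
      intro X
      obtain ⟨ι, _, T, hT⟩ := 𝓕.exists_isFieldMultiplet_of_isFiniteSum h hs hB hsep hnontriv
        X.property.1.1 X.property.2 (hU ((ObjectProperty.ιOfLE 𝓕.repFfin_le).obj X))
      exact hT.finite h hs hB hsep hnontriv (hρO _)
        (hρ ((ObjectProperty.ιOfLE 𝓕.repFfin_le).obj X))
    refine ⟨ObjectProperty.lift _ (ObjectProperty.ιOfLE 𝓕.repFfin_le ⋙ Φ) hfin,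
      inferInstance, rfl⟩
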